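/- **Setting.** Let $\mathfrak H,\mathfrak H_*$ be complex separable Hilbert spaces, let $X_0:\mathfrak H\to\mathfrak H_*$ be a densely defined closed operator and $X_1:\mathfrak H\to\mathfrak H_*$ a bounded operator. For $t\in\mathbb R$ put $X(t)=X_0+tX_1$ on $\operatorname{Dom}X_0$ and $A(t)=X(t)^*X(t)$. Let $\mathfrak N=\operatorname{Ker}A(0)=\operatorname{Ker}X_0$, $n=\dim\mathfrak N$, and let $P$ be the orthogonal projection of $\mathfrak H$ onto $\mathfrak N$. Assume that $0$ is an isolated point of the spectrum of $A(0)$ and that $0<n<\infty$, $n\le\dim\operatorname{Ker}X_0^*\le\infty$. Let $d^0\in(0,\infty]$ be the distance from $0$ to the rest of the spectrum of $A(0)$. Fix $\delta>0$ with $8\delta<d^0$ and $t_0>0$ with $t_0\le\delta^{1/2}\|X_1\|^{-1}$, and assume that for some $c_*>0$ $$A(t)\ge c_*t^2I,\qquad |t|\le t_0 .$$ For $\omega\in\mathfrak N$ let $\varphi(\omega)\in\operatorname{Dom}X_0\cap\mathfrak N^\perp$ be the weak solution of $X_0^*(X_0\varphi+X_1\omega)=0$. Put $Zu=\varphi(Pu)$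 for $u\in\mathfrak H$, $R=(X_0Z+X_1)|_{\mathfrak N}$, $S=R^*R:\mathfrak N\to\mathfrak N$, and $$N=Z^*X_1^*RP+(RP)^*X_1Z .$$ Let $\gamma_1^\circ,\dots,\gamma_p^\circ$ be the distinct eigenvalues of $S$, let $P_j$ be the orthogonal projection of $\mathfrak H$ onto $\operatorname{Ker}(S-\gamma_j^\circ I_{\mathfrak N})$, and put $$N_0=\sum_{j=1}^pP_jNP_j,\qquad c^\circ=\min\bigl\{\min\{c_*,\,n^{-1}|\gamma_l^\circ-\gamma_j^\circ|\}\;:\; j\ne l,\ P_jNP_l\ne0\bigr\},$$ where $c^\circ=+\infty$, $(c^\circ)^{-1}=0$ if there are no such pairs $(j,l)$. Finally put $$\mathcal J_1(t,\tau)=\cos(\tau A(t)^{1/2})P-\cos(\tau(t^2S)^{1/2})P,$$ $$\mathcal J_2(t,\tau)=A(t)^{-1/2}\sin(\tau A(t)^{1/2})P-(t^2S)^{-1/2}\sin(\tau(t^2S)^{1/2})P,$$ where $\lambda^{-1/2}\sin(\tau\lambda^{1/2})$ is understood as $\tau$ at $\lambda=0$. **Theorem.** There are absolute constants $\beta_1,\beta_2,\beta_7,\beta_9,\beta_{11},\beta_{12},\beta_{13}\ge1$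 such that in every such setting the following holds. (i) If $N=0$, then for all $\varepsilon>0$, $\tau\in\mathbb R$ and $|t|\le t_0$ $$\|\mathcal J_1(t,\varepsilon^{-1}\tau)\|\,\varepsilon^{3/2}(t^2+\varepsilon^2)^{-3/4}\le\bigl(2C_1+C_9'|\tau|^{1/2}\bigr)\varepsilon,$$ $$\|\mathcal J_2(t,\varepsilon^{-1}\tau)\|\,\varepsilon^{1/2}(t^2+\varepsilon^2)^{-1/4}\le C_7+C_{10}'|\tau|^{1/2},$$ where $C_9'=\max\{C_9,2\}$, $C_{10}'=\max\{C_{10},2c_*^{-1/2}\}$ and $$C_1=\beta_1\delta^{-1/2}\|X_1\|,\qquad C_7=\beta_7\delta^{-1/2}c_*^{-1/2}\|X_1\|\bigl(1+c_*^{-1}\|X_1\|^2\bigr),$$ $$C_9=\beta_9\delta^{-1}\|X_1\|^3\bigl(1+c_*^{-1/2}\|X_1\|+c_*^{-3/2}\|X_1\|^3+c_*^{-5/2}\|X_1\|^5\bigr),\qquad C_{10}=c_*^{-1/2}C_9 .$$ (ii) If $N_0=0$ and the number $t^{00}\le t_0$ satisfies $t^{00}\le(4\beta_2)^{-1}\delta^{1/2}\|X_1\|^{-3}c^\circ$,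 then for all $\varepsilon>0$, $\tau\in\mathbb R$ and $|t|\le t^{00}$ $$\|\mathcal J_1(t,\varepsilon^{-1}\tau)\|\,\varepsilon^{3/2}(t^2+\varepsilon^2)^{-3/4}\le\bigl(C_{11}+C_{12}'|\tau|^{1/2}\bigr)\varepsilon,$$ $$\|\mathcal J_2(t,\varepsilon^{-1}\tau)\|\,\varepsilon^{1/2}(t^2+\varepsilon^2)^{-1/4}\le C_{13}+C_{14}'|\tau|^{1/2},$$ where $C_{12}'=\max\{C_{12},2\}$, $C_{14}'=\max\{C_{14},2c_*^{-1/2}\}$ and $$C_{11}=\beta_{11}\delta^{-1/2}\|X_1\|\bigl(1+n^2c_*^{-1/2}\|X_1\|^3(c^\circ)^{-1}\bigr),$$ $$C_{12}=\beta_{12}\delta^{-1}\|X_1\|^3\bigl(1+c_*^{-1/2}\|X_1\|+c_*^{-3/2}\|X_1\|^3+c_*^{-5/2}\|X_1\|^5\bigr)+\beta_{12}\delta^{-1}c_*^{-1/2}\|X_1\|^8n^2(c^\circ)^{-2},$$ $$C_{13}=\beta_{13}\delta^{-1/2}c_*^{-1/2}\|X_1\|\bigl(1+c_*^{-1}\|X_1\|^2+n^2c_*^{-1/2}\|X_1\|^3(c^\circ)^{-1}\bigr),\qquad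 C_{14}=c_*^{-1/2}C_{12}.$$ -/

import Mathlib

open scoped ENNReal InnerProductSpace

set_option linter.unusedSectionVars false

noncomputable section

namespace OperatorPencil

universe u v

/-! ### Unbounded operators: `X* X`, resolvents, spectrum, bounded functions -/

section Unbounded

variable {H : Type u} {Hs : Type v}
  [NormedAddCommGroup H] [InnerProductSpace ℂ H] [CompleteSpace H]
  [NormedAddCommGroup Hs] [InnerProductSpace ℂ Hs] [CompleteSpace Hs]

/-- The kernel of a partially defined linear operator, as a subspace of the ambient space. -/
def kernel (X : H →ₗ.[ℂ] Hs) : Submodule ℂ H :=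
  (LinearMap.ker X.toFun).map X.domain.subtype

/-- The operator `X* X`, with domain `{u ∈ Dom X | X u ∈ Dom X*}`. -/
def gram (X : H →ₗ.[ℂ] Hs) : H →ₗ.[ℂ] H where
  domain :=
    { carrier := {u | ∃ h : u ∈ X.domain, X ⟨u, h⟩ ∈ (LinearPMap.adjoint X).domain}
      add_mem' := by
        rintro a b ⟨ha, ha'⟩ ⟨hb, hb'⟩
        exact ⟨X.domain.add_mem ha hb, by
          simpa [← LinearPMap.map_add] using Submodule.add_mem _ ha' hb'⟩
      zero_mem' := ⟨X.domain.zero_mem, by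
        have : X ⟨0, X.domain.zero_mem⟩ = 0 := X.map_zero
        rw [this]; exact Submodule.zero_mem _⟩
      smul_mem' := by
        rintro c a ⟨ha, ha'⟩
        exact ⟨X.domain.smul_mem c ha, by
          simpa [← LinearPMap.map_smul] using Submodule.smul_mem _ c ha'⟩ }
  toFun :=
    { toFun := fun u => LinearPMap.adjoint X ⟨X ⟨u, u.2.choose⟩, u.2.choose_spec⟩
      map_add' := by
        intro a b
        rw [← LinearPMap.map_add]
        congr 1
        ext
        simp [← LinearPMap.map_add]
      map_smul' := by
        intro c a
        rw [RingHom.id_apply, ← LinearPMap.map_smul]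
        congr 1
        ext
        simp [← LinearPMap.map_smul] }

/-- `T = (A - z)⁻¹` as a bounded everywhere defined operator. -/
def IsResolvent (A : H →ₗ.[ℂ] H) (z : ℂ) (T : H →L[ℂ] H) : Prop :=
  (∀ u : H, ∃ h : T u ∈ A.domain, A ⟨T u, h⟩ - z • T u = u) ∧
    ∀ v : A.domain, T (A v - z • (v : H)) = v

/-- The spectrum of a (possibly unbounded) operator: the complement of the set of those `z`
for which `A - z` has a bounded everywhere defined inverse. -/
def spec (A : H →ₗ.[ℂ] H) : Set ℂ := {z | ¬ ∃ T : H →L[ℂ] H, IsResolvent A z T}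

/-- The operator `(I + A)⁻¹` (for `A = X* X` it exists, see `isResolvent_resolventNegOne`). -/
def resolventNegOne (A : H →ₗ.[ℂ] H) : H →L[ℂ] H :=
  Classical.epsilon (IsResolvent A (-1))

/-- The bounded operator `f(A)` for a nonnegative selfadjoint operator `A` and a bounded
continuous function `f` on `[0, ∞)`. With `T = (I + A)⁻¹` and `x = (1 + λ)⁻¹`, it is the bounded
operator with `f(A) T = g(T)`, where `g(x) = x f(x⁻¹ - 1) = (1 + λ)⁻¹ f(λ)` is continuous on
`[0, 1]` and `g(T)` is given by the continuous functional calculus: `f(A)` is the continuous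
extension of `T u ↦ g(T) u` from the dense range of `T`
(see `boundedFun_comp_resolventNegOne`). -/
def boundedFun (f : ℝ → ℝ) (A : H →ₗ.[ℂ] H) : H →L[ℂ] H :=
  ((cfc (fun x : ℝ => x * f (x⁻¹ - 1)) (resolventNegOne A) : H →L[ℂ] H) :
      H →ₗ[ℂ] H).extendOfNorm ((resolventNegOne A : H →L[ℂ] H) : H →ₗ[ℂ] H)


/-! #### Existence facts: von Neumann's theorem for `X* X` and the functional calculus -/

theorem gram_spec {X : H →ₗ.[ℂ] Hs} (hX : Dense (X.domain : Set H)) (a : (gram X).domain) :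
    ∃ h : (a : H) ∈ X.domain, ∀ w : X.domain, ⟪X w, X ⟨a, h⟩⟫_ℂ = ⟪(w : H), gram X a⟫_ℂ := by
  obtain ⟨a, h, h'⟩ := a
  refine ⟨h, fun w => ?_⟩
  have := LinearPMap.adjoint_isFormalAdjoint hX ⟨X ⟨a, h⟩, h'⟩ w
  rw [← inner_conj_symm, ← this, inner_conj_symm]
  rfl

theorem gram_mk {X : H →ₗ.[ℂ] Hs} (hX : Dense (X.domain : Set H)) (v : X.domain) (y : H)
    (hv : ∀ w : X.domain, ⟪X w, X v⟫_ℂ = ⟪(w : H), y⟫_ℂ) :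
    ∃ h : (v : H) ∈ (gram X).domain, gram X ⟨v, h⟩ = y := by
  have h1 : ∀ w : X.domain, ⟪y, (w : H)⟫_ℂ = ⟪X v, X w⟫_ℂ := fun w => by
    rw [← inner_conj_symm, ← hv, inner_conj_symm]
  have hm := LinearPMap.mem_adjoint_domain_of_exists (T := X) (X v) ⟨y, h1⟩
  exact ⟨⟨v.2, hm⟩, LinearPMap.adjoint_apply_eq hX ⟨X v, hm⟩ h1⟩

theorem exists_graph_solver {X : H →ₗ.[ℂ] Hs} (hc : X.IsClosed) :
    ∃ K : WithLp 2 (H × Hs) →L[ℂ] H, ∀ p, ∃ h : K p ∈ X.domain, ∀ w : X.domain,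
      ⟪(w : H), p.fst - K p⟫_ℂ + ⟪X w, p.snd - X ⟨K p, h⟩⟫_ℂ = 0 := by
  let e : WithLp 2 (H × Hs) ≃L[ℂ] H × Hs := WithLp.prodContinuousLinearEquiv 2 ℂ H Hs
  let G : Submodule ℂ (WithLp 2 (H × Hs)) :=
    X.graph.comap (e : WithLp 2 (H × Hs) →ₗ[ℂ] H × Hs)
  have hG : IsClosed (G : Set (WithLp 2 (H × Hs))) := hc.preimage e.continuous
  have : CompleteSpace G := hG.completeSpace_coe
  refine ⟨(ContinuousLinearMap.fst ℂ H Hs) ∘L (e : WithLp 2 (H × Hs) →L[ℂ] H × Hs) ∘L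
    G.starProjection, fun p => ?_⟩
  have hm : G.starProjection p ∈ G := G.starProjection_apply_mem p
  obtain ⟨y, hy1, hy2⟩ := (LinearPMap.mem_graph_iff X).1 (show e (G.starProjection p) ∈ X.graph from hm)
  have hdom : (e (G.starProjection p)).1 ∈ X.domain := hy1 ▸ y.2
  refine ⟨hdom, fun w => ?_⟩
  have hw : e.symm ((w : H), X w) ∈ G := by
    change e (e.symm ((w : H), X w)) ∈ X.graph
    rw [e.apply_symm_apply]
    exact X.mem_graph w
  have h0 := Submodule.sub_starProjection_mem_orthogonal (K := G) p _ hw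
  rw [WithLp.prod_inner_apply] at h0
  have e1 : X ⟨(e (G.starProjection p)).1, hdom⟩ = (e (G.starProjection p)).2 := by
    rw [← hy2]; congr 1; exact Subtype.ext hy1.symm
  change ⟪(w : H), p.fst - (e (G.starProjection p)).1⟫_ℂ +
    ⟪X w, p.snd - X ⟨(e (G.starProjection p)).1, hdom⟩⟫_ℂ = 0
  rw [e1]
  exact h0

/-- For a closed densely defined `X`, the operator `(I + X* X)⁻¹` exists. -/
theorem exists_isResolvent_gram {X : H →ₗ.[ℂ] Hs} (hX : Dense (X.domain : Set H))
    (hc : X.IsClosed) : ∃ T : H →L[ℂ] H, IsResolvent (gram X) (-1) T := by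
  obtain ⟨K, hK⟩ := exists_graph_solver hc
  let T : H →L[ℂ] H := K ∘L (WithLp.prodContinuousLinearEquiv 2 ℂ H Hs).symm.toContinuousLinearMap
    ∘L ContinuousLinearMap.inl ℂ H Hs
  have hT : ∀ u : H, ∃ h : T u ∈ X.domain, ∀ w : X.domain,
      ⟪X w, X ⟨T u, h⟩⟫_ℂ = ⟪(w : H), u - T u⟫_ℂ := by
    intro u
    obtain ⟨h, h'⟩ := hK ((WithLp.prodContinuousLinearEquiv 2 ℂ H Hs).symm (u, 0))
    refine ⟨h, fun w => ?_⟩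
    have := h' w
    have h2 : ((WithLp.prodContinuousLinearEquiv 2 ℂ H Hs).symm (u, (0 : Hs))).snd = 0 := rfl
    rw [h2, zero_sub, inner_neg_right, ← sub_eq_add_neg, sub_eq_zero] at this
    exact this.symm
  have hT' : ∀ u : H, ∃ h : T u ∈ (gram X).domain, gram X ⟨T u, h⟩ - (-1 : ℂ) • T u = u := by
    intro u
    obtain ⟨h, h'⟩ := hT u
    obtain ⟨h1, h2⟩ := gram_mk hX ⟨T u, h⟩ (u - T u) h'
    exact ⟨h1, by rw [h2]; simp⟩
  refine ⟨T, hT', fun v => ?_⟩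
  obtain ⟨t, ht⟩ : ∃ t, t = T (gram X v - (-1 : ℂ) • (v : H)) := ⟨_, rfl⟩
  obtain ⟨h, e⟩ := hT' (gram X v - (-1 : ℂ) • (v : H))
  simp only [← ht] at h e ⊢
  have hd : gram X (⟨t, h⟩ - v) + ((⟨t, h⟩ - v : (gram X).domain) : H) = 0 := by
    rw [LinearPMap.map_sub, Submodule.coe_sub]
    have e' : gram X ⟨t, h⟩ + t = gram X v + v := by
      simpa only [neg_smul, one_smul, sub_neg_eq_add] using e
    rw [sub_add_sub_comm, e', sub_self]
  obtain ⟨hx, hx'⟩ := gram_spec hX (⟨t, h⟩ - v)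
  have h3 := hx' ⟨_, hx⟩
  rw [eq_neg_of_add_eq_zero_left hd, inner_neg_right, inner_self_eq_norm_sq_to_K,
    inner_self_eq_norm_sq_to_K] at h3
  have h4 : ‖X ⟨_, hx⟩‖ ^ 2 = -‖((⟨t, h⟩ - v : (gram X).domain) : H)‖ ^ 2 := by exact_mod_cast h3
  have h5 : ((⟨t, h⟩ - v : (gram X).domain) : H) = 0 := by
    rw [← norm_eq_zero]; nlinarith [sq_nonneg ‖X ⟨_, hx⟩‖, norm_nonneg ((⟨t, h⟩ - v : (gram X).domain) : H)]
  rw [Submodule.coe_sub, sub_eq_zero] at h5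
  exact h5

theorem isResolvent_resolventNegOne {X : H →ₗ.[ℂ] Hs} (hX : Dense (X.domain : Set H))
    (hc : X.IsClosed) : IsResolvent (gram X) (-1) (resolventNegOne (gram X)) :=
  Classical.epsilon_spec (exists_isResolvent_gram hX hc)

theorem resolventNegOne_spec {X : H →ₗ.[ℂ] Hs} (hX : Dense (X.domain : Set H))
    (hc : X.IsClosed) (u : H) : ∃ h : resolventNegOne (gram X) u ∈ X.domain, ∀ w : X.domain,
      ⟪X w, X ⟨resolventNegOne (gram X) u, h⟩⟫_ℂ =
        ⟪(w : H), u - resolventNegOne (gram X) u⟫_ℂ := by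
  obtain ⟨h, e⟩ := (isResolvent_resolventNegOne hX hc).1 u
  obtain ⟨h1, h2⟩ := gram_spec hX ⟨_, h⟩
  refine ⟨h1, fun w => ?_⟩
  rw [h2 w]
  congr 1
  rw [eq_sub_iff_add_eq]
  simpa using e

theorem resolventNegOne_inner {X : H →ₗ.[ℂ] Hs} (hX : Dense (X.domain : Set H))
    (hc : X.IsClosed) (u v : H) : ∃ h h',
      ⟪resolventNegOne (gram X) u, v⟫_ℂ =
        ⟪resolventNegOne (gram X) u, resolventNegOne (gram X) v⟫_ℂ +
        ⟪X ⟨resolventNegOne (gram X) u, h⟩, X ⟨resolventNegOne (gram X) v, h'⟩⟫_ℂ := by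
  obtain ⟨h, -⟩ := resolventNegOne_spec hX hc u
  obtain ⟨h', e⟩ := resolventNegOne_spec hX hc v
  refine ⟨h, h', ?_⟩
  rw [e ⟨_, h⟩, ← inner_add_right, add_sub_cancel]

theorem isSelfAdjoint_resolventNegOne {X : H →ₗ.[ℂ] Hs} (hX : Dense (X.domain : Set H))
    (hc : X.IsClosed) : IsSelfAdjoint (resolventNegOne (gram X)) := by
  rw [ContinuousLinearMap.isSelfAdjoint_iff_isSymmetric]
  intro u v
  obtain ⟨h, h', e⟩ := resolventNegOne_inner hX hc u v
  obtain ⟨k, k', e'⟩ := resolventNegOne_inner hX hc v u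
  change ⟪resolventNegOne (gram X) u, v⟫_ℂ = ⟪u, resolventNegOne (gram X) v⟫_ℂ
  rw [e, ← inner_conj_symm u, e', map_add, inner_conj_symm, inner_conj_symm]

theorem spectrum_resolventNegOne {X : H →ₗ.[ℂ] Hs} (hX : Dense (X.domain : Set H))
    (hc : X.IsClosed) : spectrum ℝ (resolventNegOne (gram X)) ⊆ Set.Icc 0 1 := by
  set T := resolventNegOne (gram X) with hT
  have key : ∀ u, ‖T u‖ ^ 2 ≤ (⟪T u, u⟫_ℂ).re := fun u => by
    obtain ⟨h, h', e⟩ : ∃ h h', ⟪T u, u⟫_ℂ = ⟪T u, T u⟫_ℂ + ⟪X ⟨T u, h⟩, X ⟨T u, h'⟩⟫_ℂ :=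
      resolventNegOne_inner hX hc u u
    rw [e, inner_self_eq_norm_sq_to_K, inner_self_eq_norm_sq_to_K]
    have : ((‖T u‖ : ℂ) ^ 2 + (‖X ⟨T u, h⟩‖ : ℂ) ^ 2).re = ‖T u‖ ^ 2 + ‖X ⟨T u, h⟩‖ ^ 2 := by
      norm_cast
    exact le_of_le_of_eq (by nlinarith [sq_nonneg ‖X ⟨T u, h⟩‖]) this.symm
  have hn : ‖T‖ ≤ 1 := ContinuousLinearMap.opNorm_le_bound _ zero_le_one fun u => by
    have h1 := key u
    have h2 : (⟪T u, u⟫_ℂ).re ≤ ‖T u‖ * ‖u‖ := (Complex.re_le_norm _).trans (norm_inner_le_norm _ _)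
    rw [one_mul]
    by_contra h
    push Not at h
    nlinarith [norm_nonneg u, norm_nonneg (T u)]
  have hp : T.IsPositive := by
    rw [ContinuousLinearMap.isPositive_def]
    exact ⟨(ContinuousLinearMap.isSelfAdjoint_iff_isSymmetric).1
      (isSelfAdjoint_resolventNegOne hX hc), fun u => (sq_nonneg _).trans (key u)⟩
  intro x hx
  refine ⟨spectrum_nonneg_of_nonneg ((ContinuousLinearMap.nonneg_iff_isPositive T).2 hp) hx, ?_⟩
  have h1 := spectrum.norm_le_norm_mul_of_mem hx
  have h2 : ‖(1 : H →L[ℂ] H)‖ ≤ 1 := ContinuousLinearMap.norm_id_le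
  exact (le_abs_self x).trans (h1.trans (mul_le_one₀ hn (norm_nonneg _) h2))

theorem denseRange_resolventNegOne {X : H →ₗ.[ℂ] Hs} (hX : Dense (X.domain : Set H))
    (hc : X.IsClosed) : DenseRange (resolventNegOne (gram X)) := by
  set T := resolventNegOne (gram X) with hT
  have hker : LinearMap.ker (T : H →ₗ[ℂ] H) = ⊥ := by
    rw [LinearMap.ker_eq_bot']
    intro u hu
    have hu : T u = 0 := hu
    obtain ⟨h, e⟩ : ∃ h : T u ∈ (gram X).domain, gram X ⟨T u, h⟩ - (-1 : ℂ) • T u = u :=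
      (isResolvent_resolventNegOne hX hc).1 u
    have h0 : (⟨T u, h⟩ : (gram X).domain) = 0 := Subtype.ext hu
    rw [← e, h0, LinearPMap.map_zero, hu, smul_zero, sub_zero]
  have h1 : (LinearMap.range (T : H →ₗ[ℂ] H)).topologicalClosure = ⊤ := by
    rw [Submodule.topologicalClosure_eq_top_iff, ContinuousLinearMap.orthogonal_range]
    rw [(isSelfAdjoint_resolventNegOne hX hc).adjoint_eq]
    exact hker
  have h2 := Submodule.dense_iff_topologicalClosure_eq_top.2 h1
  exact h2

theorem continuousOn_div_one_add {f : ℝ → ℝ} (hf : ContinuousOn f (Set.Ici 0)) {C : ℝ}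
    (hC : ∀ x, 0 ≤ x → |f x| ≤ C) :
    ContinuousOn (fun x : ℝ => x * f (x⁻¹ - 1)) (Set.Icc 0 1) := by
  intro x hx
  rcases hx.1.eq_or_lt with h0 | h0
  · subst h0
    have : Filter.Tendsto (fun x : ℝ => x * f (x⁻¹ - 1)) (nhdsWithin 0 (Set.Icc 0 1))
        (nhds 0) := by
      refine squeeze_zero_norm' (a := fun x : ℝ => |x| * C) ?_ ?_
      · filter_upwards [self_mem_nhdsWithin] with y hy
        rw [norm_mul, Real.norm_eq_abs, Real.norm_eq_abs]
        rcases hy.1.eq_or_lt with h | h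
        · simp [← h]
        · exact mul_le_mul_of_nonneg_left
            (hC _ (sub_nonneg.2 ((one_le_inv₀ h).2 hy.2))) (abs_nonneg _)
      · have : Continuous fun x : ℝ => |x| * C := by fun_prop
        simpa using (this.tendsto 0).mono_left nhdsWithin_le_nhds
    simpa [ContinuousWithinAt] using this
  · have h1 : ContinuousOn (fun x : ℝ => x * f (x⁻¹ - 1)) (Set.Ioc 0 1) := by
      refine continuousOn_id.mul (hf.comp (f := fun x : ℝ => x⁻¹ - 1) ?_ ?_)
      · exact (continuousOn_inv₀.mono fun y hy => hy.1.ne').sub continuousOn_const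
      · exact fun y hy => sub_nonneg.2 ((one_le_inv₀ hy.1).2 hy.2)
    refine (h1 x ⟨h0, hx.2⟩).mono_of_mem_nhdsWithin ?_
    filter_upwards [self_mem_nhdsWithin, mem_nhdsWithin_of_mem_nhds (Ioi_mem_nhds h0)] with y hy hy'
    exact ⟨hy', hy.2⟩

/-- The defining property of `f(A)`: `f(A) (I + A)⁻¹ = g((I + A)⁻¹)` with
`g((1 + λ)⁻¹) = (1 + λ)⁻¹ f(λ)`. -/
theorem boundedFun_comp_resolventNegOne {X : H →ₗ.[ℂ] Hs} (hX : Dense (X.domain : Set H))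
    (hc : X.IsClosed) {f : ℝ → ℝ} (hf : ContinuousOn f (Set.Ici 0)) {C : ℝ}
    (hC : ∀ x, 0 ≤ x → |f x| ≤ C) :
    boundedFun f (gram X) ∘L resolventNegOne (gram X) =
      cfc (fun x : ℝ => x * f (x⁻¹ - 1)) (resolventNegOne (gram X)) := by
  set T := resolventNegOne (gram X) with hT
  have hsa : IsSelfAdjoint T := isSelfAdjoint_resolventNegOne hX hc
  have hsp : spectrum ℝ T ⊆ Set.Icc 0 1 := spectrum_resolventNegOne hX hc
  set g : ℝ → ℝ := fun x => x * f (x⁻¹ - 1) with hg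
  have hgc : ContinuousOn g (spectrum ℝ T) := (continuousOn_div_one_add hf hC).mono hsp
  have hgsa : IsSelfAdjoint (cfc g T) := cfc_predicate g T
  have hb : ∀ u, ‖cfc g T u‖ ≤ C * ‖T u‖ := fun u => by
    have h1 : (C ^ 2) • T ^ 2 - cfc g T ^ 2 = cfc (fun x => C ^ 2 * x ^ 2 - g x ^ 2) T := by
      rw [cfc_sub .., cfc_pow .., cfc_const_mul .., cfc_pow_id ..]
    have h2 : 0 ≤ (C ^ 2) • T ^ 2 - cfc g T ^ 2 := by
      rw [h1]
      refine cfc_nonneg fun x hx => ?_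
      have hx' := hsp hx
      rcases hx'.1.eq_or_lt with h | h
      · simp [hg, ← h]
      · have := hC (x⁻¹ - 1) (sub_nonneg.2 ((one_le_inv₀ h).2 hx'.2))
        have h3 : f (x⁻¹ - 1) ^ 2 ≤ C ^ 2 := by
          rw [← sq_abs]; exact pow_le_pow_left₀ (abs_nonneg _) this 2
        simp only [hg, mul_pow]
        nlinarith [sq_nonneg x]
    have h3 := ((ContinuousLinearMap.nonneg_iff_isPositive _).1 h2).re_inner_nonneg_left u
    have h4 : ⟪cfc g T (cfc g T u), u⟫_ℂ = ⟪cfc g T u, cfc g T u⟫_ℂ :=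
      (ContinuousLinearMap.isSelfAdjoint_iff_isSymmetric.1 hgsa) _ _
    have h5 : ⟪T (T u), u⟫_ℂ = ⟪T u, T u⟫_ℂ :=
      (ContinuousLinearMap.isSelfAdjoint_iff_isSymmetric.1 hsa) _ _
    have h6 : ((C ^ 2) • T ^ 2 - cfc g T ^ 2) u = (C ^ 2) • T (T u) - cfc g T (cfc g T u) := by
      simp [pow_two]
    rw [h6, inner_sub_left, ← Complex.coe_smul, inner_smul_left, h4, h5, inner_self_eq_norm_sq_to_K,
      inner_self_eq_norm_sq_to_K, Complex.conj_ofReal] at h3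
    have h7 : 0 ≤ C ^ 2 * ‖T u‖ ^ 2 - ‖cfc g T u‖ ^ 2 := by
      have h8 : (((C ^ 2 : ℝ) : ℂ) * (‖T u‖ : ℂ) ^ 2 - (‖cfc g T u‖ : ℂ) ^ 2).re =
          C ^ 2 * ‖T u‖ ^ 2 - ‖cfc g T u‖ ^ 2 := by
        norm_cast
      exact h8 ▸ h3
    have hC0 : 0 ≤ C := (abs_nonneg _).trans (hC 0 le_rfl)
    exact abs_le_of_sq_le_sq' (by nlinarith) (by positivity) |>.2
  ext u
  have := LinearMap.extendOfNorm_eq (f := ((cfc g T : H →L[ℂ] H) : H →ₗ[ℂ] H))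
    (e := (T : H →ₗ[ℂ] H)) (denseRange_resolventNegOne hX hc) ⟨C, hb⟩ u
  exact this


/-! #### Weak solutions of `X* (X φ + η) = 0` -/

/-- `φ ∈ Dom X ∩ (Ker X)ᗮ` is the weak solution of `X* (X φ + η) = 0`. -/
def IsWeakSolution (X : H →ₗ.[ℂ] Hs) (η : Hs) (φ : H) : Prop :=
  φ ∈ (kernel X)ᗮ ∧ ∃ h : φ ∈ X.domain, ∀ w : X.domain, ⟪X w, X ⟨φ, h⟩ + η⟫_ℂ = 0

theorem mem_kernel {X : H →ₗ.[ℂ] Hs} {u : H} :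
    u ∈ kernel X ↔ ∃ h : u ∈ X.domain, X ⟨u, h⟩ = 0 := by
  simp only [kernel, Submodule.mem_map, LinearMap.mem_ker]
  constructor
  · rintro ⟨y, hy, rfl⟩
    exact ⟨y.2, hy⟩
  · rintro ⟨h, h'⟩
    exact ⟨⟨u, h⟩, h', rfl⟩

theorem IsWeakSolution.unique {X : H →ₗ.[ℂ] Hs} {η : Hs} {φ ψ : H}
    (h1 : IsWeakSolution X η φ) (h2 : IsWeakSolution X η ψ) : φ = ψ := by
  obtain ⟨ho1, hd1, e1⟩ := h1
  obtain ⟨ho2, hd2, e2⟩ := h2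
  have h0 : X (⟨φ, hd1⟩ - ⟨ψ, hd2⟩) = 0 := by
    rw [← inner_self_eq_zero (𝕜 := ℂ)]
    nth_rewrite 2 [LinearPMap.map_sub]
    rw [← add_sub_add_right_eq_sub _ _ η, inner_sub_right, e1, e2, sub_zero]
  have hk : φ - ψ ∈ kernel X := mem_kernel.2 ⟨X.domain.sub_mem hd1 hd2, h0⟩
  have := Submodule.inner_right_of_mem_orthogonal hk ((kernel X)ᗮ.sub_mem ho1 ho2)
  exact sub_eq_zero.1 (inner_self_eq_zero.1 this)

/-- The distance from `0` to the rest of the spectrum of `X* X` (`∞` if there is no rest). -/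
def gap (X : H →ₗ.[ℂ] Hs) : ℝ≥0∞ := Metric.infEDist 0 (spec (gram X) \ {0})

theorem spectrum_resolventNegOne_of_gap {X : H →ₗ.[ℂ] Hs} (hX : Dense (X.domain : Set H))
    (hc : X.IsClosed) (hg : 0 < gap X) : ∃ q < 1, ∀ x ∈ spectrum ℝ (resolventNegOne (gram X)),
      x ≤ q ∨ x = 1 := by
  obtain ⟨T, hT⟩ : ∃ T, T = resolventNegOne (gram X) := ⟨_, rfl⟩
  have hsp := spectrum_resolventNegOne hX hc
  have hres := isResolvent_resolventNegOne hX hc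
  rw [← hT] at hsp hres ⊢
  obtain ⟨d, hd0, hd⟩ := ENNReal.lt_iff_exists_real_btwn.1 hg
  have hd0 : 0 < d := ENNReal.ofReal_pos.1 hd.1
  refine ⟨(1 + d)⁻¹, inv_lt_one_of_one_lt₀ (by linarith), fun x hx => ?_⟩
  by_contra! hcon
  have hx1 : x < 1 := lt_of_le_of_ne (hsp hx).2 hcon.2
  have hx0 : 0 < x := lt_trans (by positivity) hcon.1
  have hl0 : 0 < x⁻¹ - 1 := sub_pos.2 ((one_lt_inv₀ hx0).2 hx1)
  have hld : x⁻¹ - 1 < d := by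
    have := (inv_lt_comm₀ (by linarith) hx0).1 hcon.1
    linarith
  have hns : ((x⁻¹ - 1 : ℝ) : ℂ) ∉ spec (gram X) := fun hmem => by
    have h1 : gap X ≤ edist (0 : ℂ) ((x⁻¹ - 1 : ℝ) : ℂ) :=
      Metric.infEDist_le_edist_of_mem ⟨hmem, by
        rw [Set.mem_singleton_iff]; exact_mod_cast hl0.ne'⟩
    rw [edist_dist, dist_zero_left, Complex.norm_real, Real.norm_of_nonneg hl0.le] at h1
    exact absurd (hd.2.trans_le h1) (not_lt.2 (ENNReal.ofReal_le_ofReal hld.le))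
  obtain ⟨B, hB⟩ : ∃ B, IsResolvent (gram X) ((x⁻¹ - 1 : ℝ) : ℂ) B := by
    simpa [spec] using hns
  have hxc : (x : ℂ) ≠ 0 := by exact_mod_cast hx0.ne'
  have e1 : ∀ u, T (u + (x : ℂ)⁻¹ • B u) = B u := fun u => by
    obtain ⟨h, e⟩ := hB.1 u
    have := hres.2 ⟨B u, h⟩
    rw [sub_eq_iff_eq_add.1 e] at this
    refine Eq.trans (congrArg T ?_) this
    simp only [Complex.ofReal_sub, Complex.ofReal_inv, Complex.ofReal_one]
    module
  have e2 : ∀ u, B (u - (x : ℂ)⁻¹ • T u) = T u := fun u => by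
    obtain ⟨h, e⟩ := hres.1 u
    have := hB.2 ⟨T u, h⟩
    rw [sub_eq_iff_eq_add.1 e] at this
    refine Eq.trans (congrArg B ?_) this
    simp only [Complex.ofReal_sub, Complex.ofReal_inv, Complex.ofReal_one]
    module
  refine hx ?_
  have hval : (algebraMap ℝ (H →L[ℂ] H) x - T : H →L[ℂ] H) = (x : ℂ) • 1 - T := by
    ext u
    simp [Algebra.algebraMap_eq_smul_one]
  rw [spectrum.mem_resolventSet_iff, hval, isUnit_iff_exists]
  refine ⟨(x : ℂ)⁻¹ • (1 + (x : ℂ)⁻¹ • B), ?_, ?_⟩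
  · ext u
    change (x : ℂ) • ((x : ℂ)⁻¹ • (u + (x : ℂ)⁻¹ • B u)) - T ((x : ℂ)⁻¹ • (u + (x : ℂ)⁻¹ • B u)) = u
    rw [map_smul, e1, smul_inv_smul₀ hxc, add_sub_cancel_right]
  · ext u
    change (x : ℂ)⁻¹ • ((x : ℂ) • u - T u + (x : ℂ)⁻¹ • B ((x : ℂ) • u - T u)) = u
    have h1 : (x : ℂ) • u - T u = (x : ℂ) • (u - (x : ℂ)⁻¹ • T u) := by
      rw [smul_sub, smul_inv_smul₀ hxc]
    have h2 : B ((x : ℂ) • u - T u) = (x : ℂ) • T u := by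
      rw [h1, map_smul, e2]
    rw [h2, inv_smul_smul₀ hxc, sub_add_cancel, inv_smul_smul₀ hxc]

theorem exists_weakSolution {X : H →ₗ.[ℂ] Hs} (hX : Dense (X.domain : Set H))
    (hc : X.IsClosed) (hg : 0 < gap X) [(kernel X).HasOrthogonalProjection] :
    ∃ Q : Hs →L[ℂ] H, ∀ η, IsWeakSolution X η (Q η) := by
  obtain ⟨q, hq1, hq⟩ := spectrum_resolventNegOne_of_gap hX hc hg
  have hTX := resolventNegOne_spec hX hc
  have hsa := isSelfAdjoint_resolventNegOne hX hc
  obtain ⟨K₀, hK₀⟩ := exists_graph_solver hc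
  generalize resolventNegOne (gram X) = T at hq hTX hsa
  -- `(I - T)` is invertible on the orthogonal complement of `Ker X`
  let k : ℝ → ℝ := fun x => (1 - x)⁻¹
  have hk : ContinuousOn k (spectrum ℝ T) := by
    intro x hx
    rcases hq x hx with h | h
    · exact ((continuousAt_const.sub continuousAt_id).inv₀
        (show (1 : ℝ) - x ≠ 0 by linarith)).continuousWithinAt
    · have : ∀ᶠ y in nhdsWithin x (spectrum ℝ T), k y = k x := by
        filter_upwards [self_mem_nhdsWithin,
          mem_nhdsWithin_of_mem_nhds (Ioi_mem_nhds (show q < x by linarith))] with y hy hy'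
        rcases hq y hy with h' | h'
        · exact absurd h' (not_le.2 hy')
        · rw [h, h']
      exact (Filter.tendsto_congr' this).2 tendsto_const_nhds
  let e : ℝ → ℝ := fun x => 1 - (1 - x) * k x
  have he : ContinuousOn e (spectrum ℝ T) := by fun_prop
  have hE : IsSelfAdjoint (cfc e T) := cfc_predicate e T
  have hTE : T * cfc e T = cfc e T := by
    have h1 : cfc (fun x => x * e x) T = T * cfc e T := by
      rw [cfc_mul .., cfc_id' ..]
    rw [← h1]
    refine cfc_congr fun x hx => ?_
    rcases hq x hx with h | h
    · have : 1 - x ≠ 0 := by linarith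
      simp [e, k, mul_inv_cancel₀ this]
    · simp [h]
  have hEk : ∀ u, cfc k T u - T (cfc k T u) = u - cfc e T u := fun u => by
    have h1 : cfc e T = 1 - (1 - T) * cfc k T := by
      rw [cfc_sub .., cfc_mul .., cfc_sub .., cfc_const_one .., cfc_id' ..]
    rw [h1]
    simp
  have hEN : ∀ u, cfc e T u ∈ kernel X := fun u => by
    have h0 : T (cfc e T u) = cfc e T u := congrArg (fun S : H →L[ℂ] H => S u) hTE
    obtain ⟨h, h'⟩ := hTX (cfc e T u)
    have h2 := h' ⟨_, h⟩
    simp only [h0, sub_self, inner_zero_right, inner_self_eq_zero] at h2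
    exact mem_kernel.2 ⟨h0 ▸ h, h2⟩
  have hE0 : ∀ u ∈ (kernel X)ᗮ, cfc e T u = 0 := fun u hu => by
    rw [← inner_self_eq_zero (𝕜 := ℂ)]
    have h1 : ⟪cfc e T u, cfc e T u⟫_ℂ = ⟪u, cfc e T (cfc e T u)⟫_ℂ :=
      (ContinuousLinearMap.isSelfAdjoint_iff_isSymmetric.1 hE) _ _
    rw [h1]
    exact Submodule.inner_left_of_mem_orthogonal (hEN _) hu
  let W : Hs →L[ℂ] H := K₀ ∘L
    (WithLp.prodContinuousLinearEquiv 2 ℂ H Hs).symm.toContinuousLinearMap ∘L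
    ContinuousLinearMap.inr ℂ H Hs
  have hW : ∀ η, ∃ h : W η ∈ X.domain, ∀ w : X.domain,
      ⟪X w, X ⟨W η, h⟩⟫_ℂ = ⟪X w, η⟫_ℂ - ⟪(w : H), W η⟫_ℂ := fun η => by
    obtain ⟨h, h'⟩ := hK₀ ((WithLp.prodContinuousLinearEquiv 2 ℂ H Hs).symm (0, η))
    refine ⟨h, fun w => ?_⟩
    have h1 := h' w
    have h2 : ((WithLp.prodContinuousLinearEquiv 2 ℂ H Hs).symm ((0 : H), η)).fst = 0 := rfl
    have h3 : ((WithLp.prodContinuousLinearEquiv 2 ℂ H Hs).symm ((0 : H), η)).snd = η := rfl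
    rw [h2, h3, zero_sub, inner_neg_right, inner_sub_right] at h1
    change ⟪X w, X ⟨_, h⟩⟫_ℂ = ⟪X w, η⟫_ℂ - ⟪(w : H), K₀ ((WithLp.prodContinuousLinearEquiv 2 ℂ H Hs).symm (0, η))⟫_ℂ
    linear_combination -h1
  refine ⟨-((1 - (kernel X).starProjection) ∘L (T ∘L cfc k T + 1) ∘L W), fun η => ?_⟩
  obtain ⟨hv, hv'⟩ := hW η
  have hvN : W η ∈ (kernel X)ᗮ := by
    rw [Submodule.mem_orthogonal]
    intro n hn
    obtain ⟨h, h'⟩ := mem_kernel.1 hn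
    have := hv' ⟨n, h⟩
    rw [h'] at this
    simpa using this
  obtain ⟨ht, ht'⟩ := hTX (cfc k T (W η))
  obtain ⟨hp, hp'⟩ := mem_kernel.1 ((kernel X).starProjection_apply_mem
    (T (cfc k T (W η)) + W η))
  refine ⟨(kernel X)ᗮ.neg_mem ?_, ?_⟩
  · exact Submodule.sub_starProjection_mem_orthogonal _
  · refine ⟨X.domain.neg_mem (X.domain.sub_mem (X.domain.add_mem ht hv) hp), fun w => ?_⟩
    have hsum : X ⟨_, X.domain.neg_mem (X.domain.sub_mem (X.domain.add_mem ht hv) hp)⟩ =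
        -(X ⟨_, ht⟩ + X ⟨_, hv⟩ - X ⟨_, hp⟩) := by
      rw [← LinearPMap.map_add, ← LinearPMap.map_sub, ← LinearPMap.map_neg]
      rfl
    have h1 := ht' w
    rw [hEk, hE0 _ hvN, sub_zero] at h1
    have h2 := hv' w
    change ⟪X w, X ⟨_, X.domain.neg_mem (X.domain.sub_mem (X.domain.add_mem ht hv) hp)⟩ + η⟫_ℂ = 0
    rw [hsum, hp', sub_zero, inner_add_right, inner_neg_right, inner_add_right, h1, h2]
    ring

/-- The operator `f(B)` for a bounded selfadjoint operator `B` and a function `f` continuous on the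
spectrum of `B`. -/
def selfAdjointFun (f : ℝ → ℝ) (B : H →L[ℂ] H) : H →L[ℂ] H := cfc f B

end Unbounded

/-! ### The operator pencil -/

/-- The data `X₀`, `X₁` of the family `A(t) = X(t)* X(t)`, `X(t) = X₀ + t X₁`: a closed densely
defined `X₀` and a bounded `X₁`, such that `0` is an isolated point of the spectrum of
`A(0) = X₀* X₀`, with `0 < dim Ker X₀ < ∞` and `dim Ker X₀ ≤ dim Ker X₀*`. -/
structure Pencil (H : Type u) (Hs : Type v)
    [NormedAddCommGroup H] [InnerProductSpace ℂ H] [CompleteSpace H]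
    [NormedAddCommGroup Hs] [InnerProductSpace ℂ Hs] [CompleteSpace Hs] where
  /-- the unbounded operator -/
  X₀ : H →ₗ.[ℂ] Hs
  /-- the bounded perturbation -/
  X₁ : H →L[ℂ] Hs
  dense_domain : Dense (X₀.domain : Set H)
  closed : X₀.IsClosed
  isolated : 0 < gap X₀
  finite_kernel : FiniteDimensional ℂ (kernel X₀)
  kernel_ne_bot : kernel X₀ ≠ ⊥
  finrank_le : (Module.finrank ℂ (kernel X₀) : Cardinal) ≤
    Module.rank ℂ (kernel (LinearPMap.adjoint X₀))

namespace Pencil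

variable {H : Type u} {Hs : Type v}
  [NormedAddCommGroup H] [InnerProductSpace ℂ H] [CompleteSpace H]
  [NormedAddCommGroup Hs] [InnerProductSpace ℂ Hs] [CompleteSpace Hs]
  (p : Pencil H Hs)

/-- `X(t) = X₀ + t X₁`, with domain `Dom X₀`. -/
def X (t : ℝ) : H →ₗ.[ℂ] Hs := (((t : ℂ) • p.X₁ : H →L[ℂ] Hs) : H →ₗ[ℂ] Hs) +ᵥ p.X₀

/-- `A(t) = X(t)* X(t)`. -/
def A (t : ℝ) : H →ₗ.[ℂ] H := gram (p.X t)

theorem X_zero : p.X 0 = p.X₀ := by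
  refine LinearPMap.ext rfl ?_
  intro x hx hx'
  change ((0 : ℝ) : ℂ) • p.X₁ x + p.X₀ ⟨x, hx⟩ = _
  simp

/-- The distance `d⁰` from the point `0` to the rest of the spectrum of `A(0)`. -/
def d₀ : ℝ≥0∞ := Metric.infEDist 0 (spec (p.A 0) \ {0})

theorem d₀_eq_gap : p.d₀ = gap p.X₀ := by
  rw [d₀, gap, A, X_zero]

/-- The nondegeneracy condition `A(t) ≥ c_* t² I` for `|t| ≤ t₀`. -/
def Nondegenerate (cs t₀ : ℝ) : Prop :=
  ∀ t : ℝ, |t| ≤ t₀ → ∀ u : (p.A t).domain,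
    cs * t ^ 2 * ‖(u : H)‖ ^ 2 ≤ (⟪(u : H), p.A t u⟫_ℂ).re

theorem closed_X (t : ℝ) : (p.X t).IsClosed := by
  let m : H × Hs → H × Hs := fun z => (z.1, z.2 - (t : ℂ) • p.X₁ z.1)
  have hm : Continuous m := by fun_prop
  have : ((p.X t).graph : Set (H × Hs)) = m ⁻¹' (p.X₀.graph : Set (H × Hs)) := by
    ext ⟨a, b⟩
    simp only [SetLike.mem_coe, Set.mem_preimage, LinearPMap.mem_graph_iff, m]
    constructor
    · rintro ⟨y, hy, hb⟩
      refine ⟨y, hy, ?_⟩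
      rw [← hb, ← hy]
      exact (add_sub_cancel_left _ _).symm
    · rintro ⟨y, hy, hb⟩
      refine ⟨y, hy, ?_⟩
      change (t : ℂ) • p.X₁ y + p.X₀ y = b
      rw [hb, hy, add_sub_cancel]
  rw [LinearPMap.IsClosed, this]
  exact p.closed.preimage hm

/-- `𝔑 = Ker X₀ = Ker A(0)`. -/
def 𝔑 : Submodule ℂ H := kernel p.X₀

instance : FiniteDimensional ℂ p.𝔑 := p.finite_kernel
instance : CompleteSpace p.𝔑 := FiniteDimensional.complete ℂ p.𝔑

/-- `n = dim 𝔑`. -/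
def n : ℕ := Module.finrank ℂ p.𝔑

/-- The orthogonal projection of `H` onto `𝔑`. -/
def P : H →L[ℂ] H := p.𝔑.starProjection

theorem exists_Z : ∃ Z : H →L[ℂ] H, ∀ u, IsWeakSolution p.X₀ (p.X₁ (p.P u)) (Z u) := by
  have : (kernel p.X₀).HasOrthogonalProjection :=
    inferInstanceAs (p.𝔑.HasOrthogonalProjection)
  obtain ⟨Q, hQ⟩ := exists_weakSolution p.dense_domain p.closed p.isolated
  exact ⟨Q ∘L p.X₁ ∘L p.P, fun u => hQ _⟩

/-- The operator `Z`: `Z u = φ(P u)`, where `φ(ω) ∈ Dom X₀ ∩ 𝔑ᗮ` is the (unique) weak solution of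
`X₀* (X₀ φ + X₁ ω) = 0`. -/
def Z : H →L[ℂ] H := p.exists_Z.choose

theorem Z_spec (u : H) : IsWeakSolution p.X₀ (p.X₁ (p.P u)) (p.Z u) := p.exists_Z.choose_spec u

theorem Z_mem_domain (u : H) : p.Z u ∈ p.X₀.domain := (p.Z_spec u).2.choose

/-- The operator `R = X₀ Z + X₁` on `𝔑`. -/
def R : p.𝔑 →L[ℂ] Hs :=
  LinearMap.toContinuousLinearMap
    { toFun := fun ω => p.X₀ ⟨p.Z ω, p.Z_mem_domain ω⟩ + p.X₁ ω
      map_add' := fun a b => by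
        have : (⟨p.Z (a + b : p.𝔑), p.Z_mem_domain _⟩ : p.X₀.domain) =
            ⟨p.Z a, p.Z_mem_domain a⟩ + ⟨p.Z b, p.Z_mem_domain b⟩ := Subtype.ext (by simp)
        rw [this, LinearPMap.map_add, Submodule.coe_add, map_add]
        abel
      map_smul' := fun c a => by
        have : (⟨p.Z (c • a : p.𝔑), p.Z_mem_domain _⟩ : p.X₀.domain) =
            c • ⟨p.Z a, p.Z_mem_domain a⟩ := Subtype.ext (by simp)
        rw [this, LinearPMap.map_smul, Submodule.coe_smul, map_smul, RingHom.id_apply, smul_add] }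

/-- The operator `R P : H → Hs`. -/
def RP : H →L[ℂ] Hs := p.R ∘L p.𝔑.orthogonalProjectionOnto

/-- The spectral germ `S = R* R : 𝔑 → 𝔑`. -/
def S : p.𝔑 →L[ℂ] p.𝔑 := ContinuousLinearMap.adjoint p.R ∘L p.R

/-- The operator `N = Z* X₁* R P + (R P)* X₁ Z`. -/
def N : H →L[ℂ] H :=
  ContinuousLinearMap.adjoint p.Z ∘L ContinuousLinearMap.adjoint p.X₁ ∘L p.RP +
    ContinuousLinearMap.adjoint p.RP ∘L p.X₁ ∘L p.Z

/-- The (finite) type of the distinct eigenvalues `γ₁°, …, γₚ°` of the germ `S`. -/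
abbrev GermEigenvalue : Type := Module.End.Eigenvalues (p.S : Module.End ℂ p.𝔑)

/-- The orthogonal projection of `H` onto the eigenspace `Ker (S - γ I) ⊆ 𝔑 ⊆ H`. -/
def eigenProj (γ : p.GermEigenvalue) : H →L[ℂ] H :=
  ((Module.End.eigenspace (p.S : Module.End ℂ p.𝔑) (γ : ℂ)).map p.𝔑.subtype).starProjection

/-- The operator `N₀ = ∑ⱼ Pⱼ N Pⱼ`. -/
def N₀ : H →L[ℂ] H := ∑ γ : p.GermEigenvalue, p.eigenProj γ ∘L p.N ∘L p.eigenProj γ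

/-- `c°_{jl} = min {c_*, n⁻¹ |γ_l° - γ_j°|}`. -/
def cPair (cs : ℝ) (γ γ' : p.GermEigenvalue) : ℝ :=
  min cs ((p.n : ℝ)⁻¹ * ‖(γ' : ℂ) - (γ : ℂ)‖)

/-- `c°`, the minimum of `c°_{jl}` over the pairs `j ≠ l` with `P_j N P_l ≠ 0`; it is `∞` if there
are no such pairs. -/
def cCirc (cs : ℝ) : ℝ≥0∞ :=
  ⨅ (γ : p.GermEigenvalue) (γ' : p.GermEigenvalue)
    (_ : γ ≠ γ' ∧ p.eigenProj γ ∘L p.N ∘L p.eigenProj γ' ≠ 0), ENNReal.ofReal (p.cPair cs γ γ')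

/-- The function `λ ↦ λ^(-1/2) sin (τ λ^(1/2))` on `[0, ∞)`, extended by continuity to `λ = 0`. -/
def sinQuot (τ x : ℝ) : ℝ := if x = 0 then τ else (√x)⁻¹ * Real.sin (τ * √x)

/-- `J₁(t, τ) = cos (τ A(t)^(1/2)) P - cos (τ (t² S)^(1/2)) P`. -/
def J₁ (t τ : ℝ) : H →L[ℂ] H :=
  boundedFun (fun x => Real.cos (τ * √x)) (p.A t) ∘L p.P -
    p.𝔑.subtypeL ∘L selfAdjointFun (fun x => Real.cos (τ * √x)) ((t : ℂ) ^ 2 • p.S) ∘L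
      p.𝔑.orthogonalProjectionOnto

/-- `J₂(t, τ) = A(t)^(-1/2) sin (τ A(t)^(1/2)) P - (t² S)^(-1/2) sin (τ (t² S)^(1/2)) P`. -/
def J₂ (t τ : ℝ) : H →L[ℂ] H :=
  boundedFun (sinQuot τ) (p.A t) ∘L p.P -
    p.𝔑.subtypeL ∘L selfAdjointFun (sinQuot τ) ((t : ℂ) ^ 2 • p.S) ∘L p.𝔑.orthogonalProjectionOnto

end Pencil

end OperatorPencil

end

/-!
Write `A = A(t)` and `B = t² S`. Both `cos (τ A^(1/2)) P` and `cos (τ B^(1/2)) P` solve a wave equation,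
so by Duhamel's principle they are close as soon as some operator `V : 𝔑 → H` close to the inclusion
almost intertwines `A` and `B`. The intertwining relation is only needed weakly, in the form
`A V = V B + f + X(t)* g` (`WeakIntertwining`): against `A^(-1/2) sin (s A^(1/2))` the error `f` costs a
factor `ρ ≤ (c_* t²)^(-1/2)`, while `X(t)* g` costs nothing because `X(t) A^(-1/2)` is a partial isometry.
This gives errors of order `|τ| (ρ ‖f‖ + ‖g‖)` for the cosine and `ρ` times this for the sine
(`norm_boundedFun_cos_sub_le`, `norm_boundedFun_sinQuot_sub_le`). No spectral projection of `A(t)` and no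
contour integral is involved. Since `A` is unbounded and its functions are defined through
`T = (I + A)⁻¹`, the formulas are tested on the dense range of `T²`, where all curves are differentiable.

The operator `V` is a formal perturbation expansion. With the bounded solution operator `Q` of
`X₀* (X₀ φ + η) = 0`, whose norm is at most `(d⁰)^(-1/2)` (`exists_solutionOperator`), one finds `Y` such that
`V₀ = I + t Z + t² Y` satisfies `A V₀ = V₀ B + t³ N + O(t⁴) + X(t)* O(t³)`
(`IsSolutionOperator.exists_expansion`). If `D` solves the commutator equation `N + S D - D S = 0`, then
`V = V₀ (I + t D)` removes the term `t³ N` (`IsSolutionOperator.exists_weakIntertwining`). For `N = 0` one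
takes `D = 0`. For `N₀ = 0` the operator `D = ∑ (γ_l° - γ_j°)⁻¹ P_j N P_l` works, and `c°` controls its norm
(`exists_commutator_solution`).

Thus `‖J₁‖ ≤ K |t| + C |τ| |t|³` and `‖J₂‖ ≤ L + C' |τ| t²`. Interpolating the second term in each with the
trivial bounds `2` and `2 c_*^(-1/2) |t|⁻¹` and replacing `τ` by `ε⁻¹ τ` yields the powers `|τ|^(1/2)` and the
smoothing factors (`interpolate_cos`, `interpolate_sin`).
-/

namespace OperatorPencil

universe u v w

/-! ### Functional calculus of a bounded selfadjoint operator -/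

section CFC

variable {H : Type u} [NormedAddCommGroup H] [InnerProductSpace ℂ H] [CompleteSpace H]

/-- The functional calculus is monotone in `|f|`, vector by vector: `‖g(T) u‖² - ‖f(T) u‖²` is the
quadratic form of `(g² - f²)(T) ≥ 0`. -/
theorem norm_cfc_apply_le {T : H →L[ℂ] H} (hT : IsSelfAdjoint T) {f g : ℝ → ℝ}
    (hf : ContinuousOn f (spectrum ℝ T)) (hg : ContinuousOn g (spectrum ℝ T))
    (hfg : ∀ x ∈ spectrum ℝ T, |f x| ≤ |g x|) (u : H) : ‖cfc f T u‖ ≤ ‖cfc g T u‖ := by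
  have key : ∀ k : ℝ → ℝ, ContinuousOn k (spectrum ℝ T) →
      ⟪cfc (fun x => k x ^ 2) T u, u⟫_ℂ = ((‖cfc k T u‖ ^ 2 : ℝ) : ℂ) := by
    intro k hk
    have hs : IsSelfAdjoint (cfc k T) := cfc_predicate k T
    rw [cfc_pow .., pow_two]
    have h4 : ⟪cfc k T (cfc k T u), u⟫_ℂ = ⟪cfc k T u, cfc k T u⟫_ℂ :=
      (ContinuousLinearMap.isSelfAdjoint_iff_isSymmetric.1 hs) _ _
    refine h4.trans ?_
    rw [inner_self_eq_norm_sq_to_K]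
    norm_cast
  have h1 : 0 ≤ cfc (fun x => g x ^ 2 - f x ^ 2) T :=
    cfc_nonneg fun x hx => sub_nonneg.2 (sq_le_sq.2 (hfg x hx))
  rw [cfc_sub ..] at h1
  have h3 := ((ContinuousLinearMap.nonneg_iff_isPositive _).1 h1).re_inner_nonneg_left u
  rw [sub_apply, inner_sub_left, key g hg, key f hf, ← Complex.ofReal_sub] at h3
  have h5 : 0 ≤ ‖cfc g T u‖ ^ 2 - ‖cfc f T u‖ ^ 2 := h3
  exact abs_le_of_sq_le_sq' (by linarith) (norm_nonneg _) |>.2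

/-- Norm differentiability of `s ↦ F s (T)`: pointwise derivatives that are Lipschitz in the
parameter, uniformly on the spectrum, suffice. -/
theorem hasDerivAt_cfc {T : H →L[ℂ] H} {F F' : ℝ → ℝ → ℝ} {K : ℝ}
    (hF : ∀ s, ContinuousOn (F s) (spectrum ℝ T)) (hF' : ∀ s, ContinuousOn (F' s) (spectrum ℝ T))
    (hd : ∀ x ∈ spectrum ℝ T, ∀ s, HasDerivAt (fun s => F s x) (F' s x) s)
    (hK : 0 ≤ K) (hL : ∀ x ∈ spectrum ℝ T, ∀ r s, |F' r x - F' s x| ≤ K * |r - s|) (s : ℝ) :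
    HasDerivAt (fun s => cfc (F s) T) (cfc (F' s) T) s := by
  rw [hasDerivAt_iff_isLittleO_nhds_zero]
  have hb : ∀ h : ℝ, ‖cfc (F (s + h)) T - cfc (F s) T - h • cfc (F' s) T‖ ≤ K * ‖h ^ 2‖ := by
    intro h
    have e : cfc (F (s + h)) T - cfc (F s) T - h • cfc (F' s) T =
        cfc (fun x => F (s + h) x - F s x - h * F' s x) T := by
      have h1 := hF (s + h)
      have h2 := hF s
      have h3 := hF' s
      rw [cfc_sub .., cfc_sub .., cfc_const_mul ..]
    rw [e]
    refine norm_cfc_le (by positivity) fun x hx => ?_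
    have hc := Convex.norm_image_sub_le_of_norm_hasDerivWithin_le (𝕜 := ℝ)
      (f := fun r => F r x - r * F' s x) (f' := fun r => F' r x - 1 * F' s x)
      (s := Set.uIcc s (s + h)) (x := s) (y := s + h) (C := K * |h|)
      (fun r _ => ((hd x hx r).sub ((hasDerivAt_id r).mul_const _)).hasDerivWithinAt)
      (fun r hr => by
        rw [one_mul]
        refine (hL x hx r s).trans (mul_le_mul_of_nonneg_left ?_ hK)
        simpa using Set.abs_sub_left_of_mem_uIcc hr) (convex_uIcc _ _) Set.left_mem_uIcc
      Set.right_mem_uIcc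
    have e2 : F (s + h) x - F s x - h * F' s x =
        (F (s + h) x - (s + h) * F' s x) - (F s x - s * F' s x) := by ring
    rw [e2]
    refine hc.trans (le_of_eq ?_)
    rw [add_sub_cancel_left, norm_pow, Real.norm_eq_abs]
    ring
  refine (Asymptotics.IsBigO.of_bound K (Filter.Eventually.of_forall hb)).trans_isLittleO ?_
  exact Asymptotics.isLittleO_pow_id one_lt_two

theorem hasDerivAt_cfc_apply {T : H →L[ℂ] H} {F F' : ℝ → ℝ → ℝ} {K : ℝ}
    (hF : ∀ s, ContinuousOn (F s) (spectrum ℝ T)) (hF' : ∀ s, ContinuousOn (F' s) (spectrum ℝ T))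
    (hd : ∀ x ∈ spectrum ℝ T, ∀ s, HasDerivAt (fun s => F s x) (F' s x) s)
    (hK : 0 ≤ K) (hL : ∀ x ∈ spectrum ℝ T, ∀ r s, |F' r x - F' s x| ≤ K * |r - s|) (s : ℝ)
    (v : H) : HasDerivAt (fun s => cfc (F s) T v) (cfc (F' s) T v) s :=
  ((ContinuousLinearMap.apply ℂ H v).restrictScalars ℝ).hasFDerivAt.comp_hasDerivAt s
    (hasDerivAt_cfc hF hF' hd hK hL s)

end CFC

/-! ### The scalar functions `cos (s √x)` and `x^(-1/2) sin (s √x)` -/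

namespace Pencil

theorem sinQuot_eq_sinc (s : ℝ) {x : ℝ} (hx : 0 ≤ x) : sinQuot s x = s * Real.sinc (s * √x) := by
  unfold sinQuot
  split_ifs with h
  · simp [h]
  · have hs : √x ≠ 0 := (Real.sqrt_pos.2 (lt_of_le_of_ne hx (Ne.symm h))).ne'
    rcases eq_or_ne s 0 with rfl | h0
    · simp
    · rw [Real.sinc_of_ne_zero (mul_ne_zero h0 hs)]
      field_simp

theorem continuousOn_sinQuot (s : ℝ) : ContinuousOn (sinQuot s) (Set.Ici 0) :=
  ContinuousOn.congr (f := fun x => s * Real.sinc (s * √x))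
    (by have := Real.continuous_sinc; fun_prop) fun _ hx => sinQuot_eq_sinc s hx

theorem abs_sinQuot_le (s : ℝ) {x : ℝ} (hx : 0 ≤ x) : |sinQuot s x| ≤ |s| := by
  rw [sinQuot_eq_sinc s hx, abs_mul]
  exact mul_le_of_le_one_right (abs_nonneg _) (Real.abs_sinc_le_one _)

theorem abs_sinQuot_le_inv_sqrt (s : ℝ) {a x : ℝ} (ha : 0 < a) (hx : a ≤ x) :
    |sinQuot s x| ≤ (√a)⁻¹ := by
  have hx0 : 0 < x := ha.trans_le hx
  rw [sinQuot, if_neg hx0.ne', abs_mul, abs_of_nonneg (by positivity)]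
  refine (mul_le_of_le_one_right (by positivity) (Real.abs_sin_le_one _)).trans ?_
  exact inv_anti₀ (Real.sqrt_pos.2 ha) (Real.sqrt_le_sqrt hx)

theorem mul_sinQuot (s : ℝ) {x : ℝ} (hx : 0 ≤ x) : x * sinQuot s x = √x * Real.sin (s * √x) := by
  unfold sinQuot
  split_ifs with h
  · simp [h]
  · have hs : √x ≠ 0 := (Real.sqrt_pos.2 (lt_of_le_of_ne hx (Ne.symm h))).ne'
    nth_rewrite 1 [← Real.mul_self_sqrt hx]
    field_simp

theorem sqrt_mul_sinQuot (s : ℝ) {x : ℝ} (hx : 0 ≤ x) : √x * sinQuot s x = Real.sin (s * √x) := by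
  unfold sinQuot
  split_ifs with h
  · simp [h]
  · have hs : √x ≠ 0 := (Real.sqrt_pos.2 (lt_of_le_of_ne hx (Ne.symm h))).ne'
    field_simp

theorem continuousOn_cos_mul_sqrt (s : ℝ) :
    ContinuousOn (fun x => Real.cos (s * √x)) (Set.Ici 0) := by
  fun_prop

theorem hasDerivAt_sinQuot {x : ℝ} (hx : 0 ≤ x) (s : ℝ) :
    HasDerivAt (fun s => sinQuot s x) (Real.cos (s * √x)) s := by
  unfold sinQuot
  split_ifs with h
  · simpa [h] using hasDerivAt_id' s
  · have hs : √x ≠ 0 := (Real.sqrt_pos.2 (lt_of_le_of_ne hx (Ne.symm h))).ne'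
    have h1 : HasDerivAt (fun s => s * √x) (1 * √x) s := (hasDerivAt_id s).mul_const _
    have h2 := (h1.sin).const_mul (√x)⁻¹
    refine h2.congr_deriv ?_
    field_simp

theorem hasDerivAt_cos_mul_sqrt {x : ℝ} (hx : 0 ≤ x) (s : ℝ) :
    HasDerivAt (fun s => Real.cos (s * √x)) (-(x * sinQuot s x)) s := by
  have h1 : HasDerivAt (fun s => s * √x) (1 * √x) s := (hasDerivAt_id s).mul_const _
  refine h1.cos.congr_deriv ?_
  rw [mul_sinQuot s hx]
  ring

theorem abs_mul_sinQuot_sub_le {x : ℝ} (hx : 0 ≤ x) (r s : ℝ) :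
    |x * sinQuot r x - x * sinQuot s x| ≤ x * |r - s| := by
  rw [mul_sinQuot _ hx, mul_sinQuot _ hx, ← mul_sub, abs_mul, abs_of_nonneg (Real.sqrt_nonneg x)]
  have h1 : |Real.sin (r * √x) - Real.sin (s * √x)| ≤ |r * √x - s * √x| := by
    simpa [Real.dist_eq] using Real.lipschitzWith_sin.dist_le_mul (r * √x) (s * √x)
  rw [← sub_mul, abs_mul, abs_of_nonneg (Real.sqrt_nonneg x)] at h1
  calc √x * |Real.sin (r * √x) - Real.sin (s * √x)| ≤ √x * (|r - s| * √x) := by gcongr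
    _ = x * |r - s| := by rw [mul_comm |r - s|, ← mul_assoc, Real.mul_self_sqrt hx]

theorem abs_cos_mul_sqrt_sub_le (x r s : ℝ) :
    |Real.cos (r * √x) - Real.cos (s * √x)| ≤ √x * |r - s| := by
  have h1 : |Real.cos (r * √x) - Real.cos (s * √x)| ≤ |r * √x - s * √x| := by
    simpa [Real.dist_eq] using Real.lipschitzWith_cos.dist_le_mul (r * √x) (s * √x)
  rwa [← sub_mul, abs_mul, abs_of_nonneg (Real.sqrt_nonneg x), mul_comm |r - s|] at h1

end Pencil

open Pencil

/-! ### The cosine and the sine of `X* X` -/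

section Calculus

variable {H : Type u} {Hs : Type v}
  [NormedAddCommGroup H] [InnerProductSpace ℂ H] [CompleteSpace H]
  [NormedAddCommGroup Hs] [InnerProductSpace ℂ Hs] [CompleteSpace Hs]

theorem inner_cfc_cfc {T : H →L[ℂ] H} {f g k : ℝ → ℝ}
    (hf : ContinuousOn f (spectrum ℝ T)) (hg : ContinuousOn g (spectrum ℝ T))
    (hk : ContinuousOn k (spectrum ℝ T)) (h : ∀ x ∈ spectrum ℝ T, f x * g x = k x * k x) (u : H) :
    ⟪cfc f T u, cfc g T u⟫_ℂ = ⟪cfc k T u, cfc k T u⟫_ℂ := by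
  have hfs : IsSelfAdjoint (cfc f T) := cfc_predicate f T
  have hks : IsSelfAdjoint (cfc k T) := cfc_predicate k T
  have e1 : ⟪cfc f T u, cfc g T u⟫_ℂ = ⟪u, cfc f T (cfc g T u)⟫_ℂ :=
    (ContinuousLinearMap.isSelfAdjoint_iff_isSymmetric.1 hfs) _ _
  have e2 : ⟪cfc k T u, cfc k T u⟫_ℂ = ⟪u, cfc k T (cfc k T u)⟫_ℂ :=
    (ContinuousLinearMap.isSelfAdjoint_iff_isSymmetric.1 hks) _ _
  have e3 : cfc f T * cfc g T = cfc k T * cfc k T := by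
    rw [← cfc_mul .., ← cfc_mul ..]
    exact cfc_congr h
  rw [e1, e2]
  exact congrArg (fun S : H →L[ℂ] H => ⟪u, S u⟫_ℂ) e3

variable {X : H →ₗ.[ℂ] Hs} (hX : Dense (X.domain : Set H)) (hc : X.IsClosed)

include hX hc

theorem boundedFun_resolventNegOne_apply {f : ℝ → ℝ} (hf : ContinuousOn f (Set.Ici 0)) {C : ℝ}
    (hC : ∀ x, 0 ≤ x → |f x| ≤ C) (v : H) :
    boundedFun f (gram X) (resolventNegOne (gram X) v) =
      cfc (fun x : ℝ => x * f (x⁻¹ - 1)) (resolventNegOne (gram X)) v :=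
  congrArg (fun S : H →L[ℂ] H => S v) (boundedFun_comp_resolventNegOne hX hc hf hC)

theorem continuousOn_spectrum_mul {f : ℝ → ℝ} (hf : ContinuousOn f (Set.Ici 0)) {C : ℝ}
    (hC : ∀ x, 0 ≤ x → |f x| ≤ C) : ContinuousOn (fun x : ℝ => x * f (x⁻¹ - 1))
      (spectrum ℝ (resolventNegOne (gram X))) :=
  (continuousOn_div_one_add hf hC).mono (spectrum_resolventNegOne hX hc)

/-- `f(A)` is symmetric. It suffices to test this on the dense range of `(I + A)⁻¹`, where `f(A)` is
given by the functional calculus. -/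
theorem inner_boundedFun_left {f : ℝ → ℝ} (hf : ContinuousOn f (Set.Ici 0)) {C : ℝ}
    (hC : ∀ x, 0 ≤ x → |f x| ≤ C) (u w : H) :
    ⟪boundedFun f (gram X) u, w⟫_ℂ = ⟪u, boundedFun f (gram X) w⟫_ℂ := by
  have hd := denseRange_resolventNegOne hX hc
  have hsa := isSelfAdjoint_resolventNegOne hX hc
  refine hd.induction_on₂ (p := fun u w => ⟪boundedFun f (gram X) u, w⟫_ℂ =
    ⟪u, boundedFun f (gram X) w⟫_ℂ) ?_ ?_ u w
  · exact isClosed_eq (by fun_prop) (by fun_prop)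
  intro a b
  simp only [boundedFun_resolventNegOne_apply hX hc hf hC]
  set T := resolventNegOne (gram X)
  have hg : IsSelfAdjoint (cfc (fun x : ℝ => x * f (x⁻¹ - 1)) T) := cfc_predicate _ T
  have e1 := (ContinuousLinearMap.isSelfAdjoint_iff_isSymmetric.1 hg) a (T b)
  have e2 := (ContinuousLinearMap.isSelfAdjoint_iff_isSymmetric.1 hsa) a
    (cfc (fun x : ℝ => x * f (x⁻¹ - 1)) T b)
  have e3 : cfc (fun x : ℝ => x * f (x⁻¹ - 1)) T * T = T * cfc (fun x : ℝ => x * f (x⁻¹ - 1)) T := by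
    have := (cfc_commute_cfc (fun x : ℝ => x * f (x⁻¹ - 1)) id T).eq
    rwa [cfc_id ℝ T] at this
  refine e1.trans (Eq.trans ?_ e2.symm)
  exact congrArg (fun S : H →L[ℂ] H => ⟪a, S b⟫_ℂ) e3

/-- The spectral bound `A ≥ a`, in the form `(I + A)⁻¹ ≤ (1 + a)⁻¹` used throughout: the variable
`λ = x⁻¹ - 1` is at least `a` for `x ≠ 0` in the spectrum of `(I + A)⁻¹`. -/
theorem spectrum_resolventNegOne_inv_ge {a : ℝ}
    (hT : ∀ x ∈ spectrum ℝ (resolventNegOne (gram X)), x * (1 + a) ≤ 1) {x : ℝ}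
    (hx : x ∈ spectrum ℝ (resolventNegOne (gram X))) (h0 : x ≠ 0) : a ≤ x⁻¹ - 1 := by
  have hx0 : 0 < x := lt_of_le_of_ne (spectrum_resolventNegOne hX hc hx).1 (Ne.symm h0)
  have := hT x hx
  have h1 : 1 + a ≤ x⁻¹ := by
    rw [← one_div, le_div_iff₀ hx0]; linarith
  linarith

/-- If `A ≥ a`, then a bound for `f` on `[a, ∞)` bounds `f(A)`; the constant `C` only ensures that
`f(A)` is defined. -/
theorem norm_boundedFun_le {f : ℝ → ℝ} (hf : ContinuousOn f (Set.Ici 0)) {C : ℝ}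
    (hC : ∀ x, 0 ≤ x → |f x| ≤ C) {a C' : ℝ}
    (hT : ∀ x ∈ spectrum ℝ (resolventNegOne (gram X)), x * (1 + a) ≤ 1)
    (hC' : ∀ x, a ≤ x → |f x| ≤ C') (u : H) :
    ‖boundedFun f (gram X) u‖ ≤ C' * ‖u‖ := by
  have hC0 : 0 ≤ C' := (abs_nonneg _).trans (hC' a le_rfl)
  refine (denseRange_resolventNegOne hX hc).induction_on
    (p := fun u => ‖boundedFun f (gram X) u‖ ≤ C' * ‖u‖) u ?_ fun v => ?_
  · exact isClosed_le (by fun_prop) (by fun_prop)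
  have hsa := isSelfAdjoint_resolventNegOne hX hc
  rw [boundedFun_resolventNegOne_apply hX hc hf hC]
  refine (norm_cfc_apply_le hsa (continuousOn_spectrum_mul hX hc hf hC)
    (g := fun x => C' * id x) (by fun_prop) (fun x hx => ?_) v).trans (le_of_eq ?_)
  · rcases eq_or_ne x 0 with h | h
    · simp [h]
    · rw [abs_mul, id, abs_mul, abs_of_nonneg hC0, mul_comm]
      gcongr
      exact hC' _ (spectrum_resolventNegOne_inv_ge hX hc hT hx h)
  · rw [cfc_const_mul .., cfc_id .., smul_apply, norm_smul, Real.norm_of_nonneg hC0]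

/-- On the range of `T = (I + A)⁻¹`, the curve `s ↦ A^(-1/2) sin (s A^(1/2)) T v` is differentiable in
norm: one power of `T` makes the derivative `x cos (s √(x⁻¹ - 1))` Lipschitz in `s`, uniformly in
`x ∈ [0, 1]`. -/
theorem hasDerivAt_boundedFun_sinQuot (v : H) (s : ℝ) :
    HasDerivAt (fun s => boundedFun (sinQuot s) (gram X) (resolventNegOne (gram X) v))
      (boundedFun (fun x => Real.cos (s * √x)) (gram X) (resolventNegOne (gram X) v)) s := by
  have hsp := spectrum_resolventNegOne hX hc
  have hcos : ∀ s : ℝ, ContinuousOn (fun x : ℝ => x * Real.cos (s * √(x⁻¹ - 1)))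
      (spectrum ℝ (resolventNegOne (gram X))) := fun s =>
    continuousOn_spectrum_mul hX hc (continuousOn_cos_mul_sqrt s) fun x _ => Real.abs_cos_le_one _
  have hsin : ∀ s : ℝ, ContinuousOn (fun x : ℝ => x * sinQuot s (x⁻¹ - 1))
      (spectrum ℝ (resolventNegOne (gram X))) := fun s =>
    continuousOn_spectrum_mul hX hc (continuousOn_sinQuot s) fun x hx => abs_sinQuot_le s hx
  simp only [boundedFun_resolventNegOne_apply hX hc (continuousOn_sinQuot _)
      fun x hx => abs_sinQuot_le _ hx,
    boundedFun_resolventNegOne_apply hX hc (continuousOn_cos_mul_sqrt s)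
      fun x _ => Real.abs_cos_le_one _]
  refine hasDerivAt_cfc_apply
    (F := fun s x => x * sinQuot s (x⁻¹ - 1)) (F' := fun s x => x * Real.cos (s * √(x⁻¹ - 1)))
    (K := 1) hsin hcos (fun x hx s => ?_) zero_le_one (fun x hx r s => ?_) s v
  · rcases (hsp hx).1.eq_or_lt with h0 | h0
    · simpa [← h0] using hasDerivAt_const s (0 : ℝ)
    · exact (hasDerivAt_sinQuot (sub_nonneg.2 ((one_le_inv₀ h0).2 (hsp hx).2)) s).const_mul x
  · rcases (hsp hx).1.eq_or_lt with h0 | h0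
    · simp [← h0]
    · rw [← mul_sub, abs_mul, abs_of_pos h0]
      have h1 : √(x⁻¹ - 1) ≤ x⁻¹ := by
        have h3 : 1 ≤ x⁻¹ := (one_le_inv₀ h0).2 (hsp hx).2
        rw [Real.sqrt_le_left (by positivity)]
        nlinarith
      calc x * |Real.cos (r * √(x⁻¹ - 1)) - Real.cos (s * √(x⁻¹ - 1))|
          ≤ x * (√(x⁻¹ - 1) * |r - s|) := by
            gcongr; exact abs_cos_mul_sqrt_sub_le _ r s
        _ ≤ x * (x⁻¹ * |r - s|) := by gcongr
        _ = 1 * |r - s| := by rw [← mul_assoc, mul_inv_cancel₀ h0.ne']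

/-- On the range of `T²`, where `T = (I + A)⁻¹`, the curve `s ↦ cos (s A^(1/2)) T² v` is
differentiable; its derivative is `-A^(1/2) sin (s A^(1/2)) T² v`, written with the operator
`σ = A^(-1/2) sin (s A^(1/2)) T` and `A T = I - T`. -/
theorem hasDerivAt_boundedFun_cos (v : H) (s : ℝ) :
    HasDerivAt (fun s => boundedFun (fun x => Real.cos (s * √x)) (gram X)
        (resolventNegOne (gram X) (resolventNegOne (gram X) v)))
      (-(cfc (fun x : ℝ => x * sinQuot s (x⁻¹ - 1)) (resolventNegOne (gram X)) v -
        resolventNegOne (gram X)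
          (cfc (fun x : ℝ => x * sinQuot s (x⁻¹ - 1)) (resolventNegOne (gram X)) v))) s := by
  have hsp := spectrum_resolventNegOne hX hc
  have hsa := isSelfAdjoint_resolventNegOne hX hc
  have hcos : ∀ s : ℝ, ContinuousOn (fun x : ℝ => x * Real.cos (s * √(x⁻¹ - 1)))
      (spectrum ℝ (resolventNegOne (gram X))) := fun s =>
    continuousOn_spectrum_mul hX hc (continuousOn_cos_mul_sqrt s) fun x _ => Real.abs_cos_le_one _
  have hsin : ∀ s : ℝ, ContinuousOn (fun x : ℝ => x * sinQuot s (x⁻¹ - 1))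
      (spectrum ℝ (resolventNegOne (gram X))) := fun s =>
    continuousOn_spectrum_mul hX hc (continuousOn_sinQuot s) fun x hx => abs_sinQuot_le s hx
  simp only [boundedFun_resolventNegOne_apply hX hc (continuousOn_cos_mul_sqrt _)
      fun x _ => Real.abs_cos_le_one _]
  set T := resolventNegOne (gram X)
  have e1 : ∀ s : ℝ, cfc (fun x : ℝ => x * Real.cos (s * √(x⁻¹ - 1))) T (T v) =
      cfc (fun x : ℝ => x * Real.cos (s * √(x⁻¹ - 1)) * x) T v := fun s => by
    have := hcos s
    rw [cfc_mul (fun x : ℝ => x * Real.cos (s * √(x⁻¹ - 1))) (fun x => x) T, cfc_id' ..]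
    rfl
  have e2 : ∀ s : ℝ, -(cfc (fun x : ℝ => x * sinQuot s (x⁻¹ - 1)) T v -
      T (cfc (fun x : ℝ => x * sinQuot s (x⁻¹ - 1)) T v)) =
      cfc (fun x : ℝ => -((1 - x) * (x * sinQuot s (x⁻¹ - 1)))) T v := fun s => by
    have := hsin s
    rw [cfc_neg, cfc_mul (fun x : ℝ => 1 - x) (fun x => x * sinQuot s (x⁻¹ - 1)) T, cfc_sub ..,
      cfc_const_one .., cfc_id' ..]
    simp
  simp only [e1, e2]
  refine hasDerivAt_cfc_apply
    (F := fun s x => x * Real.cos (s * √(x⁻¹ - 1)) * x)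
    (F' := fun s x => -((1 - x) * (x * sinQuot s (x⁻¹ - 1))))
    (K := 1) (fun s => (hcos s).mul continuousOn_id)
    (fun s => ((continuousOn_const.sub continuousOn_id).mul (hsin s)).neg)
    (fun x hx s => ?_) zero_le_one (fun x hx r s => ?_) s v
  · rcases (hsp hx).1.eq_or_lt with h0 | h0
    · simpa [← h0] using hasDerivAt_const s (0 : ℝ)
    · refine (((hasDerivAt_cos_mul_sqrt (sub_nonneg.2 ((one_le_inv₀ h0).2 (hsp hx).2))
        s).const_mul x).mul_const x).congr_deriv ?_
      field_simp
  · rcases (hsp hx).1.eq_or_lt with h0 | h0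
    · simp [← h0]
    · have h3 : 0 ≤ x⁻¹ - 1 := sub_nonneg.2 ((one_le_inv₀ h0).2 (hsp hx).2)
      have h1 := abs_mul_sinQuot_sub_le h3 r s
      have e3 : -((1 - x) * (x * sinQuot r (x⁻¹ - 1))) - -((1 - x) * (x * sinQuot s (x⁻¹ - 1))) =
          -(x ^ 2 * ((x⁻¹ - 1) * sinQuot r (x⁻¹ - 1) - (x⁻¹ - 1) * sinQuot s (x⁻¹ - 1))) := by
        field_simp
        ring
      rw [e3, abs_neg, abs_mul, abs_of_nonneg (sq_nonneg x)]
      have hx1 := (hsp hx).2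
      calc _ ≤ x ^ 2 * ((x⁻¹ - 1) * |r - s|) := by gcongr
        _ = (x * (1 - x)) * |r - s| := by field_simp
        _ ≤ 1 * |r - s| := by
          gcongr
          nlinarith

/-- For `z = T² v` with `T = (I + A)⁻¹`, the vector `S z = A^(-1/2) sin (s A^(1/2)) z` lies in the
domain of `A = X* X`, and `‖X S z‖ = ‖sin (s A^(1/2)) z‖ ≤ ‖z‖`. -/
theorem boundedFun_sinQuot_mem_domain (v : H) (s : ℝ) :
    ∃ h : boundedFun (sinQuot s) (gram X)
        (resolventNegOne (gram X) (resolventNegOne (gram X) v)) ∈ X.domain,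
      (∀ w : X.domain, ⟪X ⟨_, h⟩, X w⟫_ℂ =
        ⟪cfc (fun x : ℝ => x * sinQuot s (x⁻¹ - 1)) (resolventNegOne (gram X)) v -
        resolventNegOne (gram X)
          (cfc (fun x : ℝ => x * sinQuot s (x⁻¹ - 1)) (resolventNegOne (gram X)) v), (w : H)⟫_ℂ) ∧
      ‖X ⟨_, h⟩‖ ≤ ‖resolventNegOne (gram X) (resolventNegOne (gram X) v)‖ := by
  have hsp := spectrum_resolventNegOne hX hc
  have hsa := isSelfAdjoint_resolventNegOne hX hc
  have hspec := resolventNegOne_spec hX hc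
  have hsin : ContinuousOn (fun x : ℝ => x * sinQuot s (x⁻¹ - 1))
      (spectrum ℝ (resolventNegOne (gram X))) :=
    continuousOn_spectrum_mul hX hc (continuousOn_sinQuot s) fun x hx => abs_sinQuot_le s hx
  have hsin' : ContinuousOn (fun x : ℝ => x * Real.sin (s * √(x⁻¹ - 1)))
      (spectrum ℝ (resolventNegOne (gram X))) :=
    continuousOn_spectrum_mul hX hc (f := fun x => Real.sin (s * √x)) (by fun_prop)
      fun x _ => Real.abs_sin_le_one _
  rw [boundedFun_resolventNegOne_apply hX hc (continuousOn_sinQuot s)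
    fun x hx => abs_sinQuot_le s hx]
  set T := resolventNegOne (gram X)
  set σ := cfc (fun x : ℝ => x * sinQuot s (x⁻¹ - 1)) T with hσ
  have hcomm : σ (T v) = T (σ v) := by
    have := (cfc_commute_cfc (fun x : ℝ => x * sinQuot s (x⁻¹ - 1)) id T).eq
    rw [cfc_id ℝ T] at this
    exact congrArg (fun S : H →L[ℂ] H => S v) this
  rw [hcomm]
  obtain ⟨h, h'⟩ := hspec (σ v)
  have h1 : ∀ w : X.domain, ⟪X ⟨T (σ v), h⟩, X w⟫_ℂ = ⟪σ v - T (σ v), (w : H)⟫_ℂ := fun w => by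
    rw [← inner_conj_symm, h' w, inner_conj_symm]
  refine ⟨h, h1, ?_⟩
  have e1 : σ v - T (σ v) = cfc (fun x : ℝ => (1 - x) * (x * sinQuot s (x⁻¹ - 1))) T v := by
    rw [cfc_mul .., cfc_sub .., cfc_const_one .., cfc_id' ..]
    simp [hσ]
  have e2 : T (σ v) = cfc (fun x : ℝ => x * (x * sinQuot s (x⁻¹ - 1))) T v := by
    rw [cfc_mul .., cfc_id' ..]
    rfl
  have hk : ContinuousOn (fun x : ℝ => x * (x * Real.sin (s * √(x⁻¹ - 1)))) (spectrum ℝ T) :=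
    continuousOn_id.mul hsin'
  have h2 := h1 ⟨_, h⟩
  rw [e1] at h2
  have e3 := inner_cfc_cfc (f := fun x : ℝ => (1 - x) * (x * sinQuot s (x⁻¹ - 1)))
    (g := fun x : ℝ => x * (x * sinQuot s (x⁻¹ - 1))) (by fun_prop) (by fun_prop) hk
    (fun x hx => ?_) v
  · rw [← e2, ← h2, inner_self_eq_norm_sq_to_K, inner_self_eq_norm_sq_to_K] at e3
    have h4 : ‖X ⟨T (σ v), h⟩‖ ^ 2 =
        ‖cfc (fun x : ℝ => x * (x * Real.sin (s * √(x⁻¹ - 1)))) T v‖ ^ 2 := by exact_mod_cast e3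
    have h5 : ‖X ⟨T (σ v), h⟩‖ =
        ‖cfc (fun x : ℝ => x * (x * Real.sin (s * √(x⁻¹ - 1)))) T v‖ := by
      rwa [sq_eq_sq₀ (norm_nonneg _) (norm_nonneg _)] at h4
    rw [h5]
    have e4 : T (T v) = cfc (fun x : ℝ => x * x) T v := by
      rw [cfc_mul .., cfc_id' ..]
      rfl
    rw [e4]
    refine norm_cfc_apply_le hsa hk (by fun_prop) (fun x hx => ?_) v
    rw [abs_mul, abs_mul, abs_mul]
    have := Real.abs_sin_le_one (s * √(x⁻¹ - 1))
    gcongr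
    exact mul_le_of_le_one_right (abs_nonneg _) this
  · rcases (hsp hx).1.eq_or_lt with h0 | h0
    · simp [← h0]
    · have h3 : 0 ≤ x⁻¹ - 1 := sub_nonneg.2 ((one_le_inv₀ h0).2 (hsp hx).2)
      have e5 : 1 - x = x * (√(x⁻¹ - 1) * √(x⁻¹ - 1)) := by
        rw [Real.mul_self_sqrt h3]; field_simp
      rw [← sqrt_mul_sinQuot s h3, e5]
      ring

end Calculus

/-! ### The cosine and the sine of a bounded nonnegative operator -/

section BoundedWave

variable {M : Type w} [NormedAddCommGroup M] [InnerProductSpace ℂ M] [CompleteSpace M]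
  {B : M →L[ℂ] M} (hB : IsSelfAdjoint B)

include hB

theorem hasDerivAt_cfc_cos (hsp : spectrum ℝ B ⊆ Set.Ici 0) (ω : M) (s : ℝ) :
    HasDerivAt (fun s => cfc (fun x => Real.cos (s * √x)) B ω) (-(B (cfc (sinQuot s) B ω))) s := by
  have hsin : ∀ s, ContinuousOn (sinQuot s) (spectrum ℝ B) := fun s =>
    (continuousOn_sinQuot s).mono hsp
  have e : -(B (cfc (sinQuot s) B ω)) = cfc (fun x => -(x * sinQuot s x)) B ω := by
    have := hsin s
    rw [cfc_neg, cfc_mul .., cfc_id' ..]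
    rfl
  rw [e]
  refine hasDerivAt_cfc_apply (F' := fun s x => -(x * sinQuot s x)) (K := ‖B‖ * ‖(1 : M →L[ℂ] M)‖)
    (fun s => by fun_prop) (fun s => (continuousOn_id.mul (hsin s)).neg)
    (fun x hx s => hasDerivAt_cos_mul_sqrt (hsp hx) s) (by positivity) (fun x hx r s => ?_) s ω
  rw [← neg_sub', abs_neg]
  refine (abs_mul_sinQuot_sub_le (hsp hx) r s).trans ?_
  gcongr
  exact (le_abs_self x).trans (spectrum.norm_le_norm_mul_of_mem hx)

theorem hasDerivAt_cfc_sinQuot (hsp : spectrum ℝ B ⊆ Set.Ici 0) (ω : M) (s : ℝ) :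
    HasDerivAt (fun s => cfc (sinQuot s) B ω) (cfc (fun x => Real.cos (s * √x)) B ω) s := by
  have hsin : ∀ s, ContinuousOn (sinQuot s) (spectrum ℝ B) := fun s =>
    (continuousOn_sinQuot s).mono hsp
  refine hasDerivAt_cfc_apply (F' := fun s x => Real.cos (s * √x))
    (K := √(‖B‖ * ‖(1 : M →L[ℂ] M)‖)) hsin (fun s => by fun_prop)
    (fun x hx s => hasDerivAt_sinQuot (hsp hx) s) (by positivity) (fun x hx r s => ?_) s ω
  refine (abs_cos_mul_sqrt_sub_le x r s).trans ?_
  gcongr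
  exact (le_abs_self x).trans (spectrum.norm_le_norm_mul_of_mem hx)

theorem norm_cfc_apply_le_mul {f : ℝ → ℝ} (hf : ContinuousOn f (spectrum ℝ B)) {C : ℝ}
    (hC : 0 ≤ C) (h : ∀ x ∈ spectrum ℝ B, |f x| ≤ C) (ω : M) : ‖cfc f B ω‖ ≤ C * ‖ω‖ := by
  refine (norm_cfc_apply_le hB hf (g := fun _ => C) (by fun_prop)
    (fun x hx => (h x hx).trans (le_abs_self C)) ω).trans (le_of_eq ?_)
  rw [cfc_const .., Algebra.algebraMap_eq_smul_one, smul_apply, norm_smul, Real.norm_of_nonneg hC]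
  rfl

theorem spectrum_subset_Ici {a : ℝ} (h : ∀ ω, a * ‖ω‖ ^ 2 ≤ (⟪B ω, ω⟫_ℂ).re) :
    spectrum ℝ B ⊆ Set.Ici a := by
  intro x hx
  refine (algebraMap_le_iff_le_spectrum (r := a) (a := B) hB).1 ?_ x hx
  rw [← sub_nonneg, ContinuousLinearMap.nonneg_iff_isPositive, ContinuousLinearMap.isPositive_def]
  refine ⟨(ContinuousLinearMap.isSelfAdjoint_iff_isSymmetric).1
    (hB.sub (IsSelfAdjoint.algebraMap _ (IsSelfAdjoint.all _))), fun ω => ?_⟩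
  have e : (B - algebraMap ℝ (M →L[ℂ] M) a) ω = B ω - (a : ℂ) • ω := by
    rw [sub_apply, Algebra.algebraMap_eq_smul_one, Complex.coe_smul, smul_apply]
    rfl
  have e3 : ⟪ω, ω⟫_ℂ = ((‖ω‖ ^ 2 : ℝ) : ℂ) := by
    rw [inner_self_eq_norm_sq_to_K]; norm_cast
  change 0 ≤ RCLike.re ⟪(B - algebraMap ℝ (M →L[ℂ] M) a) ω, ω⟫_ℂ
  rw [e, inner_sub_left, inner_smul_left, Complex.conj_ofReal, e3, ← Complex.ofReal_mul]
  change 0 ≤ (⟪B ω, ω⟫_ℂ - ((a * ‖ω‖ ^ 2 : ℝ) : ℂ)).re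
  rw [Complex.sub_re, Complex.ofReal_re]
  exact sub_nonneg.2 (h ω)

end BoundedWave

/-! ### Duhamel's principle for weakly intertwined operators -/

section Duhamel

variable {H : Type u} {Hs : Type v}
  [NormedAddCommGroup H] [InnerProductSpace ℂ H] [CompleteSpace H]
  [NormedAddCommGroup Hs] [InnerProductSpace ℂ Hs] [CompleteSpace Hs]
  {M : Type w} [NormedAddCommGroup M] [InnerProductSpace ℂ M] [CompleteSpace M]
  {X : H →ₗ.[ℂ] Hs}

/-- `V` intertwines the operators `X* X` on `H` and `B` on `M` up to the error `f + X* g`, in the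
weak sense: `X* X V = V B + f + X* g` as quadratic forms on `Dom X`. -/
def WeakIntertwining (X : H →ₗ.[ℂ] Hs) (B : M →L[ℂ] M) (V f : M →L[ℂ] H) (g : M →L[ℂ] Hs) : Prop :=
  ∀ ω, ∃ h : V ω ∈ X.domain, ∀ w : X.domain,
    ⟪X w, X ⟨V ω, h⟩⟫_ℂ = ⟪(w : H), V (B ω)⟫_ℂ + ⟪(w : H), f ω⟫_ℂ + ⟪X w, g ω⟫_ℂ

/-- A bound for a vector that has to be tested only on the dense range of `(I + A)⁻²`. -/
theorem norm_le_of_inner_resolventNegOne_sq (hX : Dense (X.domain : Set H)) (hc : X.IsClosed)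
    {d : H} {K : ℝ} (hK : 0 ≤ K)
    (h : ∀ v, ‖⟪resolventNegOne (gram X) (resolventNegOne (gram X) v), d⟫_ℂ‖ ≤
      K * ‖resolventNegOne (gram X) (resolventNegOne (gram X) v)‖) : ‖d‖ ≤ K := by
  have hd := denseRange_resolventNegOne hX hc
  have hd2 : DenseRange (fun v => resolventNegOne (gram X) (resolventNegOne (gram X) v)) :=
    hd.comp hd (resolventNegOne (gram X)).continuous
  have h1 : ∀ z, ‖⟪z, d⟫_ℂ‖ ≤ K * ‖z‖ := fun z =>
    hd2.induction_on (p := fun z => ‖⟪z, d⟫_ℂ‖ ≤ K * ‖z‖) z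
      (isClosed_le (by fun_prop) (by fun_prop)) h
  rcases eq_or_ne d 0 with rfl | hne
  · simpa using hK
  · have h2 := h1 d
    rw [inner_self_eq_norm_sq_to_K] at h2
    have h3 : ‖d‖ ^ 2 ≤ K * ‖d‖ := by simpa using h2
    have : 0 < ‖d‖ := norm_pos_iff.2 hne
    nlinarith

variable {B : M →L[ℂ] M} {V f : M →L[ℂ] H} {g : M →L[ℂ] Hs} {a ρ τ : ℝ}

/-- The integrand in Duhamel's formula. For `z = (I + A)⁻² v` the vector `S z`,
`S = A^(-1/2) sin (s A^(1/2))`, is an admissible test vector in the weak relation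
`A V = V B + f + X* g`, and `‖S z‖ ≤ ρ ‖z‖`, `‖X S z‖ ≤ ‖z‖`. The first inner product below is
`⟪A S z, V ω⟫`. -/
theorem norm_inner_sub_le_of_weakIntertwining (hX : Dense (X.domain : Set H)) (hc : X.IsClosed)
    (hV : WeakIntertwining X B V f g)
    (hT : ∀ x ∈ spectrum ℝ (resolventNegOne (gram X)), x * (1 + a) ≤ 1) {s : ℝ}
    (hρ : ∀ y, a ≤ y → |sinQuot s y| ≤ ρ) (v : H) (ω : M) :
    ‖⟪cfc (fun x : ℝ => x * sinQuot s (x⁻¹ - 1)) (resolventNegOne (gram X)) v -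
        resolventNegOne (gram X)
          (cfc (fun x : ℝ => x * sinQuot s (x⁻¹ - 1)) (resolventNegOne (gram X)) v), V ω⟫_ℂ -
      ⟪boundedFun (sinQuot s) (gram X)
        (resolventNegOne (gram X) (resolventNegOne (gram X) v)), V (B ω)⟫_ℂ‖ ≤
      (ρ * ‖f‖ + ‖g‖) * ‖ω‖ * ‖resolventNegOne (gram X) (resolventNegOne (gram X) v)‖ := by
  obtain ⟨h, h1, h2⟩ := boundedFun_sinQuot_mem_domain hX hc v s
  have h3 := norm_boundedFun_le hX hc (continuousOn_sinQuot s) (fun x hx => abs_sinQuot_le s hx)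
    hT hρ (resolventNegOne (gram X) (resolventNegOne (gram X) v))
  obtain ⟨k, hk⟩ := hV ω
  rw [← h1 ⟨V ω, k⟩, hk ⟨_, h⟩, add_assoc, add_sub_cancel_left]
  refine (norm_add_le _ _).trans ?_
  refine (add_le_add (norm_inner_le_norm _ _) (norm_inner_le_norm _ _)).trans ?_
  have hf := f.le_opNorm ω
  have hg := g.le_opNorm ω
  have hρ0 : 0 ≤ ρ := (abs_nonneg _).trans (hρ a le_rfl)
  calc _ ≤ ρ * ‖resolventNegOne (gram X) (resolventNegOne (gram X) v)‖ * (‖f‖ * ‖ω‖) +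
        ‖resolventNegOne (gram X) (resolventNegOne (gram X) v)‖ * (‖g‖ * ‖ω‖) := by
        gcongr
    _ = _ := by ring

theorem boundedFun_cos_zero (hX : Dense (X.domain : Set H)) (hc : X.IsClosed) (v : H) :
    boundedFun (fun x => Real.cos (0 * √x)) (gram X) (resolventNegOne (gram X) v) =
      resolventNegOne (gram X) v := by
  have := isSelfAdjoint_resolventNegOne hX hc
  rw [boundedFun_resolventNegOne_apply hX hc (continuousOn_cos_mul_sqrt 0)
      fun x _ => Real.abs_cos_le_one _]
  simp only [zero_mul, Real.cos_zero, mul_one]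
  rw [cfc_id' ..]

theorem boundedFun_sinQuot_zero (hX : Dense (X.domain : Set H)) (hc : X.IsClosed) (v : H) :
    boundedFun (sinQuot 0) (gram X) (resolventNegOne (gram X) v) = 0 := by
  have h0 : ∀ x, sinQuot 0 x = 0 := fun x => by simp [sinQuot]
  rw [boundedFun_resolventNegOne_apply hX hc (continuousOn_sinQuot 0)
      fun x hx => abs_sinQuot_le 0 hx]
  simp only [h0, mul_zero, cfc_const_zero, zero_apply]

/-- Duhamel's principle for the cosine: the defect of `V` as an intertwiner of `X* X` and `B` bounds
the defect for `cos (τ (·)^(1/2))`. The comparison curve is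
`s ↦ cos ((τ - s) A^(1/2)) V cos (s B^(1/2)) - A^(-1/2) sin ((τ - s) A^(1/2)) V B^(1/2) sin (s B^(1/2))`,
`A = X* X`, whose derivative is
`A^(-1/2) sin ((τ - s) A^(1/2)) (A V - V B) cos (s B^(1/2))`. -/
theorem norm_boundedFun_cos_sub_le (hX : Dense (X.domain : Set H)) (hc : X.IsClosed)
    (hV : WeakIntertwining X B V f g)
    (hT : ∀ x ∈ spectrum ℝ (resolventNegOne (gram X)), x * (1 + a) ≤ 1)
    (hB : IsSelfAdjoint B) (hsp : spectrum ℝ B ⊆ Set.Ici 0)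
    (hρ : ∀ s y, |s| ≤ |τ| → a ≤ y → |sinQuot s y| ≤ ρ) (ω : M) :
    ‖boundedFun (fun x => Real.cos (τ * √x)) (gram X) (V ω) -
      V (cfc (fun x => Real.cos (τ * √x)) B ω)‖ ≤ (ρ * ‖f‖ + ‖g‖) * |τ| * ‖ω‖ := by
  have hρ0 : 0 ≤ ρ := (abs_nonneg _).trans (hρ 0 a (by simp) le_rfl)
  refine norm_le_of_inner_resolventNegOne_sq hX hc (by positivity) fun v => ?_
  set z := resolventNegOne (gram X) (resolventNegOne (gram X) v) with hz
  have hVd : ∀ {k : ℝ → M} {k' : M} {s : ℝ}, HasDerivAt k k' s →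
      HasDerivAt (fun s => V (k s)) (V k') s := fun h =>
    (V.restrictScalars ℝ).hasFDerivAt.comp_hasDerivAt _ h
  have hBd : ∀ {k : ℝ → M} {k' : M} {s : ℝ}, HasDerivAt k k' s →
      HasDerivAt (fun s => B (k s)) (B k') s := fun h =>
    (B.restrictScalars ℝ).hasFDerivAt.comp_hasDerivAt _ h
  have hG : ∀ s, HasDerivAt (fun s =>
      ⟪boundedFun (fun x => Real.cos ((τ - s) * √x)) (gram X) z,
        V (cfc (fun x => Real.cos (s * √x)) B ω)⟫_ℂ -
      ⟪boundedFun (sinQuot (τ - s)) (gram X) z, V (B (cfc (sinQuot s) B ω))⟫_ℂ) _ s := fun s =>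
    (((hasDerivAt_boundedFun_cos hX hc v (τ - s)).comp_const_sub τ s).inner ℂ
      (hVd (hasDerivAt_cfc_cos hB hsp ω s))).sub
    (((hasDerivAt_boundedFun_sinQuot hX hc (resolventNegOne (gram X) v)
      (τ - s)).comp_const_sub τ s).inner ℂ (hVd (hBd (hasDerivAt_cfc_sinQuot hB hsp ω s))))
  have hmv := Convex.norm_image_sub_le_of_norm_hasDerivWithin_le (s := Set.uIcc 0 τ) (x := 0)
    (y := τ) (C := (ρ * ‖f‖ + ‖g‖) * ‖ω‖ * ‖z‖)
    (fun s _ => (hG s).hasDerivWithinAt) (fun s hs => ?_) (convex_uIcc _ _) Set.left_mem_uIcc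
    Set.right_mem_uIcc
  · have e1 : ⟪z, boundedFun (fun x => Real.cos (τ * √x)) (gram X) (V ω) -
        V (cfc (fun x => Real.cos (τ * √x)) B ω)⟫_ℂ =
        ⟪boundedFun (fun x => Real.cos (τ * √x)) (gram X) z, V ω⟫_ℂ -
          ⟪z, V (cfc (fun x => Real.cos (τ * √x)) B ω)⟫_ℂ := by
      rw [inner_sub_right, inner_boundedFun_left hX hc (continuousOn_cos_mul_sqrt τ)
        fun x _ => Real.abs_cos_le_one _]
    have h0 : ∀ x, sinQuot 0 x = 0 := fun x => by simp [sinQuot]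
    have e2 : cfc (fun x => Real.cos (0 * √x)) B ω = ω := by
      simp only [zero_mul, Real.cos_zero]
      rw [cfc_const_one ..]
      rfl
    have e3 : cfc (sinQuot 0) B ω = 0 := by
      rw [show sinQuot 0 = fun _ => (0 : ℝ) from funext h0, cfc_const_zero, zero_apply]
    rw [e1, ← norm_neg, neg_sub]
    simp only [sub_self, sub_zero] at hmv
    rw [hz, boundedFun_cos_zero hX hc, boundedFun_sinQuot_zero hX hc, e2, e3, ← hz] at hmv
    simp only [inner_zero_left, map_zero, inner_zero_right, sub_zero] at hmv
    refine hmv.trans (le_of_eq ?_)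
    rw [Real.norm_eq_abs]
    ring
  · have h1 := norm_inner_sub_le_of_weakIntertwining hX hc hV hT (s := τ - s)
      (fun y hy => hρ (τ - s) y (by
        rw [abs_sub_comm]
        simpa [abs_sub_comm] using Set.abs_sub_right_of_mem_uIcc hs) hy) v
        (cfc (fun x => Real.cos (s * √x)) B ω)
    rw [← hz] at h1
    have h2 : ‖cfc (fun x => Real.cos (s * √x)) B ω‖ ≤ 1 * ‖ω‖ :=
      norm_cfc_apply_le_mul hB (by fun_prop) zero_le_one (fun x _ => Real.abs_cos_le_one _) ω
    rw [one_mul] at h2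
    have h3 : (ρ * ‖f‖ + ‖g‖) * ‖cfc (fun x => Real.cos (s * √x)) B ω‖ * ‖z‖ ≤
        (ρ * ‖f‖ + ‖g‖) * ‖ω‖ * ‖z‖ := by gcongr
    refine le_trans (le_of_eq ?_) (h1.trans h3)
    congr 1
    rw [neg_neg, map_neg, inner_neg_right, inner_neg_left]
    ring

/-- Duhamel's principle for `λ ↦ λ^(-1/2) sin (τ λ^(1/2))`. The comparison curve is
`s ↦ A^(-1/2) sin ((τ - s) A^(1/2)) V cos (s B^(1/2)) + cos ((τ - s) A^(1/2)) V B^(-1/2) sin (s B^(1/2))`,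
with derivative `A^(-1/2) sin ((τ - s) A^(1/2)) (A V - V B) B^(-1/2) sin (s B^(1/2))`; the second factor
`ρ` comes from `B`. -/
theorem norm_boundedFun_sinQuot_sub_le (hX : Dense (X.domain : Set H)) (hc : X.IsClosed)
    (hV : WeakIntertwining X B V f g) (ha : 0 ≤ a)
    (hT : ∀ x ∈ spectrum ℝ (resolventNegOne (gram X)), x * (1 + a) ≤ 1)
    (hB : IsSelfAdjoint B) (hsp : spectrum ℝ B ⊆ Set.Ici a)
    (hρ : ∀ s y, |s| ≤ |τ| → a ≤ y → |sinQuot s y| ≤ ρ) (ω : M) :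
    ‖boundedFun (sinQuot τ) (gram X) (V ω) - V (cfc (sinQuot τ) B ω)‖ ≤
      (ρ * ‖f‖ + ‖g‖) * ρ * |τ| * ‖ω‖ := by
  have hsp0 : spectrum ℝ B ⊆ Set.Ici 0 := hsp.trans (Set.Ici_subset_Ici.2 ha)
  have hρ0 : 0 ≤ ρ := (abs_nonneg _).trans (hρ 0 a (by simp) le_rfl)
  refine norm_le_of_inner_resolventNegOne_sq hX hc (by positivity) fun v => ?_
  set z := resolventNegOne (gram X) (resolventNegOne (gram X) v) with hz
  have hVd : ∀ {k : ℝ → M} {k' : M} {s : ℝ}, HasDerivAt k k' s →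
      HasDerivAt (fun s => V (k s)) (V k') s := fun h =>
    (V.restrictScalars ℝ).hasFDerivAt.comp_hasDerivAt _ h
  have hG : ∀ s, HasDerivAt (fun s =>
      ⟪boundedFun (sinQuot (τ - s)) (gram X) z, V (cfc (fun x => Real.cos (s * √x)) B ω)⟫_ℂ +
      ⟪boundedFun (fun x => Real.cos ((τ - s) * √x)) (gram X) z,
        V (cfc (sinQuot s) B ω)⟫_ℂ) _ s := fun s =>
    (((hasDerivAt_boundedFun_sinQuot hX hc (resolventNegOne (gram X) v)
      (τ - s)).comp_const_sub τ s).inner ℂ (hVd (hasDerivAt_cfc_cos hB hsp0 ω s))).add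
    (((hasDerivAt_boundedFun_cos hX hc v (τ - s)).comp_const_sub τ s).inner ℂ
      (hVd (hasDerivAt_cfc_sinQuot hB hsp0 ω s)))
  have hmv := Convex.norm_image_sub_le_of_norm_hasDerivWithin_le (s := Set.uIcc 0 τ) (x := 0)
    (y := τ) (C := (ρ * ‖f‖ + ‖g‖) * (ρ * ‖ω‖) * ‖z‖)
    (fun s _ => (hG s).hasDerivWithinAt) (fun s hs => ?_) (convex_uIcc _ _) Set.left_mem_uIcc
    Set.right_mem_uIcc
  · have e1 : ⟪z, boundedFun (sinQuot τ) (gram X) (V ω) - V (cfc (sinQuot τ) B ω)⟫_ℂ =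
        ⟪boundedFun (sinQuot τ) (gram X) z, V ω⟫_ℂ - ⟪z, V (cfc (sinQuot τ) B ω)⟫_ℂ := by
      rw [inner_sub_right, inner_boundedFun_left hX hc (continuousOn_sinQuot τ)
        fun x hx => abs_sinQuot_le τ hx]
    have h0 : ∀ x, sinQuot 0 x = 0 := fun x => by simp [sinQuot]
    have e2 : cfc (fun x => Real.cos (0 * √x)) B ω = ω := by
      simp only [zero_mul, Real.cos_zero]
      rw [cfc_const_one ..]
      rfl
    have e3 : cfc (sinQuot 0) B ω = 0 := by
      rw [show sinQuot 0 = fun _ => (0 : ℝ) from funext h0, cfc_const_zero, zero_apply]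
    rw [e1, ← norm_neg, neg_sub]
    simp only [sub_self, sub_zero] at hmv
    rw [hz, boundedFun_cos_zero hX hc, boundedFun_sinQuot_zero hX hc, e2, e3, ← hz] at hmv
    simp only [inner_zero_left, map_zero, inner_zero_right, zero_add, add_zero] at hmv
    refine hmv.trans (le_of_eq ?_)
    rw [Real.norm_eq_abs]
    ring
  · have hs1 : |τ - s| ≤ |τ| := by
      rw [abs_sub_comm]
      simpa [abs_sub_comm] using Set.abs_sub_right_of_mem_uIcc hs
    have hs2 : |s| ≤ |τ| := by simpa using Set.abs_sub_left_of_mem_uIcc hs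
    have h1 := norm_inner_sub_le_of_weakIntertwining hX hc hV hT (s := τ - s)
      (fun y hy => hρ (τ - s) y hs1 hy) v (cfc (sinQuot s) B ω)
    rw [← hz] at h1
    have h2 : ‖cfc (sinQuot s) B ω‖ ≤ ρ * ‖ω‖ :=
      norm_cfc_apply_le_mul hB ((continuousOn_sinQuot s).mono hsp0) hρ0
        (fun x hx => hρ s x hs2 (hsp hx)) ω
    have h3 : (ρ * ‖f‖ + ‖g‖) * ‖cfc (sinQuot s) B ω‖ * ‖z‖ ≤
        (ρ * ‖f‖ + ‖g‖) * (ρ * ‖ω‖) * ‖z‖ := by gcongr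
    refine le_trans (le_of_eq ?_) (h1.trans h3)
    congr 1
    rw [neg_neg, map_neg, inner_neg_right, inner_neg_left]
    ring

end Duhamel

/-! ### Lower bounds for `X* X` -/

section LowerBound

variable {H : Type u} {Hs : Type v}
  [NormedAddCommGroup H] [InnerProductSpace ℂ H] [CompleteSpace H]
  [NormedAddCommGroup Hs] [InnerProductSpace ℂ Hs] [CompleteSpace Hs]
  {X : H →ₗ.[ℂ] Hs}

/-- If `X* X ≥ a`, then `(I + X* X)⁻¹ ≤ (1 + a)⁻¹`. -/
theorem spectrum_resolventNegOne_mul_le (hX : Dense (X.domain : Set H)) (hc : X.IsClosed) {a : ℝ}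
    (ha : 0 ≤ a) (hA : ∀ u : (gram X).domain, a * ‖(u : H)‖ ^ 2 ≤ (⟪(u : H), gram X u⟫_ℂ).re) :
    ∀ x ∈ spectrum ℝ (resolventNegOne (gram X)), x * (1 + a) ≤ 1 := by
  have hres := isResolvent_resolventNegOne hX hc
  set T := resolventNegOne (gram X) with hT
  have hn : ‖T‖ ≤ (1 + a)⁻¹ := ContinuousLinearMap.opNorm_le_bound _ (by positivity) fun u => by
    obtain ⟨h, e⟩ := hres.1 u
    have h1 := hA ⟨T u, h⟩
    have e1 : gram X ⟨T u, h⟩ = u - T u := by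
      rw [eq_sub_iff_add_eq]
      simpa using e
    rw [e1, inner_sub_right, inner_self_eq_norm_sq_to_K, Complex.sub_re] at h1
    have h2 : ((‖T u‖ : ℂ) ^ 2).re = ‖T u‖ ^ 2 := by norm_cast
    have h3 : (⟪T u, u⟫_ℂ).re ≤ ‖T u‖ * ‖u‖ := (Complex.re_le_norm _).trans (norm_inner_le_norm _ _)
    change a * ‖T u‖ ^ 2 ≤ _ - ((‖T u‖ : ℂ) ^ 2).re at h1
    rw [h2] at h1
    rw [inv_mul_eq_div, le_div_iff₀ (by positivity)]
    by_contra! hcon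
    have : 0 < ‖T u‖ := by
      by_contra! h0
      have : ‖T u‖ = 0 := le_antisymm h0 (norm_nonneg _)
      rw [this, zero_mul] at hcon
      exact absurd hcon (not_lt.2 (norm_nonneg _))
    nlinarith
  intro x hx
  have h1 := spectrum.norm_le_norm_mul_of_mem hx
  have h2 : ‖(1 : H →L[ℂ] H)‖ ≤ 1 := ContinuousLinearMap.norm_id_le
  have h3 : x ≤ (1 + a)⁻¹ :=
    (le_abs_self x).trans (h1.trans ((mul_le_of_le_one_right (norm_nonneg _) h2).trans hn))
  calc x * (1 + a) ≤ (1 + a)⁻¹ * (1 + a) := by gcongr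
    _ = 1 := inv_mul_cancel₀ (by positivity)

/-- The bound `X* X ≥ a` extends from the domain of `X* X` to the form domain `Dom X`. -/
theorem le_norm_sq_of_gram_ge (hX : Dense (X.domain : Set H)) (hc : X.IsClosed) {a : ℝ}
    (ha : 0 ≤ a) (hA : ∀ u : (gram X).domain, a * ‖(u : H)‖ ^ 2 ≤ (⟪(u : H), gram X u⟫_ℂ).re)
    (w : X.domain) : a * ‖(w : H)‖ ^ 2 ≤ ‖X w‖ ^ 2 := by
  rcases ha.eq_or_lt with rfl | ha0
  · simp
  have hsp := spectrum_resolventNegOne_mul_le hX hc ha hA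
  have hres := isResolvent_resolventNegOne hX hc
  have hspec := resolventNegOne_spec hX hc
  set T := resolventNegOne (gram X) with hT
  have h1 : (1 : ℝ) ∉ spectrum ℝ T := fun h => by linarith [hsp 1 h]
  rw [spectrum.notMem_iff, map_one, isUnit_iff_exists] at h1
  obtain ⟨S, hS, -⟩ := h1
  have hu : S (w : H) - T (S (w : H)) = w := congrArg (fun S : H →L[ℂ] H => S (w : H)) hS
  obtain ⟨k, hk⟩ := hspec (S (w : H))
  rw [hu] at hk
  obtain ⟨l, hl⟩ := gram_mk hX ⟨_, k⟩ _ hk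
  have h2 := hA ⟨_, l⟩
  rw [hl] at h2
  set φ : X.domain := ⟨_, k⟩ with hφ
  change a * ‖(φ : H)‖ ^ 2 ≤ (⟪(φ : H), (w : H)⟫_ℂ).re at h2
  have h3 : ‖X φ‖ ^ 2 = (⟪(φ : H), (w : H)⟫_ℂ).re := by
    rw [← hk φ, inner_self_eq_norm_sq_to_K]
    norm_cast
  have h4 : ‖(w : H)‖ ^ 2 ≤ ‖X w‖ * ‖X φ‖ := by
    have := hk w
    rw [inner_self_eq_norm_sq_to_K] at this
    calc ‖(w : H)‖ ^ 2 = ‖((‖(w : H)‖ : ℂ)) ^ 2‖ := by simp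
      _ = ‖⟪X w, X φ⟫_ℂ‖ := congrArg norm this.symm
      _ ≤ _ := norm_inner_le_norm _ _
  have h5 : (⟪(φ : H), (w : H)⟫_ℂ).re ≤ ‖(φ : H)‖ * ‖(w : H)‖ :=
    (Complex.re_le_norm _).trans (norm_inner_le_norm _ _)
  have h6 : a * ‖(φ : H)‖ ≤ ‖(w : H)‖ := by
    rcases (norm_nonneg (φ : H)).eq_or_lt with h | h
    · rw [← h, mul_zero]; exact norm_nonneg _
    · by_contra! hcon
      nlinarith
  have h7 : a * ‖X φ‖ ^ 2 ≤ ‖(w : H)‖ ^ 2 := by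
    nlinarith [norm_nonneg (w : H), norm_nonneg (φ : H)]
  rcases (norm_nonneg (w : H)).eq_or_lt with h | h
  · rw [← h]; simp
  · have h8 : a * (‖(w : H)‖ ^ 2) ^ 2 ≤ ‖X w‖ ^ 2 * ‖(w : H)‖ ^ 2 := by
      calc a * (‖(w : H)‖ ^ 2) ^ 2 ≤ a * (‖X w‖ * ‖X φ‖) ^ 2 := by gcongr
        _ = ‖X w‖ ^ 2 * (a * ‖X φ‖ ^ 2) := by ring
        _ ≤ _ := by gcongr
    have h9 : 0 < ‖(w : H)‖ ^ 2 := by positivity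
    nlinarith

end LowerBound

/-! ### The spectral gap and the weak solution operator -/

section Gap

variable {H : Type u} {Hs : Type v}
  [NormedAddCommGroup H] [InnerProductSpace ℂ H] [CompleteSpace H]
  [NormedAddCommGroup Hs] [InnerProductSpace ℂ Hs] [CompleteSpace Hs]
  {X : H →ₗ.[ℂ] Hs}

/-- A quantitative form of `spectrum_resolventNegOne_of_gap`: the spectrum of `(I + X* X)⁻¹` avoids
`((1 + d)⁻¹, 1)` for every `d` below the gap. -/
theorem spectrum_resolventNegOne_of_lt_gap (hX : Dense (X.domain : Set H))
    (hc : X.IsClosed) {d : ℝ} (hd0 : 0 < d) (hd : ENNReal.ofReal d < gap X) :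
    ∀ x ∈ spectrum ℝ (resolventNegOne (gram X)), x ≤ (1 + d)⁻¹ ∨ x = 1 := by
  obtain ⟨T, hT⟩ : ∃ T, T = resolventNegOne (gram X) := ⟨_, rfl⟩
  have hsp := spectrum_resolventNegOne hX hc
  have hres := isResolvent_resolventNegOne hX hc
  rw [← hT] at hsp hres ⊢
  intro x hx
  by_contra! hcon
  have hx1 : x < 1 := lt_of_le_of_ne (hsp hx).2 hcon.2
  have hx0 : 0 < x := lt_trans (by positivity) hcon.1
  have hl0 : 0 < x⁻¹ - 1 := sub_pos.2 ((one_lt_inv₀ hx0).2 hx1)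
  have hld : x⁻¹ - 1 < d := by
    have := (inv_lt_comm₀ (by linarith) hx0).1 hcon.1
    linarith
  have hns : ((x⁻¹ - 1 : ℝ) : ℂ) ∉ spec (gram X) := fun hmem => by
    have h1 : gap X ≤ edist (0 : ℂ) ((x⁻¹ - 1 : ℝ) : ℂ) :=
      Metric.infEDist_le_edist_of_mem ⟨hmem, by
        rw [Set.mem_singleton_iff]; exact_mod_cast hl0.ne'⟩
    rw [edist_dist, dist_zero_left, Complex.norm_real, Real.norm_of_nonneg hl0.le] at h1
    exact absurd (hd.trans_le h1) (not_lt.2 (ENNReal.ofReal_le_ofReal hld.le))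
  obtain ⟨B, hB⟩ : ∃ B, IsResolvent (gram X) ((x⁻¹ - 1 : ℝ) : ℂ) B := by
    simpa [spec] using hns
  have hxc : (x : ℂ) ≠ 0 := by exact_mod_cast hx0.ne'
  have e1 : ∀ u, T (u + (x : ℂ)⁻¹ • B u) = B u := fun u => by
    obtain ⟨h, e⟩ := hB.1 u
    have := hres.2 ⟨B u, h⟩
    rw [sub_eq_iff_eq_add.1 e] at this
    refine Eq.trans (congrArg T ?_) this
    simp only [Complex.ofReal_sub, Complex.ofReal_inv, Complex.ofReal_one]
    module
  have e2 : ∀ u, B (u - (x : ℂ)⁻¹ • T u) = T u := fun u => by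
    obtain ⟨h, e⟩ := hres.1 u
    have := hB.2 ⟨T u, h⟩
    rw [sub_eq_iff_eq_add.1 e] at this
    refine Eq.trans (congrArg B ?_) this
    simp only [Complex.ofReal_sub, Complex.ofReal_inv, Complex.ofReal_one]
    module
  refine hx ?_
  have hval : (algebraMap ℝ (H →L[ℂ] H) x - T : H →L[ℂ] H) = (x : ℂ) • 1 - T := by
    ext u
    simp [Algebra.algebraMap_eq_smul_one]
  rw [spectrum.mem_resolventSet_iff, hval, isUnit_iff_exists]
  refine ⟨(x : ℂ)⁻¹ • (1 + (x : ℂ)⁻¹ • B), ?_, ?_⟩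
  · ext u
    change (x : ℂ) • ((x : ℂ)⁻¹ • (u + (x : ℂ)⁻¹ • B u)) - T ((x : ℂ)⁻¹ • (u + (x : ℂ)⁻¹ • B u)) = u
    rw [map_smul, e1, smul_inv_smul₀ hxc, add_sub_cancel_right]
  · ext u
    change (x : ℂ)⁻¹ • ((x : ℂ) • u - T u + (x : ℂ)⁻¹ • B ((x : ℂ) • u - T u)) = u
    have h1 : (x : ℂ) • u - T u = (x : ℂ) • (u - (x : ℂ)⁻¹ • T u) := by
      rw [smul_sub, smul_inv_smul₀ hxc]
    have h2 : B ((x : ℂ) • u - T u) = (x : ℂ) • T u := by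
      rw [h1, map_smul, e2]
    rw [h2, inv_smul_smul₀ hxc, sub_add_cancel, inv_smul_smul₀ hxc]

/-- If `X* X φ = y`, then `d ‖X φ‖² ≤ ‖y‖²` for every `d` below the spectral gap: on the spectrum of
`A = X* X` one has `λ² ≥ d λ`. -/
theorem mul_norm_sq_le_of_lt_gap (hX : Dense (X.domain : Set H))
    (hc : X.IsClosed) {d : ℝ} (hd0 : 0 < d) (hd : ENNReal.ofReal d < gap X) {φ : X.domain} {y : H}
    (hφ : ∀ w : X.domain, ⟪X w, X φ⟫_ℂ = ⟪(w : H), y⟫_ℂ) : d * ‖X φ‖ ^ 2 ≤ ‖y‖ ^ 2 := by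
  have hsp := spectrum_resolventNegOne_of_lt_gap hX hc hd0 hd
  have hsa := isSelfAdjoint_resolventNegOne hX hc
  obtain ⟨h, hh⟩ := gram_mk hX φ y hφ
  have h1 := (isResolvent_resolventNegOne hX hc).2 ⟨φ, h⟩
  rw [hh] at h1
  set T := resolventNegOne (gram X)
  have h2 : T (y + φ) = φ := by simpa using h1
  have h3 : 0 ≤ cfc (fun x => (1 - x) * (1 - (1 + d) * x)) T := by
    refine cfc_nonneg fun x hx => ?_
    rcases hsp x hx with h | h
    · have h4 : (1 + d) * x ≤ 1 := by
        calc (1 + d) * x ≤ (1 + d) * (1 + d)⁻¹ := by gcongr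
          _ = 1 := mul_inv_cancel₀ (by positivity)
      have h5 : x ≤ 1 := h.trans (inv_le_one_of_one_le₀ (by linarith))
      exact mul_nonneg (by linarith) (by linarith)
    · simp [h]
  rw [cfc_mul .., cfc_sub .., cfc_sub .., cfc_const_one .., cfc_const_mul .., cfc_id' ..] at h3
  have h4 := ((ContinuousLinearMap.nonneg_iff_isPositive _).1 h3).re_inner_nonneg_right (y + φ)
  have h5 : IsSelfAdjoint (1 - T) := (IsSelfAdjoint.one _).sub hsa
  have h6 : ⟪y + (φ : H), ((1 - T) * (1 - (1 + d) • T)) (y + φ)⟫_ℂ =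
      ⟪(1 - T) (y + φ), (1 - (1 + d) • T) (y + φ)⟫_ℂ :=
    ((ContinuousLinearMap.isSelfAdjoint_iff_isSymmetric.1 h5) _ _).symm
  have h7 : (1 - T) (y + φ) = y := by
    rw [sub_apply, h2]; simp
  have h8 : (1 - (1 + d) • T) (y + φ) = y - (d : ℂ) • (φ : H) := by
    change (y + (φ : H)) - (1 + d) • T (y + φ) = _
    rw [h2, add_smul, one_smul, Complex.coe_smul]
    abel
  rw [h6, h7, h8, inner_sub_right, inner_smul_right, ← inner_conj_symm y (φ : H), ← hφ,
    inner_self_eq_norm_sq_to_K, inner_self_eq_norm_sq_to_K] at h4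
  have h9 : Complex.re ((‖y‖ : ℂ) ^ 2 - (d : ℂ) * (starRingEnd ℂ) ((‖X φ‖ : ℂ) ^ 2)) =
      ‖y‖ ^ 2 - d * ‖X φ‖ ^ 2 := by
    rw [map_pow, Complex.conj_ofReal]
    norm_cast
  have h10 := h4.trans_eq h9
  linarith

/-- The operator `Q : η ↦ φ` solving `X* (X φ + η) = 0` weakly, together with `Γ = X Q + I` (the
orthogonal projection along the range of `X`), with the bounds that follow from a spectral
gap `d` of `X* X`. The adjoint of `-Q` inverts `X*`. -/
theorem exists_solutionOperator (hX : Dense (X.domain : Set H)) (hc : X.IsClosed)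
    [(kernel X).HasOrthogonalProjection] {d : ℝ} (hd0 : 0 < d) (hd : ENNReal.ofReal d < gap X) :
    ∃ (Q : Hs →L[ℂ] H) (Γ : Hs →L[ℂ] Hs), (∀ η, IsWeakSolution X η (Q η)) ∧
      (∀ η, ∃ h : Q η ∈ X.domain, X ⟨Q η, h⟩ = Γ η - η) ∧ (∀ η (w : X.domain), ⟪X w, Γ η⟫_ℂ = 0) ∧
      ‖Q‖ ≤ (√d)⁻¹ ∧ ‖Γ‖ ≤ 1 ∧
      ∀ y ∈ (kernel X)ᗮ, ∀ w : X.domain,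
        ⟪X w, -(ContinuousLinearMap.adjoint Q y)⟫_ℂ = ⟪(w : H), y⟫_ℂ := by
  obtain ⟨Q, hQ⟩ := exists_weakSolution hX hc ((zero_le).trans_lt hd)
  have hQd : ∀ η, Q η ∈ X.domain := fun η => (hQ η).2.choose
  have hQo : ∀ η (w : X.domain), ⟪X w, X ⟨Q η, hQd η⟩ + η⟫_ℂ = 0 := fun η => (hQ η).2.choose_spec
  have hpy : ∀ η, ‖X ⟨Q η, hQd η⟩ + η‖ ^ 2 + ‖X ⟨Q η, hQd η⟩‖ ^ 2 = ‖η‖ ^ 2 := fun η => by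
    have h := hQo η ⟨Q η, hQd η⟩
    have h1 : η = (X ⟨Q η, hQd η⟩ + η) - X ⟨Q η, hQd η⟩ := by abel
    have h2 := @norm_sub_sq ℂ _ _ _ _ (X ⟨Q η, hQd η⟩ + η) (X ⟨Q η, hQd η⟩)
    rw [← h1, ← inner_conj_symm, h] at h2
    simp at h2
    linarith
  let Γ : Hs →L[ℂ] Hs := LinearMap.mkContinuous
    { toFun := fun η => X ⟨Q η, hQd η⟩ + η
      map_add' := fun a b => by
        have : (⟨Q (a + b), hQd _⟩ : X.domain) = ⟨Q a, hQd a⟩ + ⟨Q b, hQd b⟩ :=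
          Subtype.ext (by simp)
        rw [this, LinearPMap.map_add]
        abel
      map_smul' := fun c a => by
        have : (⟨Q (c • a), hQd _⟩ : X.domain) = c • ⟨Q a, hQd a⟩ := Subtype.ext (by simp)
        rw [this, LinearPMap.map_smul, RingHom.id_apply, smul_add] } 1
    (fun η => by
      rw [one_mul]
      refine abs_le_of_sq_le_sq' ?_ (norm_nonneg _) |>.2
      change ‖X ⟨Q η, hQd η⟩ + η‖ ^ 2 ≤ _
      rw [← hpy η]
      exact le_add_of_nonneg_right (sq_nonneg _))
  have hadj : ∀ y ∈ (kernel X)ᗮ, ∀ w : X.domain,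
      ⟪X w, -(ContinuousLinearMap.adjoint Q y)⟫_ℂ = ⟪(w : H), y⟫_ℂ := by
    intro y hy w
    obtain ⟨hp, hp'⟩ := mem_kernel.1 ((kernel X).starProjection_apply_mem (w : H))
    have h1 : IsWeakSolution X (X w) (-((w : H) - (kernel X).starProjection (w : H))) := by
      refine ⟨(kernel X)ᗮ.neg_mem (Submodule.sub_starProjection_mem_orthogonal _),
        X.domain.neg_mem (X.domain.sub_mem w.2 hp), fun w' => ?_⟩
      have : X ⟨_, X.domain.neg_mem (X.domain.sub_mem w.2 hp)⟩ = -(X w - X ⟨_, hp⟩) := by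
        rw [← LinearPMap.map_sub, ← LinearPMap.map_neg]
        rfl
      rw [this, hp']
      simp
    have h2 := (hQ (X w)).unique h1
    rw [inner_neg_right, ContinuousLinearMap.adjoint_inner_right, h2, inner_neg_left, neg_neg,
      inner_sub_left, Submodule.inner_right_of_mem_orthogonal
        ((kernel X).starProjection_apply_mem (w : H)) hy, sub_zero]
  refine ⟨Q, Γ, hQ, fun η => ⟨hQd η, (add_sub_cancel_right _ _).symm⟩, fun η w => hQo η w, ?_,
    LinearMap.mkContinuous_norm_le _ zero_le_one _, hadj⟩
  refine ContinuousLinearMap.opNorm_le_bound _ (by positivity) fun η => ?_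
  -- with `y = Q η` solve `X* X φ = y`; then `‖y‖² = ⟪X y, X φ⟫`
  have hy := (hQ η).1
  have h1 : ∀ w : X.domain, ⟪X w, X (-⟨Q (-(ContinuousLinearMap.adjoint Q (Q η))), hQd _⟩)⟫_ℂ =
      ⟪(w : H), Q η⟫_ℂ := fun w => by
    have h2 := hQo (-(ContinuousLinearMap.adjoint Q (Q η))) w
    rw [inner_add_right, hadj _ hy w] at h2
    rw [LinearPMap.map_neg, inner_neg_right]
    linear_combination -h2
  have h3 := mul_norm_sq_le_of_lt_gap hX hc hd0 hd h1
  set φ : X.domain := -⟨Q (-(ContinuousLinearMap.adjoint Q (Q η))), hQd _⟩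
  have h4 : ‖Q η‖ ^ 2 ≤ ‖X ⟨Q η, hQd η⟩‖ * ‖X φ‖ := by
    have := h1 ⟨Q η, hQd η⟩
    rw [inner_self_eq_norm_sq_to_K] at this
    calc ‖Q η‖ ^ 2 = ‖((‖Q η‖ : ℂ)) ^ 2‖ := by simp
      _ = ‖⟪X ⟨Q η, hQd η⟩, X φ⟫_ℂ‖ := congrArg norm this.symm
      _ ≤ _ := norm_inner_le_norm _ _
  have h5 : ‖X ⟨Q η, hQd η⟩‖ ≤ ‖η‖ := by
    refine abs_le_of_sq_le_sq' ?_ (norm_nonneg _) |>.2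
    rw [← hpy η]
    exact le_add_of_nonneg_left (sq_nonneg _)
  have hs : 0 < √d := Real.sqrt_pos.2 hd0
  have h6 : √d * ‖X φ‖ ≤ ‖Q η‖ := by
    refine abs_le_of_sq_le_sq' ?_ (norm_nonneg _) |>.2
    rw [mul_pow, Real.sq_sqrt hd0.le]
    exact h3
  rw [inv_mul_eq_div, le_div_iff₀ hs]
  rcases (norm_nonneg (Q η)).eq_or_lt with h | h
  · rw [← h, zero_mul]; exact norm_nonneg _
  · have : ‖Q η‖ * (‖Q η‖ * √d) ≤ ‖Q η‖ * ‖η‖ := by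
      calc ‖Q η‖ * (‖Q η‖ * √d) = √d * ‖Q η‖ ^ 2 := by ring
        _ ≤ √d * (‖X ⟨Q η, hQd η⟩‖ * ‖X φ‖) := by gcongr
        _ = ‖X ⟨Q η, hQd η⟩‖ * (√d * ‖X φ‖) := by ring
        _ ≤ ‖η‖ * ‖Q η‖ := by gcongr
        _ = _ := mul_comm _ _
    exact le_of_mul_le_mul_left this h

end Gap

/-! ### The solution operator of a pencil -/

namespace Pencil

variable {H : Type u} {Hs : Type v}
  [NormedAddCommGroup H] [InnerProductSpace ℂ H] [CompleteSpace H]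
  [NormedAddCommGroup Hs] [InnerProductSpace ℂ Hs] [CompleteSpace Hs]
  (p : Pencil H Hs)

/-- `Q : Hs → H`, `η ↦ φ`, is the weak solution operator of `X₀* (X₀ φ + η) = 0`, `Γ = X₀ Q + I` is the
orthogonal projection along the range of `X₀`, and `q` bounds `‖Q‖`. The last field says that
`-Q* y` is a weak solution `h` of `X₀* h = y` for `y` orthogonal to the kernel. -/
structure IsSolutionOperator (Q : Hs →L[ℂ] H) (Γ : Hs →L[ℂ] Hs) (q : ℝ) : Prop where
  isWeakSolution : ∀ η, IsWeakSolution p.X₀ η (Q η)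
  apply_eq : ∀ η, ∃ h : Q η ∈ p.X₀.domain, p.X₀ ⟨Q η, h⟩ = Γ η - η
  inner_eq_zero : ∀ η (w : p.X₀.domain), ⟪p.X₀ w, Γ η⟫_ℂ = 0
  norm_le : ‖Q‖ ≤ q
  norm_le_one : ‖Γ‖ ≤ 1
  inner_adjoint : ∀ y ∈ p.𝔑ᗮ, ∀ w : p.X₀.domain,
    ⟪p.X₀ w, -(ContinuousLinearMap.adjoint Q y)⟫_ℂ = ⟪(w : H), y⟫_ℂ

theorem exists_isSolutionOperator {d : ℝ} (hd0 : 0 < d) (hd : ENNReal.ofReal d < p.d₀) :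
    ∃ Q Γ, p.IsSolutionOperator Q Γ (√d)⁻¹ := by
  have : (kernel p.X₀).HasOrthogonalProjection :=
    inferInstanceAs (p.𝔑.HasOrthogonalProjection)
  rw [d₀_eq_gap] at hd
  obtain ⟨Q, Γ, h1, h2, h3, h4, h5, h6⟩ := exists_solutionOperator p.dense_domain p.closed hd0 hd
  exact ⟨Q, Γ, h1, h2, h3, h4, h5, h6⟩

theorem P_coe (ω : p.𝔑) : p.P ω = ω := Submodule.starProjection_mem_subspace_eq_self ω

theorem P_eq_zero {u : H} (hu : u ∈ p.𝔑ᗮ) : p.P u = 0 :=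
  (Submodule.starProjection_apply_eq_zero_iff p.𝔑).2 hu

theorem X₀_coe (ω : p.𝔑) : ∃ h : (ω : H) ∈ p.X₀.domain, p.X₀ ⟨ω, h⟩ = 0 := mem_kernel.1 ω.2

theorem RP_coe (ω : p.𝔑) : p.RP ω = p.R ω := by
  simp [RP]

theorem RP_eq_zero {u : H} (hu : u ∈ p.𝔑ᗮ) : p.RP u = 0 := by
  have h : p.𝔑.orthogonalProjectionOnto u = 0 := Subtype.ext (p.P_eq_zero hu)
  simp [RP, h]

theorem inner_S (ω ω' : p.𝔑) : ⟪(ω : H), (p.S ω' : H)⟫_ℂ = ⟪p.R ω, p.R ω'⟫_ℂ := by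
  rw [← Submodule.coe_inner, S, ContinuousLinearMap.comp_apply,
    ContinuousLinearMap.adjoint_inner_right]

theorem inner_N (u v : H) :
    ⟪u, p.N v⟫_ℂ = ⟪p.X₁ (p.Z u), p.RP v⟫_ℂ + ⟪p.RP u, p.X₁ (p.Z v)⟫_ℂ := by
  simp only [N, add_apply, ContinuousLinearMap.comp_apply, inner_add_right,
    ContinuousLinearMap.adjoint_inner_right]

section

variable {p} {Q : Hs →L[ℂ] H} {Γ : Hs →L[ℂ] Hs} {q : ℝ} (hQ : p.IsSolutionOperator Q Γ q)

include hQ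

theorem IsSolutionOperator.Z_eq (u : H) : p.Z u = Q (p.X₁ (p.P u)) :=
  (p.Z_spec u).unique (hQ.isWeakSolution _)

theorem IsSolutionOperator.R_eq (ω : p.𝔑) : p.R ω = Γ (p.X₁ ω) := by
  obtain ⟨h, e⟩ := hQ.apply_eq (p.X₁ ω)
  have h1 : p.Z ω = Q (p.X₁ ω) := by rw [hQ.Z_eq, P_coe]
  have h2 : (⟨p.Z ω, p.Z_mem_domain ω⟩ : p.X₀.domain) = ⟨Q (p.X₁ ω), h⟩ := Subtype.ext h1
  change p.X₀ ⟨p.Z ω, p.Z_mem_domain ω⟩ + p.X₁ ω = _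
  rw [h2, e, sub_add_cancel]

theorem IsSolutionOperator.q_nonneg : 0 ≤ q := (norm_nonneg _).trans hQ.norm_le

theorem IsSolutionOperator.norm_Z_le : ‖p.Z‖ ≤ q * ‖p.X₁‖ := by
  have e : p.Z = Q ∘L p.X₁ ∘L p.P := ContinuousLinearMap.ext hQ.Z_eq
  have hP : ‖p.P‖ ≤ 1 := Submodule.starProjection_norm_le _
  have hq := hQ.q_nonneg
  rw [e]
  calc _ ≤ ‖Q‖ * (‖p.X₁‖ * ‖p.P‖) := (ContinuousLinearMap.opNorm_comp_le _ _).trans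
        (by gcongr; exact ContinuousLinearMap.opNorm_comp_le _ _)
    _ ≤ q * (‖p.X₁‖ * 1) := by gcongr; exact hQ.norm_le
    _ = _ := by rw [mul_one]

theorem IsSolutionOperator.norm_R_le : ‖p.R‖ ≤ ‖p.X₁‖ :=
  ContinuousLinearMap.opNorm_le_bound _ (norm_nonneg _) fun ω => by
    rw [hQ.R_eq]
    calc _ ≤ ‖Γ‖ * ‖p.X₁ ω‖ := Γ.le_opNorm _
      _ ≤ 1 * (‖p.X₁‖ * ‖(ω : H)‖) := by gcongr; exacts [hQ.norm_le_one, p.X₁.le_opNorm _]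
      _ = _ := by rw [one_mul]; rfl

theorem IsSolutionOperator.norm_RP_le : ‖p.RP‖ ≤ ‖p.X₁‖ := by
  have h : ‖p.𝔑.orthogonalProjectionOnto‖ ≤ 1 := Submodule.orthogonalProjectionOnto_norm_le _
  calc _ ≤ ‖p.R‖ * ‖p.𝔑.orthogonalProjectionOnto‖ := ContinuousLinearMap.opNorm_comp_le _ _
    _ ≤ ‖p.X₁‖ * 1 := by gcongr; exact hQ.norm_R_le
    _ = _ := mul_one _

theorem IsSolutionOperator.norm_S_le : ‖p.S‖ ≤ ‖p.X₁‖ ^ 2 := by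
  have h : ‖ContinuousLinearMap.adjoint p.R‖ = ‖p.R‖ := LinearIsometryEquiv.norm_map _ _
  calc _ ≤ ‖ContinuousLinearMap.adjoint p.R‖ * ‖p.R‖ := ContinuousLinearMap.opNorm_comp_le _ _
    _ ≤ ‖p.X₁‖ * ‖p.X₁‖ := by rw [h]; gcongr <;> exact hQ.norm_R_le
    _ = _ := (pow_two _).symm

theorem IsSolutionOperator.norm_N_le : ‖p.N‖ ≤ 2 * q * ‖p.X₁‖ ^ 3 := by
  have hq := hQ.q_nonneg
  have h1 : ‖ContinuousLinearMap.adjoint p.Z‖ = ‖p.Z‖ := LinearIsometryEquiv.norm_map _ _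
  have h2 : ‖ContinuousLinearMap.adjoint p.X₁‖ = ‖p.X₁‖ := LinearIsometryEquiv.norm_map _ _
  have h3 : ‖ContinuousLinearMap.adjoint p.RP‖ = ‖p.RP‖ := LinearIsometryEquiv.norm_map _ _
  have hZ := hQ.norm_Z_le
  have hR := hQ.norm_RP_le
  calc _ ≤ ‖ContinuousLinearMap.adjoint p.Z‖ * (‖ContinuousLinearMap.adjoint p.X₁‖ * ‖p.RP‖) +
        ‖ContinuousLinearMap.adjoint p.RP‖ * (‖p.X₁‖ * ‖p.Z‖) :=
        (norm_add_le _ _).trans (add_le_add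
          ((ContinuousLinearMap.opNorm_comp_le _ _).trans
            (by gcongr; exact ContinuousLinearMap.opNorm_comp_le _ _))
          ((ContinuousLinearMap.opNorm_comp_le _ _).trans
            (by gcongr; exact ContinuousLinearMap.opNorm_comp_le _ _)))
    _ ≤ (q * ‖p.X₁‖) * (‖p.X₁‖ * ‖p.X₁‖) + ‖p.X₁‖ * (‖p.X₁‖ * (q * ‖p.X₁‖)) := by
        rw [h1, h2, h3]; gcongr
    _ = _ := by ring

/-- `Z` and `R P` vanish on `𝔑ᗮ`, so the form of `N` annihilates `𝔑ᗮ` in its first argument. -/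
theorem IsSolutionOperator.N_mem (u : H) : p.N u ∈ p.𝔑 := by
  rw [← Submodule.orthogonal_orthogonal p.𝔑, Submodule.mem_orthogonal]
  intro v hv
  rw [inner_N, p.RP_eq_zero hv, hQ.Z_eq v, p.P_eq_zero hv]
  simp

end

/-! ### The approximate intertwining operator -/

theorem X_apply (t : ℝ) (u : H) (h : u ∈ p.X₀.domain) :
    p.X t ⟨u, h⟩ = (t : ℂ) • p.X₁ u + p.X₀ ⟨u, h⟩ := rfl

theorem norm_comp_le_of_le {E F G : Type*} [NormedAddCommGroup E] [NormedSpace ℂ E]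
    [NormedAddCommGroup F] [NormedSpace ℂ F] [NormedAddCommGroup G] [NormedSpace ℂ G]
    {A : F →L[ℂ] G} {B : E →L[ℂ] F} {a b : ℝ} (hA : ‖A‖ ≤ a) (hB : ‖B‖ ≤ b) : ‖A ∘L B‖ ≤ a * b :=
  (A.opNorm_comp_le B).trans
    (mul_le_mul hA hB (norm_nonneg _) ((norm_nonneg _).trans hA))

/-- The second order expansion `V₀ = I + t Z + t² Y` of the spectral subspace of `A(t)` near zero.
It satisfies `A(t) V₀ = V₀ (t² S) + t³ N + O(t⁴)` up to a term `t³ X(t)* G₁`. -/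
theorem IsSolutionOperator.exists_expansion {p : Pencil H Hs} {Q : Hs →L[ℂ] H} {Γ : Hs →L[ℂ] Hs}
    {q : ℝ} (hQ : p.IsSolutionOperator Q Γ q) (N' : p.𝔑 →L[ℂ] p.𝔑)
    (hN' : ∀ ω, (N' ω : H) = p.N ω) :
    ∃ (Y F₁ : p.𝔑 →L[ℂ] H) (G₁ : p.𝔑 →L[ℂ] Hs),
      ‖Y‖ ≤ 3 * q ^ 2 * ‖p.X₁‖ ^ 2 ∧ ‖F₁‖ ≤ 11 * q ^ 2 * ‖p.X₁‖ ^ 4 ∧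
      ‖G₁‖ ≤ 11 * q ^ 2 * ‖p.X₁‖ ^ 3 ∧
      ∀ t : ℝ, WeakIntertwining (p.X t) ((t : ℂ) ^ 2 • p.S)
        (p.𝔑.subtypeL + (t : ℂ) • p.Z ∘L p.𝔑.subtypeL + (t : ℂ) ^ 2 • Y)
        ((t : ℂ) ^ 3 • p.𝔑.subtypeL ∘L N' - (t : ℂ) ^ 4 • F₁) ((t : ℂ) ^ 3 • G₁) := by
  have hq := hQ.q_nonneg
  set m := ‖p.X₁‖ with hm
  have hm0 : 0 ≤ m := norm_nonneg _
  set J : p.𝔑 →L[ℂ] H := p.𝔑.subtypeL with hJ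
  set X₁a := ContinuousLinearMap.adjoint p.X₁ with hXa
  set Qa := ContinuousLinearMap.adjoint Q with hQa
  -- `Y` solves the second order equation `X₀* (X₀ Y + X₁ Z) + X₁* R = S`: here `X₀* h = y`, so that
  -- `G = X₀ Y + X₁ Z` satisfies `X₀* G + X₁* R = S`
  set y : p.𝔑 →L[ℂ] H := X₁a ∘L p.R - J ∘L p.S with hy
  set h : p.𝔑 →L[ℂ] Hs := -(Qa ∘L y) with hh
  set η : p.𝔑 →L[ℂ] Hs := p.X₁ ∘L p.Z ∘L J + h with hη
  set Y : p.𝔑 →L[ℂ] H := Q ∘L η with hY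
  set G : p.𝔑 →L[ℂ] Hs := Γ ∘L η - h with hG
  -- the third order residual is `k = X₁* G - Z S`; its component in the kernel is `N`, and the rest
  -- is `X₀* h₂`
  set k : p.𝔑 →L[ℂ] H := X₁a ∘L G - (p.Z ∘L J) ∘L p.S with hk
  set h₂ : p.𝔑 →L[ℂ] Hs := -(Qa ∘L (k - J ∘L N')) with hh₂
  -- the right-hand sides are orthogonal to the kernel
  have hZd := p.Z_mem_domain
  have hRZ : ∀ w : p.𝔑, p.R w = p.X₀ ⟨p.Z w, hZd w⟩ + p.X₁ w := fun w => rfl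
  have hX₀R : ∀ (ω : p.𝔑) (w : p.X₀.domain), ⟪p.X₀ w, p.R ω⟫_ℂ = 0 := fun ω w => by
    rw [hQ.R_eq]; exact hQ.inner_eq_zero _ w
  have hyo : ∀ ω, y ω ∈ p.𝔑ᗮ := fun ω => by
    rw [Submodule.mem_orthogonal]
    intro w hw
    have h1 : ⟪w, y ω⟫_ℂ = ⟪p.X₁ w, p.R ω⟫_ℂ - ⟪w, (p.S ω : H)⟫_ℂ := by
      rw [hy, sub_apply, inner_sub_right, ContinuousLinearMap.comp_apply,
        ContinuousLinearMap.adjoint_inner_right]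
      rfl
    have h2 := p.inner_S ⟨w, hw⟩ ω
    have h3 := hRZ ⟨w, hw⟩
    rw [h3, inner_add_left, hX₀R, zero_add] at h2
    rw [h1, h2, sub_self]
  have hX₀h : ∀ (ω : p.𝔑) (w : p.X₀.domain), ⟪p.X₀ w, h ω⟫_ℂ =
      ⟪p.X₁ (w : H), p.R ω⟫_ℂ - ⟪(w : H), (p.S ω : H)⟫_ℂ := fun ω w => by
    have h1 := hQ.inner_adjoint (y ω) (hyo ω) w
    have h2 : ⟪(w : H), y ω⟫_ℂ = ⟪p.X₁ (w : H), p.R ω⟫_ℂ - ⟪(w : H), (p.S ω : H)⟫_ℂ := by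
      rw [hy, sub_apply, inner_sub_right, ContinuousLinearMap.comp_apply,
        ContinuousLinearMap.adjoint_inner_right]
      rfl
    rw [← h2, ← h1]
    rfl
  have hX₀Γ : ∀ (ω : p.𝔑) (w : p.X₀.domain), ⟪p.X₀ w, Γ (η ω)⟫_ℂ = 0 := fun ω w =>
    hQ.inner_eq_zero _ w
  have hGa : ∀ ω, G ω = Γ (η ω) - h ω := fun ω => rfl
  have hX₀G : ∀ (ω : p.𝔑) (w : p.X₀.domain), ⟪p.X₀ w, G ω⟫_ℂ = -⟪p.X₀ w, h ω⟫_ℂ := fun ω w => by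
    rw [hGa, inner_sub_right, hX₀Γ, zero_sub]
  have hZo : ∀ u (w : p.𝔑), ⟪(w : H), p.Z u⟫_ℂ = 0 := fun u w =>
    Submodule.inner_right_of_mem_orthogonal w.2 (p.Z_spec u).1
  have hka : ∀ (w : H) ω, ⟪w, k ω⟫_ℂ = ⟪p.X₁ w, G ω⟫_ℂ - ⟪w, p.Z (p.S ω : H)⟫_ℂ := fun w ω => by
    rw [hk, sub_apply, inner_sub_right, ContinuousLinearMap.comp_apply,
      ContinuousLinearMap.adjoint_inner_right]
    rfl
  obtain ⟨hYd, hYe⟩ : ∃ hd : ∀ ω, Y ω ∈ p.X₀.domain, ∀ ω, p.X₀ ⟨Y ω, hd ω⟩ = Γ (η ω) - η ω :=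
    ⟨fun ω => (hQ.apply_eq (η ω)).choose, fun ω => (hQ.apply_eq (η ω)).choose_spec⟩
  have hηa : ∀ ω, η ω = p.X₁ (p.Z (ω : H)) + h ω := fun ω => rfl
  have hko : ∀ ω, (k - J ∘L N') ω ∈ p.𝔑ᗮ := fun ω => by
    rw [Submodule.mem_orthogonal]
    intro w hw
    have e1 : ⟪w, (k - J ∘L N') ω⟫_ℂ = ⟪w, k ω⟫_ℂ - ⟪w, (N' ω : H)⟫_ℂ := by
      rw [sub_apply, inner_sub_right]
      rfl
    have e2 : p.X₁ w = p.R ⟨w, hw⟩ - p.X₀ ⟨p.Z w, hZd w⟩ := by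
      rw [hRZ ⟨w, hw⟩]; simp
    have e3 : ⟪p.R ⟨w, hw⟩, G ω⟫_ℂ = ⟪p.R ⟨w, hw⟩, p.X₁ (p.Z ω)⟫_ℂ := by
      have h5 : G ω = p.X₁ (p.Z (ω : H)) + p.X₀ ⟨Y ω, hYd ω⟩ := by
        rw [hYe, hGa, hηa]; abel
      rw [h5, inner_add_right, ← inner_conj_symm _ (p.X₀ _), hX₀R, map_zero, add_zero]
    have e4 : ⟪p.X₀ ⟨p.Z w, hZd w⟩, G ω⟫_ℂ = -⟪p.X₁ (p.Z w), p.R ω⟫_ℂ := by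
      rw [hX₀G, hX₀h]
      have : ⟪p.Z w, (p.S ω : H)⟫_ℂ = 0 := by
        rw [← inner_conj_symm, hZo, map_zero]
      rw [this, sub_zero]
    have e5 := p.inner_N w ω
    have e6 : p.RP w = p.R ⟨w, hw⟩ := p.RP_coe ⟨w, hw⟩
    rw [RP_coe, e6] at e5
    rw [e1, hka, hN', e5, e2, inner_sub_left, e3, e4, hZo _ ⟨w, hw⟩]
    ring
  have hX₀h₂ : ∀ (ω : p.𝔑) (w : p.X₀.domain), ⟪p.X₀ w, h₂ ω⟫_ℂ =
      ⟪p.X₁ (w : H), G ω⟫_ℂ - ⟪(w : H), p.Z (p.S ω : H)⟫_ℂ - ⟪(w : H), (N' ω : H)⟫_ℂ :=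
    fun ω w => by
    have h1 := hQ.inner_adjoint _ (hko ω) w
    have h2 : ⟪(w : H), (k - J ∘L N') ω⟫_ℂ = ⟪(w : H), k ω⟫_ℂ - ⟪(w : H), (N' ω : H)⟫_ℂ := by
      rw [sub_apply, inner_sub_right]
      rfl
    rw [← hka, ← h2, ← h1]
    rfl
  have hXan : ‖X₁a‖ ≤ m := (LinearIsometryEquiv.norm_map _ _).le
  have hQan : ‖Qa‖ ≤ q := (LinearIsometryEquiv.norm_map _ _).le.trans hQ.norm_le
  have hJn : ‖J‖ ≤ 1 := p.𝔑.norm_subtypeL_le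
  have hX₁n : ‖p.X₁‖ ≤ m := le_rfl
  have hyn : ‖y‖ ≤ 2 * m ^ 2 := by
    have h1 := norm_comp_le_of_le hXan hQ.norm_R_le
    have h2 := norm_comp_le_of_le hJn hQ.norm_S_le
    rw [← hm] at h1 h2
    linarith [norm_sub_le (X₁a ∘L p.R) (J ∘L p.S)]
  have hhn : ‖h‖ ≤ 2 * q * m ^ 2 := by
    have h1 := norm_comp_le_of_le hQan hyn
    refine (norm_neg (Qa ∘L y)).trans_le ?_
    linarith
  have hZJ : ‖p.Z ∘L J‖ ≤ q * m := by
    simpa using norm_comp_le_of_le hQ.norm_Z_le hJn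
  have hηn : ‖η‖ ≤ 3 * q * m ^ 2 := by
    have h1 := norm_comp_le_of_le hX₁n hZJ
    linarith [norm_add_le (p.X₁ ∘L p.Z ∘L J) h]
  have hYn : ‖Y‖ ≤ 3 * q ^ 2 * m ^ 2 := by
    have h1 := norm_comp_le_of_le hQ.norm_le hηn
    linarith
  have hGn : ‖G‖ ≤ 5 * q * m ^ 2 := by
    have h1 := norm_comp_le_of_le hQ.norm_le_one hηn
    linarith [norm_sub_le (Γ ∘L η) h]
  have hkn : ‖k‖ ≤ 6 * q * m ^ 3 := by
    have h1 := norm_comp_le_of_le hXan hGn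
    have h2 := norm_comp_le_of_le hZJ hQ.norm_S_le
    rw [← hm] at h2
    linarith [norm_sub_le (X₁a ∘L G) ((p.Z ∘L J) ∘L p.S)]
  have hNn : ‖J ∘L N'‖ ≤ 2 * q * m ^ 3 := by
    have e : J ∘L N' = p.N ∘L J := ContinuousLinearMap.ext hN'
    rw [e]
    simpa using norm_comp_le_of_le hQ.norm_N_le hJn
  have hh₂n : ‖h₂‖ ≤ 8 * q ^ 2 * m ^ 3 := by
    have h1 : ‖k - J ∘L N'‖ ≤ 8 * q * m ^ 3 := by
      linarith [norm_sub_le k (J ∘L N')]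
    have h2 := norm_comp_le_of_le hQan h1
    refine (norm_neg (Qa ∘L (k - J ∘L N'))).trans_le ?_
    linarith
  refine ⟨Y, Y ∘L p.S + X₁a ∘L h₂, p.X₁ ∘L Y + h₂, hYn, ?_, ?_, fun t ω => ?_⟩
  · have h1 := norm_comp_le_of_le hYn hQ.norm_S_le
    have h2 := norm_comp_le_of_le hXan hh₂n
    rw [← hm] at h1
    linarith [norm_add_le (Y ∘L p.S) (X₁a ∘L h₂)]
  · have h1 := norm_comp_le_of_le hX₁n hYn
    linarith [norm_add_le (p.X₁ ∘L Y) h₂]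
  obtain ⟨hωd, hωe⟩ := p.X₀_coe ω
  have hVd : (ω : H) + (t : ℂ) • p.Z (ω : H) + (t : ℂ) ^ 2 • Y ω ∈ p.X₀.domain :=
    p.X₀.domain.add_mem (p.X₀.domain.add_mem hωd (p.X₀.domain.smul_mem _ (hZd _)))
      (p.X₀.domain.smul_mem _ (hYd _))
  have hXV : p.X t ⟨_, hVd⟩ = (t : ℂ) • p.R ω + (t : ℂ) ^ 2 • G ω + (t : ℂ) ^ 3 • p.X₁ (Y ω) := by
    have e1 : (⟨_, hVd⟩ : p.X₀.domain) =
        ⟨ω, hωd⟩ + (t : ℂ) • ⟨p.Z ω, hZd ω⟩ + (t : ℂ) ^ 2 • ⟨Y ω, hYd ω⟩ := rfl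
    have e2 : p.X₀ ⟨p.Z ω, hZd ω⟩ = p.R ω - p.X₁ ω := by rw [hRZ]; abel
    rw [X_apply, e1, LinearPMap.map_add, LinearPMap.map_add, LinearPMap.map_smul,
      LinearPMap.map_smul, hωe, e2, hYe, hGa, hηa]
    simp only [map_add, map_smul]
    module
  refine ⟨hVd, fun w => ?_⟩
  have hXw : p.X t w = (t : ℂ) • p.X₁ (w : H) + p.X₀ w := rfl
  change ⟪p.X t w, p.X t ⟨_, hVd⟩⟫_ℂ = _
  rw [hXV, hXw]
  have r1 := hX₀R ω w
  have r2 := hX₀G ω w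
  have r3 := hX₀h ω w
  have r4 := hX₀h₂ ω w
  have r5 : ⟪(w : H), X₁a (h₂ ω)⟫_ℂ = ⟪p.X₁ (w : H), h₂ ω⟫_ℂ :=
    ContinuousLinearMap.adjoint_inner_right _ _ _
  have hJa : ∀ ω, J ω = (ω : H) := fun _ => rfl
  simp only [add_apply, sub_apply, smul_apply, ContinuousLinearMap.comp_apply, map_smul, smul_add,
    inner_add_left, inner_add_right, inner_sub_right, inner_smul_left, inner_smul_right,
    Complex.conj_ofReal, hJa, r5]
  linear_combination (t : ℂ) * r1 + (t : ℂ) ^ 2 * (r2 - r3) - (t : ℂ) ^ 3 * r4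

/-- The correction step: if `V₀ = J + t Z + t² Y` intertwines `X* X` with `t² S` up to `t³ N' + O(t⁴)`
and `S D = D S - N'`, then `V = V₀ (I + t D)` does so up to `O(t⁴)`. The constants `q`, `m` keep
track of the two scales of the problem, with `|t| q m ≤ 1`. -/
theorem _root_.OperatorPencil.WeakIntertwining.exists_corrected {M : Type w} [NormedAddCommGroup M]
    [InnerProductSpace ℂ M] {X : H →ₗ.[ℂ] Hs} {J Z Y F₁ : M →L[ℂ] H} {G₁ : M →L[ℂ] Hs}
    {S N' D : M →L[ℂ] M} {t q m : ℝ} (hq : 0 ≤ q) (hm0 : 0 ≤ m) (ht : |t| * (q * m) ≤ 1)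
    (hW : WeakIntertwining X ((t : ℂ) ^ 2 • S) (J + (t : ℂ) • Z + (t : ℂ) ^ 2 • Y)
      ((t : ℂ) ^ 3 • J ∘L N' - (t : ℂ) ^ 4 • F₁) ((t : ℂ) ^ 3 • G₁))
    (hD : ∀ ω, S (D ω) = D (S ω) - N' ω) (hJn : ‖J‖ ≤ 1) (hZJ : ‖Z‖ ≤ q * m)
    (hY : ‖Y‖ ≤ 3 * q ^ 2 * m ^ 2) (hF : ‖F₁‖ ≤ 11 * q ^ 2 * m ^ 4)
    (hG : ‖G₁‖ ≤ 11 * q ^ 2 * m ^ 3) (hN'n : ‖N'‖ ≤ 2 * q * m ^ 3) :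
    ∃ (V f : M →L[ℂ] H) (g : M →L[ℂ] Hs),
      WeakIntertwining X ((t : ℂ) ^ 2 • S) V f g ∧
      ‖V - J‖ ≤ 5 * |t| * (q * m + ‖D‖) ∧
      ‖f‖ ≤ 19 * t ^ 4 * (q * m ^ 3) * (q * m + ‖D‖) ∧
      ‖g‖ ≤ 11 * |t| ^ 3 * (q * m ^ 2) * (q * m + ‖D‖) := by
  have htn : ‖(t : ℂ)‖ = |t| := by simp
  set Y₁ : M →L[ℂ] H := Z + (t : ℂ) • Y with hY₁
  have hY₁n : ‖Y₁‖ ≤ 4 * (q * m) := by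
    refine (norm_add_le _ _).trans ?_
    rw [norm_smul, htn]
    calc ‖Z‖ + |t| * ‖Y‖ ≤ q * m + |t| * (3 * q ^ 2 * m ^ 2) := by gcongr
      _ = q * m + 3 * (q * m) * (|t| * (q * m)) := by ring
      _ ≤ q * m + 3 * (q * m) * 1 := by gcongr
      _ = _ := by ring
  have hV₀ : J + (t : ℂ) • Z + (t : ℂ) ^ 2 • Y = J + (t : ℂ) • Y₁ := by
    rw [hY₁, smul_add, smul_smul, ← pow_two, add_assoc]
  have hNn : ‖J ∘L N'‖ ≤ 2 * q * m ^ 3 := by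
    simpa using norm_comp_le_of_le hJn hN'n
  set E : M →L[ℂ] M := ContinuousLinearMap.id ℂ M + (t : ℂ) • D with hE
  have hEn : ‖E‖ ≤ 1 + |t| * ‖D‖ := by
    refine (norm_add_le _ _).trans ?_
    rw [norm_smul, htn]
    gcongr
    exact ContinuousLinearMap.norm_id_le
  refine ⟨(J + (t : ℂ) • Y₁) ∘L E,
    (t : ℂ) ^ 4 • (J ∘L N' ∘L D - Y₁ ∘L N' - F₁ ∘L E), (t : ℂ) ^ 3 • (G₁ ∘L E),
    fun ω => ?_, ?_, ?_, ?_⟩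
  · have h := hW (E ω)
    rw [hV₀] at h
    obtain ⟨hd, h⟩ := h
    refine ⟨hd, fun w => ?_⟩
    have hw := h w
    have e1 : S (D ω) = D (S ω) - N' ω := hD ω
    change ⟪X w, X ⟨(J + (t : ℂ) • Y₁) (E ω), hd⟩⟫_ℂ = _
    rw [hw]
    have e2 : ∀ u, E u = u + (t : ℂ) • D u := fun u => rfl
    simp only [add_apply, sub_apply, smul_apply, ContinuousLinearMap.comp_apply, map_smul, smul_add,
      inner_add_right, inner_sub_right, inner_smul_right, e2, map_add, e1, map_sub, smul_sub]
    ring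
  · have e : (J + (t : ℂ) • Y₁) ∘L E - J = (t : ℂ) • (Y₁ + (J + (t : ℂ) • Y₁) ∘L D) := by
      ext ω
      simp only [hE, add_apply, sub_apply, smul_apply, ContinuousLinearMap.comp_apply,
        ContinuousLinearMap.id_apply, map_add, map_smul]
      module
    have hV₀n : ‖J + (t : ℂ) • Y₁‖ ≤ 5 := by
      refine (norm_add_le _ _).trans ?_
      rw [norm_smul, htn]
      calc ‖J‖ + |t| * ‖Y₁‖ ≤ 1 + |t| * (4 * (q * m)) := by gcongr
        _ = 1 + 4 * (|t| * (q * m)) := by ring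
        _ ≤ 1 + 4 * 1 := by gcongr
        _ = 5 := by norm_num
    rw [e, norm_smul, htn]
    calc |t| * ‖Y₁ + (J + (t : ℂ) • Y₁) ∘L D‖ ≤ |t| * (4 * (q * m) + 5 * ‖D‖) := by
          gcongr
          exact (norm_add_le _ _).trans (add_le_add hY₁n (norm_comp_le_of_le hV₀n le_rfl))
      _ ≤ |t| * (5 * (q * m) + 5 * ‖D‖) := by gcongr; norm_num
      _ = _ := by ring
  · rw [norm_smul, norm_pow, htn]
    have h4 : |t| ^ 4 = t ^ 4 := by rw [← abs_pow]; exact abs_of_nonneg (by positivity)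
    rw [h4]
    have h1 : ‖J ∘L N' ∘L D‖ ≤ 2 * q * m ^ 3 * ‖D‖ :=
      norm_comp_le_of_le (A := J ∘L N') hNn le_rfl
    have h2 := norm_comp_le_of_le hY₁n hN'n
    have h3 := norm_comp_le_of_le hF hEn
    have h5 : q * m ^ 3 * (q * m) * (|t| * ‖D‖) ≤ q * m ^ 3 * ‖D‖ := by
      calc q * m ^ 3 * (q * m) * (|t| * ‖D‖) = q * m ^ 3 * ‖D‖ * (|t| * (q * m)) := by ring
        _ ≤ q * m ^ 3 * ‖D‖ * 1 := by gcongr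
        _ = _ := mul_one _
    have h6 : 0 ≤ q * m ^ 3 * ‖D‖ := by positivity
    calc t ^ 4 * ‖J ∘L N' ∘L D - Y₁ ∘L N' - F₁ ∘L E‖
        ≤ t ^ 4 * (19 * (q * m ^ 3) * (q * m + ‖D‖)) := by
          gcongr
          have := norm_sub_le (J ∘L N' ∘L D - Y₁ ∘L N') (F₁ ∘L E)
          have := norm_sub_le (J ∘L N' ∘L D) (Y₁ ∘L N')
          nlinarith
      _ = _ := by ring
  · rw [norm_smul, norm_pow, htn]
    have h3 := norm_comp_le_of_le hG hEn
    have h5 : q * m ^ 2 * (q * m) * (|t| * ‖D‖) ≤ q * m ^ 2 * ‖D‖ := by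
      calc q * m ^ 2 * (q * m) * (|t| * ‖D‖) = q * m ^ 2 * ‖D‖ * (|t| * (q * m)) := by ring
        _ ≤ q * m ^ 2 * ‖D‖ * 1 := by gcongr
        _ = _ := mul_one _
    calc |t| ^ 3 * ‖G₁ ∘L E‖ ≤ |t| ^ 3 * (11 * (q * m ^ 2) * (q * m + ‖D‖)) := by
          gcongr
          refine h3.trans ?_
          linarith
      _ = _ := by ring

/-- The expansion corrected by `D`: if `N + S D - D S = 0` on the kernel, the operator
`V = V₀ (I + t D)` removes the term `t³ N` and intertwines `A(t)` with `t² S` up to fourth order. -/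
theorem IsSolutionOperator.exists_weakIntertwining {p : Pencil H Hs} {Q : Hs →L[ℂ] H}
    {Γ : Hs →L[ℂ] Hs} {q : ℝ} (hQ : p.IsSolutionOperator Q Γ q) (D : p.𝔑 →L[ℂ] p.𝔑)
    (hD : ∀ ω : p.𝔑, p.N ω + (p.S (D ω) : H) - (D (p.S ω) : H) = 0) {t : ℝ}
    (ht : |t| * (q * ‖p.X₁‖) ≤ 1) :
    ∃ (V f : p.𝔑 →L[ℂ] H) (g : p.𝔑 →L[ℂ] Hs),
      WeakIntertwining (p.X t) ((t : ℂ) ^ 2 • p.S) V f g ∧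
      ‖V - p.𝔑.subtypeL‖ ≤ 5 * |t| * (q * ‖p.X₁‖ + ‖D‖) ∧
      ‖f‖ ≤ 19 * t ^ 4 * (q * ‖p.X₁‖ ^ 3) * (q * ‖p.X₁‖ + ‖D‖) ∧
      ‖g‖ ≤ 11 * |t| ^ 3 * (q * ‖p.X₁‖ ^ 2) * (q * ‖p.X₁‖ + ‖D‖) := by
  have hq := hQ.q_nonneg
  obtain ⟨N', hN'⟩ : ∃ N' : p.𝔑 →L[ℂ] p.𝔑, ∀ ω, (N' ω : H) = p.N ω :=
    ⟨(p.N ∘L p.𝔑.subtypeL).codRestrict p.𝔑 fun ω => hQ.N_mem ω, fun ω => rfl⟩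
  obtain ⟨Y, F₁, G₁, hY, hF, hG, hW⟩ := hQ.exists_expansion N' hN'
  have hN'n : ‖N'‖ ≤ 2 * q * ‖p.X₁‖ ^ 3 :=
    ContinuousLinearMap.opNorm_le_bound _ (by positivity) fun ω => by
      have h : ‖(N' ω : H)‖ ≤ _ * ‖(ω : H)‖ := hN' ω ▸ p.N.le_of_opNorm_le hQ.norm_N_le ω
      exact h
  have hJn : ‖p.𝔑.subtypeL‖ ≤ 1 := p.𝔑.norm_subtypeL_le
  refine (hW t).exists_corrected hq (norm_nonneg _) ht (fun ω => Subtype.ext ?_) hJn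
    (by simpa using norm_comp_le_of_le hQ.norm_Z_le hJn) hY hF hG hN'n
  rw [Submodule.coe_sub, hN', eq_sub_iff_add_eq, ← sub_eq_zero, ← hD ω]
  abel

/-! ### The spectral germ -/

theorem isSymmetric_S : (p.S : p.𝔑 →ₗ[ℂ] p.𝔑).IsSymmetric := fun ω ω' => by
  have h1 := p.inner_S ω ω'
  have h2 := p.inner_S ω' ω
  change ⟪(p.S ω : H), (ω' : H)⟫_ℂ = ⟪(ω : H), (p.S ω' : H)⟫_ℂ
  rw [h1, ← inner_conj_symm, h2, inner_conj_symm]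

variable {p}

/-- The germ inherits the lower bound of `A(t)`: `S ≥ c_*`. -/
theorem Nondegenerate.mul_norm_sq_le {cs t₀ : ℝ} (h : p.Nondegenerate cs t₀) (hcs : 0 < cs)
    (ht₀ : 0 < t₀) (ω : p.𝔑) : cs * ‖ω‖ ^ 2 ≤ ‖p.R ω‖ ^ 2 := by
  obtain ⟨hωd, hωe⟩ := p.X₀_coe ω
  set K := ‖p.X₁ (p.Z ω)‖ + √cs * ‖p.Z ω‖ with hK
  have hK0 : 0 ≤ K := by positivity
  have key : ∀ t, 0 < t → t ≤ t₀ → √cs * ‖ω‖ ≤ ‖p.R ω‖ + t * K := fun t ht htt => by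
    have hd : (ω : H) + (t : ℂ) • p.Z ω ∈ p.X₀.domain :=
      p.X₀.domain.add_mem hωd (p.X₀.domain.smul_mem _ (p.Z_mem_domain _))
    have h1 := le_norm_sq_of_gram_ge (X := p.X t) p.dense_domain (p.closed_X t)
      (a := cs * t ^ 2) (by positivity) (h t (by rwa [abs_of_pos ht])) ⟨_, hd⟩
    have e : p.X t ⟨_, hd⟩ = (t : ℂ) • (p.R ω + (t : ℂ) • p.X₁ (p.Z ω)) := by
      have e1 : (⟨_, hd⟩ : p.X₀.domain) = ⟨ω, hωd⟩ + (t : ℂ) • ⟨p.Z ω, p.Z_mem_domain _⟩ := rfl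
      have e2 : p.R ω = p.X₀ ⟨p.Z ω, p.Z_mem_domain _⟩ + p.X₁ ω := rfl
      rw [X_apply, e1, LinearPMap.map_add, LinearPMap.map_smul, hωe, e2]
      simp only [map_add, map_smul]
      module
    rw [e, norm_smul, Complex.norm_real, Real.norm_of_nonneg ht.le] at h1
    have h2 : √cs * ‖(ω : H) + (t : ℂ) • p.Z ω‖ ≤ ‖p.R ω + (t : ℂ) • p.X₁ (p.Z ω)‖ := by
      refine abs_le_of_sq_le_sq' ?_ (norm_nonneg _) |>.2
      rw [mul_pow, Real.sq_sqrt hcs.le]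
      have : 0 < t ^ 2 := by positivity
      nlinarith
    have h3 : ‖ω‖ ≤ ‖(ω : H) + (t : ℂ) • p.Z ω‖ + t * ‖p.Z ω‖ := by
      have := norm_sub_le ((ω : H) + (t : ℂ) • p.Z ω) ((t : ℂ) • p.Z ω)
      rw [add_sub_cancel_right, norm_smul, Complex.norm_real, Real.norm_of_nonneg ht.le] at this
      exact this
    have h4 : ‖p.R ω + (t : ℂ) • p.X₁ (p.Z ω)‖ ≤ ‖p.R ω‖ + t * ‖p.X₁ (p.Z ω)‖ := by
      have := norm_add_le (p.R ω) ((t : ℂ) • p.X₁ (p.Z ω))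
      rwa [norm_smul, Complex.norm_real, Real.norm_of_nonneg ht.le] at this
    calc √cs * ‖ω‖ ≤ √cs * (‖(ω : H) + (t : ℂ) • p.Z ω‖ + t * ‖p.Z ω‖) := by gcongr
      _ = √cs * ‖(ω : H) + (t : ℂ) • p.Z ω‖ + t * (√cs * ‖p.Z ω‖) := by ring
      _ ≤ _ := by rw [hK]; linarith
  have h1 : √cs * ‖ω‖ ≤ ‖p.R ω‖ := by
    refine le_of_forall_pos_le_add fun ε hε => ?_
    refine (key (min t₀ (ε / (K + 1))) (by positivity) (min_le_left _ _)).trans ?_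
    gcongr
    calc min t₀ (ε / (K + 1)) * K ≤ ε / (K + 1) * (K + 1) := by
          gcongr
          · exact min_le_right _ _
          · linarith
      _ = ε := by field_simp
  calc cs * ‖ω‖ ^ 2 = (√cs * ‖ω‖) ^ 2 := by rw [mul_pow, Real.sq_sqrt hcs.le]
    _ ≤ _ := by gcongr

variable (p)

theorem isSelfAdjoint_smul_S (t : ℝ) : IsSelfAdjoint ((t : ℂ) ^ 2 • p.S) := by
  rw [ContinuousLinearMap.isSelfAdjoint_iff_isSymmetric]
  intro ω ω'
  have := p.isSymmetric_S ω ω'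
  change ⟪(t : ℂ) ^ 2 • p.S ω, ω'⟫_ℂ = ⟪ω, (t : ℂ) ^ 2 • p.S ω'⟫_ℂ
  rw [inner_smul_left, inner_smul_right, map_pow, Complex.conj_ofReal]
  exact congrArg _ this

theorem spectrum_smul_S {c : ℝ} (hc : ∀ ω, c * ‖ω‖ ^ 2 ≤ ‖p.R ω‖ ^ 2) (t : ℝ) :
    spectrum ℝ ((t : ℂ) ^ 2 • p.S) ⊆ Set.Ici (c * t ^ 2) := by
  have hs := p.isSelfAdjoint_smul_S t
  refine spectrum_subset_Ici hs fun ω => ?_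
  have e2 : ⟪p.S ω, ω⟫_ℂ = ((‖p.R ω‖ ^ 2 : ℝ) : ℂ) := by
    have := p.inner_S ω ω
    rw [inner_self_eq_norm_sq_to_K] at this
    refine (p.isSymmetric_S ω ω).trans (this.trans ?_)
    norm_cast
  have h1 : c * t ^ 2 * ‖ω‖ ^ 2 ≤ t ^ 2 * ‖p.R ω‖ ^ 2 := by
    have := hc ω
    nlinarith [sq_nonneg t]
  refine h1.trans_eq ?_
  change _ = (⟪(t : ℂ) ^ 2 • p.S ω, ω⟫_ℂ).re
  rw [inner_smul_left, map_pow, Complex.conj_ofReal, e2, ← Complex.ofReal_pow,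
    ← Complex.ofReal_mul, Complex.ofReal_re]

theorem n_pos : 0 < p.n := by
  have : Nontrivial p.𝔑 := Submodule.nontrivial_iff_ne_bot.2 p.kernel_ne_bot
  exact Module.finrank_pos

/-- Distinct eigenvalues have linearly independent eigenvectors, so `p ≤ n`. -/
theorem card_germEigenvalue_le : Fintype.card p.GermEigenvalue ≤ p.n := by
  have h : ∀ γ : p.GermEigenvalue, ∃ x,
      Module.End.HasEigenvector (p.S : Module.End ℂ p.𝔑) (γ : ℂ) x := fun γ =>
    Module.End.HasEigenvalue.exists_hasEigenvector (f := (p.S : Module.End ℂ p.𝔑)) γ.2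
  choose x hx using h
  exact (Module.End.eigenvectors_linearIndependent' (p.S : Module.End ℂ p.𝔑)
    (fun γ : p.GermEigenvalue => (γ : ℂ)) Subtype.val_injective x hx).fintype_card_le_finrank

theorem eigenProj_mem (γ : p.GermEigenvalue) (u : H) :
    ∃ e : p.𝔑, (e : H) = p.eigenProj γ u ∧ p.S e = (γ : ℂ) • e := by
  have h := Submodule.starProjection_apply_mem
    ((Module.End.eigenspace (p.S : Module.End ℂ p.𝔑) (γ : ℂ)).map p.𝔑.subtype) u
  obtain ⟨e, he, h⟩ := h
  exact ⟨e, h, Module.End.mem_eigenspace_iff.1 he⟩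

theorem eigenProj_S (γ : p.GermEigenvalue) (ω : p.𝔑) :
    p.eigenProj γ (p.S ω) = (γ : ℂ) • p.eigenProj γ ω := by
  have hre : (starRingEnd ℂ) (γ : ℂ) = γ := p.isSymmetric_S.conj_eigenvalue_eq_self γ.2
  refine Submodule.eq_starProjection_of_mem_of_inner_eq_zero
    (Submodule.smul_mem _ _ (Submodule.starProjection_apply_mem
      ((Module.End.eigenspace (p.S : Module.End ℂ p.𝔑) (γ : ℂ)).map p.𝔑.subtype) _)) ?_
  rintro w ⟨e, he, rfl⟩
  have he' : p.S e = (γ : ℂ) • e := Module.End.mem_eigenspace_iff.1 he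
  have h1 : ⟪(p.S ω : H), (e : H)⟫_ℂ = (γ : ℂ) * ⟪(ω : H), (e : H)⟫_ℂ := by
    have := p.isSymmetric_S ω e
    change ⟪p.S ω, e⟫_ℂ = ⟪ω, p.S e⟫_ℂ at this
    rw [he', inner_smul_right] at this
    exact this
  have h2 : ⟪(ω : H) - p.eigenProj γ ω, (e : H)⟫_ℂ = 0 :=
    Submodule.starProjection_inner_eq_zero (K := (Module.End.eigenspace (p.S : Module.End ℂ p.𝔑)
      (γ : ℂ)).map p.𝔑.subtype) _ _ ⟨e, he, rfl⟩
  rw [inner_sub_left, sub_eq_zero] at h2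
  change ⟪(p.S ω : H) - (γ : ℂ) • p.eigenProj γ ω, (e : H)⟫_ℂ = 0
  rw [inner_sub_left, inner_smul_left, h1, hre, h2, sub_self]

theorem sum_eigenProj_coe (ω : p.𝔑) : ∑ γ, p.eigenProj γ (ω : H) = ω := by
  have hO := p.isSymmetric_S.orthogonalFamily_eigenspaces
  have hW : OrthogonalFamily ℂ (fun γ : p.GermEigenvalue =>
      ((Module.End.eigenspace (p.S : Module.End ℂ p.𝔑) (γ : ℂ)).map p.𝔑.subtype))
      (fun γ => ((Module.End.eigenspace (p.S : Module.End ℂ p.𝔑) (γ : ℂ)).map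
        p.𝔑.subtype).subtypeₗᵢ) := by
    refine OrthogonalFamily.of_pairwise fun γ γ' hne => ?_
    rw [Function.onFun, Submodule.isOrtho_iff_inner_eq]
    rintro _ ⟨e, he, rfl⟩ _ ⟨e', he', rfl⟩
    exact hO (Subtype.coe_injective.ne hne) ⟨e, he⟩ ⟨e', he'⟩
  refine OrthogonalFamily.sum_projection_of_mem_iSup hW _ ?_
  rw [← Submodule.map_iSup]
  have h1 : (⨆ γ : p.GermEigenvalue, Module.End.eigenspace (p.S : Module.End ℂ p.𝔑) (γ : ℂ)) = ⊤ := by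
    rw [← Submodule.orthogonal_eq_bot_iff]
    exact p.isSymmetric_S.orthogonalComplement_iSup_eigenspaces_eq_bot'
  rw [h1]
  exact ⟨ω, trivial, rfl⟩

/-! ### Solving the commutator equation -/

theorem cCirc_pos {cs : ℝ} (hcs : 0 < cs) : p.cCirc cs ≠ 0 := by
  have hn := p.n_pos
  have hpos : ∀ γ γ' : p.GermEigenvalue, γ ≠ γ' → 0 < p.cPair cs γ γ' := fun γ γ' hne => by
    have : (γ' : ℂ) - γ ≠ 0 := sub_ne_zero.2 (Subtype.coe_injective.ne hne.symm)
    have : 0 < ‖(γ' : ℂ) - γ‖ := norm_pos_iff.2 this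
    exact lt_min hcs (by positivity)
  have hinf : ∀ {ι : Sort _} [Finite ι] (f : ι → ℝ≥0∞), (∀ i, f i ≠ 0) → ⨅ i, f i ≠ 0 := by
    intro ι _ f hf
    rcases isEmpty_or_nonempty ι with h | h
    · rw [iInf_of_empty]; exact ENNReal.top_ne_zero
    · obtain ⟨i, hi⟩ := exists_eq_ciInf_of_finite (f := f)
      rw [← hi]; exact hf i
  refine hinf _ fun γ => hinf _ fun γ' => ?_
  by_cases hcond : γ ≠ γ' ∧ p.eigenProj γ ∘L p.N ∘L p.eigenProj γ' ≠ 0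
  · simpa [hcond] using hpos γ γ' hcond.1
  · simp [hcond]

/-- Each term of the solution of the commutator equation is controlled by `c°`, since
`n⁻¹ |γ_l° - γ_j°| ≥ c°` for the pairs that contribute. -/
theorem norm_inv_smul_le {cs : ℝ} (hcs : 0 < cs) (γ γ' : p.GermEigenvalue) :
    ‖((γ' : ℂ) - (γ : ℂ))⁻¹ • (p.eigenProj γ ∘L p.N ∘L p.eigenProj γ')‖ ≤
      ((p.cCirc cs)⁻¹).toReal / p.n * ‖p.N‖ := by
  have hn : (0 : ℝ) < p.n := by exact_mod_cast p.n_pos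
  have hκ : 0 ≤ ((p.cCirc cs)⁻¹).toReal := ENNReal.toReal_nonneg
  by_cases hcond : γ ≠ γ' ∧ p.eigenProj γ ∘L p.N ∘L p.eigenProj γ' ≠ 0
  · have hne : 0 < ‖(γ' : ℂ) - γ‖ :=
      norm_pos_iff.2 (sub_ne_zero.2 (Subtype.coe_injective.ne hcond.1.symm))
    have h1 : p.cCirc cs ≤ ENNReal.ofReal (p.cPair cs γ γ') :=
      iInf_le_of_le γ (iInf_le_of_le γ' (iInf_le _ hcond))
    have h2 : ENNReal.ofReal (p.cPair cs γ γ') ≤ ENNReal.ofReal ((p.n : ℝ)⁻¹ * ‖(γ' : ℂ) - γ‖) :=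
      ENNReal.ofReal_le_ofReal (min_le_right _ _)
    have h3 := ENNReal.toReal_mono (ENNReal.inv_ne_top.2 (p.cCirc_pos hcs))
      (ENNReal.inv_le_inv.2 (h1.trans h2))
    rw [ENNReal.toReal_inv, ENNReal.toReal_ofReal (by positivity), mul_inv, inv_inv] at h3
    have h4 : ‖(γ' : ℂ) - γ‖⁻¹ ≤ ((p.cCirc cs)⁻¹).toReal / p.n := by
      rw [le_div_iff₀ hn]; linarith
    have h5 : ‖p.eigenProj γ ∘L p.N ∘L p.eigenProj γ'‖ ≤ 1 * (‖p.N‖ * 1) :=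
      norm_comp_le_of_le (Submodule.starProjection_norm_le _)
        (norm_comp_le_of_le le_rfl (Submodule.starProjection_norm_le _))
    rw [one_mul, mul_one] at h5
    rw [norm_smul, norm_inv]
    gcongr
  · have h0 : ((γ' : ℂ) - (γ : ℂ))⁻¹ • (p.eigenProj γ ∘L p.N ∘L p.eigenProj γ') = 0 := by
      by_cases h : γ = γ'
      · simp [h]
      · have : p.eigenProj γ ∘L p.N ∘L p.eigenProj γ' = 0 := by
          by_contra h'
          exact hcond ⟨h, h'⟩
        rw [this, smul_zero]
    rw [h0, norm_zero]
    positivity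

/-- If `N₀ = 0`, the operator `D = ∑ (γ_l - γ_j)⁻¹ P_j N P_l` solves `N + S D - D S = 0`. There are at
most `n²` terms, each of norm at most `n⁻¹ (c°)⁻¹ ‖N‖`. -/
theorem exists_commutator_solution {p : Pencil H Hs} (hNm : ∀ u, p.N u ∈ p.𝔑) (hN₀ : p.N₀ = 0)
    {cs : ℝ} (hcs : 0 < cs) :
    ∃ D : p.𝔑 →L[ℂ] p.𝔑, (∀ ω : p.𝔑, p.N ω + (p.S (D ω) : H) - (D (p.S ω) : H) = 0) ∧
      ‖D‖ ≤ p.n * ((p.cCirc cs)⁻¹).toReal * ‖p.N‖ := by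
  have hn : (0 : ℝ) < p.n := by exact_mod_cast p.n_pos
  have hκ : 0 ≤ ((p.cCirc cs)⁻¹).toReal := ENNReal.toReal_nonneg
  set DH : H →L[ℂ] H := ∑ γ : p.GermEigenvalue, ∑ γ' : p.GermEigenvalue,
    ((γ' : ℂ) - (γ : ℂ))⁻¹ • (p.eigenProj γ ∘L p.N ∘L p.eigenProj γ') with hDH
  have hDa : ∀ u, DH u = ∑ γ : p.GermEigenvalue, ∑ γ' : p.GermEigenvalue,
      ((γ' : ℂ) - (γ : ℂ))⁻¹ • p.eigenProj γ (p.N (p.eigenProj γ' u)) := fun u => by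
    simp [hDH]
  have hEm : ∀ γ u, p.eigenProj γ u ∈ p.𝔑 := fun γ u => by
    obtain ⟨e, he, -⟩ := p.eigenProj_mem γ u
    rw [← he]; exact e.2
  have hDm : ∀ ω : p.𝔑, DH ω ∈ p.𝔑 := fun ω => by
    rw [hDa]
    exact Submodule.sum_mem _ fun γ _ => Submodule.sum_mem _ fun γ' _ =>
      Submodule.smul_mem _ _ (hEm _ _)
  refine ⟨(DH ∘L p.𝔑.subtypeL).codRestrict p.𝔑 hDm, fun ω => ?_, ?_⟩
  · set SH : H →L[ℂ] H := p.𝔑.subtypeL ∘L p.S ∘L p.𝔑.orthogonalProjectionOnto with hSH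
    have hSHa : ∀ ω : p.𝔑, SH ω = p.S ω := fun ω => by simp [hSH]
    have hSHE : ∀ γ u, SH (p.eigenProj γ u) = (γ : ℂ) • p.eigenProj γ u := fun γ u => by
      obtain ⟨e, he, he'⟩ := p.eigenProj_mem γ u
      rw [← he, hSHa, he']
      rfl
    change p.N ω + (p.S ⟨DH ω, hDm ω⟩ : H) - DH (p.S ω : H) = 0
    rw [← hSHa]
    change p.N ω + SH (DH ω) - DH (p.S ω : H) = 0
    have hN : p.N ω = ∑ γ : p.GermEigenvalue, ∑ γ' : p.GermEigenvalue,
        p.eigenProj γ (p.N (p.eigenProj γ' ω)) := by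
      have h1 := p.sum_eigenProj_coe ⟨p.N ω, hNm ω⟩
      have h2 := p.sum_eigenProj_coe ω
      change ∑ γ, p.eigenProj γ (p.N ω) = p.N ω at h1
      rw [← h1]
      refine Finset.sum_congr rfl fun γ _ => ?_
      conv_lhs => rw [← h2]
      rw [map_sum, map_sum]
    have hd : ∑ γ : p.GermEigenvalue, p.eigenProj γ (p.N (p.eigenProj γ ω)) = 0 := by
      have := congrArg (fun T : H →L[ℂ] H => T ω) hN₀
      simpa [N₀] using this
    rw [hN, hDa, hDa]
    simp only [map_sum, map_smul, hSHE, eigenProj_S]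
    rw [← Finset.sum_add_distrib, ← Finset.sum_sub_distrib, ← hd]
    refine Finset.sum_congr rfl fun γ _ => ?_
    rw [← Finset.sum_add_distrib, ← Finset.sum_sub_distrib]
    rw [Finset.sum_eq_single γ]
    · simp
    · intro γ' _ hne
      have h3 : (γ' : ℂ) - (γ : ℂ) ≠ 0 := sub_ne_zero.2 (Subtype.coe_injective.ne hne)
      rw [smul_smul, smul_smul]
      have h4 : ((γ' : ℂ) - γ)⁻¹ * (γ' : ℂ) = 1 + ((γ' : ℂ) - γ)⁻¹ * γ := by
        field_simp
        ring
      rw [h4]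
      module
    · simp
  · have h1 : ‖DH‖ ≤ p.n * ((p.cCirc cs)⁻¹).toReal * ‖p.N‖ := by
      have hcard : (Fintype.card p.GermEigenvalue : ℝ) ≤ p.n := by
        exact_mod_cast p.card_germEigenvalue_le
      calc ‖DH‖ ≤ ∑ γ : p.GermEigenvalue, ∑ γ' : p.GermEigenvalue,
            ((p.cCirc cs)⁻¹).toReal / p.n * ‖p.N‖ :=
            norm_sum_le_of_le _ fun γ _ => norm_sum_le_of_le _ fun γ' _ =>
              p.norm_inv_smul_le hcs γ γ'
        _ = Fintype.card p.GermEigenvalue * (Fintype.card p.GermEigenvalue *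
            (((p.cCirc cs)⁻¹).toReal / p.n * ‖p.N‖)) := by
            simp [Finset.sum_const, Finset.card_univ]
        _ ≤ p.n * (p.n * (((p.cCirc cs)⁻¹).toReal / p.n * ‖p.N‖)) := by gcongr
        _ = _ := by field_simp
    refine ContinuousLinearMap.opNorm_le_bound _ (by positivity) fun ω => ?_
    exact DH.le_of_opNorm_le h1 (ω : H)

/-! ### Threshold approximation of the cosine and the sine -/

variable {p}

/-- If `V` is `v`-close to the inclusion `𝔑 → H` and almost intertwines `FA` and `FB`, then `FA P` is
close to `FB P`. -/
theorem norm_comp_P_sub_le {FA : H →L[ℂ] H} {FB : p.𝔑 →L[ℂ] p.𝔑} {V : p.𝔑 →L[ℂ] H} {C K v : ℝ}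
    (hA : ∀ u, ‖FA u‖ ≤ C * ‖u‖) (hB : ∀ ω, ‖FB ω‖ ≤ C * ‖ω‖) (hC : 0 ≤ C) (hK : 0 ≤ K)
    (hV : ‖V - p.𝔑.subtypeL‖ ≤ v) (h : ∀ ω, ‖FA (V ω) - V (FB ω)‖ ≤ K * ‖ω‖) :
    ‖FA ∘L p.P - p.𝔑.subtypeL ∘L FB ∘L p.𝔑.orthogonalProjectionOnto‖ ≤ 2 * C * v + K := by
  have hv : 0 ≤ v := (norm_nonneg (V - p.𝔑.subtypeL)).trans hV
  refine ContinuousLinearMap.opNorm_le_bound _ (by positivity) fun u => ?_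
  set ω := p.𝔑.orthogonalProjectionOnto u with hω
  have hωu : ‖ω‖ ≤ ‖u‖ := by
    rw [← one_mul ‖u‖]
    exact (p.𝔑.orthogonalProjectionOnto).le_of_opNorm_le
      (Submodule.orthogonalProjectionOnto_norm_le _) u
  have hVa : ∀ ω : p.𝔑, ‖V ω - (ω : H)‖ ≤ v * ‖ω‖ := fun ω =>
    (V - p.𝔑.subtypeL).le_of_opNorm_le hV ω
  have e : (FA ∘L p.P - p.𝔑.subtypeL ∘L FB ∘L p.𝔑.orthogonalProjectionOnto) u =
      (FA (V ω) - V (FB ω)) - FA (V ω - (ω : H)) + (V (FB ω) - (FB ω : H)) := by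
    rw [map_sub]
    change FA (ω : H) - (FB ω : H) = _
    abel
  rw [e]
  have h1 := hA (V ω - (ω : H))
  have h2 := hVa (FB ω)
  have h3 := hVa ω
  have h4 := hB ω
  have h5 := h ω
  calc _ ≤ ‖FA (V ω) - V (FB ω)‖ + ‖FA (V ω - (ω : H))‖ + ‖V (FB ω) - (FB ω : H)‖ :=
        (norm_add_le _ _).trans (add_le_add_left (norm_sub_le _ _) _)
    _ ≤ K * ‖ω‖ + C * (v * ‖ω‖) + v * (C * ‖ω‖) := by
        gcongr
        · exact h1.trans (by gcongr)
        · exact h2.trans (by gcongr)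
    _ = (2 * C * v + K) * ‖ω‖ := by ring
    _ ≤ _ := by gcongr

theorem norm_comp_P_sub_le_two_mul {FA : H →L[ℂ] H} {FB : p.𝔑 →L[ℂ] p.𝔑} {C : ℝ}
    (hA : ∀ u, ‖FA u‖ ≤ C * ‖u‖) (hB : ∀ ω, ‖FB ω‖ ≤ C * ‖ω‖) (hC : 0 ≤ C) :
    ‖FA ∘L p.P - p.𝔑.subtypeL ∘L FB ∘L p.𝔑.orthogonalProjectionOnto‖ ≤ 2 * C := by
  refine ContinuousLinearMap.opNorm_le_bound _ (by positivity) fun u => ?_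
  set ω := p.𝔑.orthogonalProjectionOnto u with hω
  have hωu : ‖ω‖ ≤ ‖u‖ := by
    rw [← one_mul ‖u‖]
    exact (p.𝔑.orthogonalProjectionOnto).le_of_opNorm_le
      (Submodule.orthogonalProjectionOnto_norm_le _) u
  change ‖FA (ω : H) - (FB ω : H)‖ ≤ _
  have h1 : ‖FA (ω : H)‖ ≤ C * ‖ω‖ := hA ω
  have h2 : ‖(FB ω : H)‖ ≤ C * ‖ω‖ := hB ω
  calc _ ≤ C * ‖ω‖ + C * ‖ω‖ := (norm_sub_le _ _).trans (add_le_add h1 h2)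
    _ = 2 * C * ‖ω‖ := by ring
    _ ≤ _ := by gcongr

/-- The bounds for `J₁` and `J₂` by `2` resp. `2 ρ`, and those that follow from Duhamel's principle;
here `ρ` bounds `λ^(-1/2) sin (s λ^(1/2))` for `λ ≥ c_* t²` and `|s| ≤ |τ|`. -/
theorem IsSolutionOperator.norm_J_le {Q : Hs →L[ℂ] H} {Γ : Hs →L[ℂ] Hs} {q cs t₀ t τ ρ : ℝ}
    (hQ : p.IsSolutionOperator Q Γ q) {D : p.𝔑 →L[ℂ] p.𝔑}
    (hD : ∀ ω : p.𝔑, p.N ω + (p.S (D ω) : H) - (D (p.S ω) : H) = 0)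
    (hnd : p.Nondegenerate cs t₀) (hcs : 0 < cs) (ht₀ : 0 < t₀) (htt : |t| ≤ t₀)
    (ht : |t| * (q * ‖p.X₁‖) ≤ 1)
    (hρ : ∀ s y, |s| ≤ |τ| → cs * t ^ 2 ≤ y → |sinQuot s y| ≤ ρ) :
    ‖p.J₁ t τ‖ ≤ 2 ∧ ‖p.J₂ t τ‖ ≤ 2 * ρ ∧
    ‖p.J₁ t τ‖ ≤ 10 * |t| * (q * ‖p.X₁‖ + ‖D‖) +
      (ρ * (19 * t ^ 4 * (q * ‖p.X₁‖ ^ 3) * (q * ‖p.X₁‖ + ‖D‖)) +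
        11 * |t| ^ 3 * (q * ‖p.X₁‖ ^ 2) * (q * ‖p.X₁‖ + ‖D‖)) * |τ| ∧
    ‖p.J₂ t τ‖ ≤ ρ * (10 * |t| * (q * ‖p.X₁‖ + ‖D‖) +
      (ρ * (19 * t ^ 4 * (q * ‖p.X₁‖ ^ 3) * (q * ‖p.X₁‖ + ‖D‖)) +
        11 * |t| ^ 3 * (q * ‖p.X₁‖ ^ 2) * (q * ‖p.X₁‖ + ‖D‖)) * |τ|) := by
  obtain ⟨V, f, g, hW, hVn, hfn, hgn⟩ := hQ.exists_weakIntertwining D hD ht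
  have ha : 0 ≤ cs * t ^ 2 := by positivity
  have hX : Dense ((p.X t).domain : Set H) := p.dense_domain
  have hc := p.closed_X t
  have hT := spectrum_resolventNegOne_mul_le hX hc ha (hnd t htt)
  have hB := p.isSelfAdjoint_smul_S t
  have hsp := p.spectrum_smul_S (hnd.mul_norm_sq_le hcs ht₀) t
  have hsp0 : spectrum ℝ ((t : ℂ) ^ 2 • p.S) ⊆ Set.Ici 0 := hsp.trans (Set.Ici_subset_Ici.2 ha)
  have hρ0 : 0 ≤ ρ := (abs_nonneg _).trans (hρ 0 _ (by simp) le_rfl)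
  have hd1 := norm_boundedFun_cos_sub_le hX hc hW hT hB hsp0 hρ
  have hd2 := norm_boundedFun_sinQuot_sub_le hX hc hW ha hT hB hsp hρ
  have hA1 := norm_boundedFun_le hX hc (continuousOn_cos_mul_sqrt τ)
    (fun x _ => Real.abs_cos_le_one _) hT (fun x _ => Real.abs_cos_le_one (τ * √x))
  have hA2 := norm_boundedFun_le hX hc (continuousOn_sinQuot τ)
    (fun x hx => abs_sinQuot_le τ hx) hT (fun x hx => hρ τ x le_rfl hx)
  have hB1 := norm_cfc_apply_le_mul hB ((continuousOn_cos_mul_sqrt τ).mono hsp0) zero_le_one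
    (fun x _ => Real.abs_cos_le_one _)
  have hB2 := norm_cfc_apply_le_mul hB ((continuousOn_sinQuot τ).mono hsp0) hρ0
    (fun x hx => hρ τ x le_rfl (hsp hx))
  have h1 := norm_comp_P_sub_le hA1 hB1 zero_le_one (by positivity) hVn hd1
  have h2 := norm_comp_P_sub_le hA2 hB2 hρ0 (by positivity) hVn hd2
  refine ⟨(norm_comp_P_sub_le_two_mul hA1 hB1 zero_le_one).trans_eq (mul_one 2),
    norm_comp_P_sub_le_two_mul hA2 hB2 hρ0, h1.trans ?_, h2.trans ?_⟩
  · calc _ = 10 * |t| * (q * ‖p.X₁‖ + ‖D‖) + (ρ * ‖f‖ + ‖g‖) * |τ| := by ring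
      _ ≤ _ := by gcongr
  · calc _ = ρ * (10 * |t| * (q * ‖p.X₁‖ + ‖D‖) + (ρ * ‖f‖ + ‖g‖) * |τ|) := by ring
      _ ≤ _ := by gcongr

/-! ### Interpolation -/

theorem le_of_le_of_le_of_mul_le_sq {x a b y : ℝ} (hy : 0 ≤ y) (hxa : x ≤ a) (hxb : x ≤ b)
    (h : a * b ≤ y ^ 2) : x ≤ y := by
  rcases le_or_gt x 0 with h0 | h0
  · exact h0.trans hy
  · have : x ^ 2 ≤ y ^ 2 := by
      rw [pow_two]
      exact (mul_le_mul hxa hxb h0.le (h0.le.trans hxa)).trans h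
    exact (abs_le_of_sq_le_sq' this hy).2

/-- All fractional powers of the interpolation inequalities expressed as integer powers of
`e = ε^(1/2)`, `r = |t|^(1/2)`, `X = (t² + ε²)^(1/4)` and `T = |τ|^(1/2)`. -/
theorem exists_roots {ε : ℝ} (t τ : ℝ) (hε : 0 < ε) :
    ∃ e r X T : ℝ, 0 < e ∧ 0 ≤ r ∧ 0 < X ∧ 0 ≤ T ∧ e ≤ X ∧ r ≤ X ∧ ε = e ^ 2 ∧ |t| = r ^ 2 ∧
      |τ| = T ^ 2 ∧ |τ| ^ (1 / 2 : ℝ) = T ∧ ε ^ (3 / 2 : ℝ) = e ^ 3 ∧ ε ^ (1 / 2 : ℝ) = e ∧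
      (t ^ 2 + ε ^ 2) ^ (-3 / 4 : ℝ) = (X ^ 3)⁻¹ ∧ (t ^ 2 + ε ^ 2) ^ (-1 / 4 : ℝ) = X⁻¹ := by
  have hs : 0 < t ^ 2 + ε ^ 2 := by positivity
  have hX : 0 < (t ^ 2 + ε ^ 2) ^ (1 / 4 : ℝ) := by positivity
  have hX4 : ((t ^ 2 + ε ^ 2) ^ (1 / 4 : ℝ)) ^ 4 = t ^ 2 + ε ^ 2 := by
    rw [← Real.rpow_natCast, ← Real.rpow_mul hs.le]
    norm_num
  have hr : √|t| ^ 2 = |t| := Real.sq_sqrt (abs_nonneg t)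
  have he : √ε ^ 2 = ε := Real.sq_sqrt hε.le
  refine ⟨√ε, √|t|, (t ^ 2 + ε ^ 2) ^ (1 / 4 : ℝ), √|τ|, Real.sqrt_pos.2 hε, Real.sqrt_nonneg _, hX,
    Real.sqrt_nonneg _, ?_, ?_, he.symm, hr.symm, (Real.sq_sqrt (abs_nonneg τ)).symm,
    (Real.sqrt_eq_rpow _).symm, ?_, (Real.sqrt_eq_rpow _).symm, ?_, ?_⟩
  · refine le_of_pow_le_pow_left₀ (n := 4) (by norm_num) hX.le ?_
    rw [hX4, show √ε ^ 4 = (√ε ^ 2) ^ 2 by ring, he]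
    nlinarith [sq_nonneg t]
  · refine le_of_pow_le_pow_left₀ (n := 4) (by norm_num) hX.le ?_
    rw [hX4, show √|t| ^ 4 = (√|t| ^ 2) ^ 2 by ring, hr, sq_abs]
    nlinarith [sq_nonneg ε]
  · rw [Real.sqrt_eq_rpow, ← Real.rpow_natCast, ← Real.rpow_mul hε.le]
    norm_num
  · rw [← Real.rpow_natCast ((t ^ 2 + ε ^ 2) ^ (1 / 4 : ℝ)) 3, ← Real.rpow_mul hs.le,
      ← Real.rpow_neg hs.le]
    norm_num
  · rw [← Real.rpow_neg hs.le]
    norm_num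

/-- Interpolation of the two bounds for `J₁`: the part of `J` beyond `K |t|` is at most
`min {2, C ε⁻¹ |τ| |t|³}`, hence at most the geometric mean of the two numbers. -/
theorem interpolate_cos {J K C ε t τ : ℝ} (hε : 0 < ε) (hK : 0 ≤ K) (hJ : J ≤ 2)
    (h : J ≤ K * |t| + C * (|ε⁻¹ * τ| * |t| ^ 3)) :
    J * (ε ^ (3 / 2 : ℝ) * (t ^ 2 + ε ^ 2) ^ (-3 / 4 : ℝ)) ≤
      (K + max C 2 * |τ| ^ (1 / 2 : ℝ)) * ε := by
  obtain ⟨e, r, X, T, he, hr, hX, hT, heX, hrX, e1, e2, e3, e4, e5, e6, e7, e8⟩ :=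
    exists_roots t τ hε
  rw [abs_mul, abs_of_pos (inv_pos.2 hε), e2, e3, e1] at h
  rw [e5, e7, e4, e1]
  set M := max C 2
  have hM2 : 2 ≤ M := le_max_right _ _
  have hMC : C ≤ M := le_max_left _ _
  have h1 : J - K * r ^ 2 ≤ M * T * r ^ 3 / e := by
    refine le_of_le_of_le_of_mul_le_sq (a := M) (b := M * ((e ^ 2)⁻¹ * T ^ 2 * (r ^ 2) ^ 3))
      (by positivity) ?_ ?_ (le_of_eq ?_)
    · nlinarith [mul_nonneg hK (sq_nonneg r)]
    · have : C * ((e ^ 2)⁻¹ * T ^ 2 * (r ^ 2) ^ 3) ≤ M * ((e ^ 2)⁻¹ * T ^ 2 * (r ^ 2) ^ 3) := by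
        gcongr
      linarith
    · field_simp
  rw [← div_eq_mul_inv, ← mul_div_assoc, div_le_iff₀ (by positivity)]
  have h2 : J * e ^ 3 ≤ (K * r ^ 2 + M * T * r ^ 3 / e) * e ^ 3 := by
    gcongr; linarith
  refine h2.trans ?_
  have h3 : (K * r ^ 2 + M * T * r ^ 3 / e) * e ^ 3 = K * e ^ 2 * (r ^ 2 * e) + M * T * e ^ 2 * r ^ 3 := by
    field_simp
  have h4 : r ^ 2 * e ≤ X ^ 3 := by
    calc r ^ 2 * e ≤ X ^ 2 * X := by gcongr
      _ = X ^ 3 := by ring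
  have h5 : r ^ 3 ≤ X ^ 3 := by gcongr
  rw [h3]
  calc _ ≤ K * e ^ 2 * X ^ 3 + M * T * e ^ 2 * X ^ 3 := by gcongr
    _ = _ := by ring

/-- Interpolation of the two bounds for `J₂`: the part of `J` beyond `L` is at most the geometric mean
of `2 s |t|⁻¹` and `C ε⁻¹ |τ| t²`. -/
theorem interpolate_sin {J L C s ε t τ : ℝ} (hε : 0 < ε) (ht : t ≠ 0) (hL : 0 ≤ L) (hs : 0 ≤ s)
    (hJ : J ≤ 2 * (s * |t|⁻¹)) (h : J ≤ L + C * (|ε⁻¹ * τ| * t ^ 2)) :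
    J * (ε ^ (1 / 2 : ℝ) * (t ^ 2 + ε ^ 2) ^ (-1 / 4 : ℝ)) ≤
      L + max C (2 * s) * |τ| ^ (1 / 2 : ℝ) := by
  obtain ⟨e, r, X, T, he, hr, hX, hT, heX, hrX, e1, e2, e3, e4, e5, e6, e7, e8⟩ :=
    exists_roots t τ hε
  have hr0 : 0 < r := by
    refine lt_of_le_of_ne hr fun h0 => ht ?_
    rw [← abs_eq_zero, e2, ← h0]; norm_num
  rw [abs_mul, abs_of_pos (inv_pos.2 hε), ← sq_abs t, e2, e3, e1] at h
  rw [e2] at hJ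
  rw [e6, e8, e4]
  set M := max C (2 * s)
  have hM2 : 2 * s ≤ M := le_max_right _ _
  have hMC : C ≤ M := le_max_left _ _
  have hM0 : 0 ≤ M := (by positivity : 0 ≤ 2 * s).trans hM2
  have h1 : J - L ≤ M * T * r / e := by
    refine le_of_le_of_le_of_mul_le_sq (a := M * (r ^ 2)⁻¹)
      (b := M * ((e ^ 2)⁻¹ * T ^ 2 * (r ^ 2) ^ 2)) (by positivity) ?_ ?_ (le_of_eq ?_)
    · have : 2 * s * (r ^ 2)⁻¹ ≤ M * (r ^ 2)⁻¹ := by gcongr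
      linarith
    · have : C * ((e ^ 2)⁻¹ * T ^ 2 * (r ^ 2) ^ 2) ≤ M * ((e ^ 2)⁻¹ * T ^ 2 * (r ^ 2) ^ 2) := by
        gcongr
      linarith
    · field_simp
  rw [← div_eq_mul_inv, ← mul_div_assoc, div_le_iff₀ hX]
  calc J * e ≤ (L + M * T * r / e) * e := by gcongr; linarith
    _ = L * e + M * T * r := by field_simp
    _ ≤ L * X + M * T * X := by gcongr
    _ = _ := by ring

theorem IsSolutionOperator.mono {Q : Hs →L[ℂ] H} {Γ : Hs →L[ℂ] Hs} {q q' : ℝ}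
    (hQ : p.IsSolutionOperator Q Γ q) (h : q ≤ q') : p.IsSolutionOperator Q Γ q' :=
  { hQ with norm_le := hQ.norm_le.trans h }

/-- Since `S ≥ c_*` and `‖S‖ ≤ ‖X₁‖²`, one has `c_* ≤ ‖X₁‖²`. -/
theorem IsSolutionOperator.le_norm_sq {Q : Hs →L[ℂ] H} {Γ : Hs →L[ℂ] Hs} {q cs t₀ : ℝ}
    (hQ : p.IsSolutionOperator Q Γ q)
    (hnd : p.Nondegenerate cs t₀) (hcs : 0 < cs) (ht₀ : 0 < t₀) : cs ≤ ‖p.X₁‖ ^ 2 := by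
  have : Nontrivial p.𝔑 := Submodule.nontrivial_iff_ne_bot.2 p.kernel_ne_bot
  obtain ⟨ω, hω⟩ := exists_ne (0 : p.𝔑)
  have h1 := hnd.mul_norm_sq_le hcs ht₀ ω
  have h2 : ‖p.R ω‖ ≤ ‖p.X₁‖ * ‖ω‖ := p.R.le_of_opNorm_le hQ.norm_R_le ω
  have h3 : 0 < ‖ω‖ ^ 2 := pow_pos (norm_pos_iff.2 hω) 2
  refine le_of_mul_le_mul_right ?_ h3
  calc cs * ‖ω‖ ^ 2 ≤ ‖p.R ω‖ ^ 2 := h1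
    _ ≤ (‖p.X₁‖ * ‖ω‖) ^ 2 := by gcongr
    _ = _ := by ring

/-- The interpolated estimates, for any solution `D` of the commutator equation; `s` stands for
`c_*^(-1/2)`. -/
theorem IsSolutionOperator.interpolated_bounds {Q : Hs →L[ℂ] H} {Γ : Hs →L[ℂ] Hs}
    {q cs t₀ t s K C L C' b : ℝ}
    (hQ : p.IsSolutionOperator Q Γ q) {D : p.𝔑 →L[ℂ] p.𝔑}
    (hD : ∀ ω : p.𝔑, p.N ω + (p.S (D ω) : H) - (D (p.S ω) : H) = 0) (hb : q * ‖p.X₁‖ + ‖D‖ ≤ b)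
    (hnd : p.Nondegenerate cs t₀) (hcs : 0 < cs) (ht₀ : 0 < t₀) (htt : |t| ≤ t₀)
    (ht : |t| * (q * ‖p.X₁‖) ≤ 1) (hs : s = (√cs)⁻¹)
    (hK : 10 * b ≤ K) (hC : 30 * s * (q * ‖p.X₁‖ ^ 3) * b ≤ C)
    (hL : 10 * s * b ≤ L) (hC' : 30 * s ^ 2 * (q * ‖p.X₁‖ ^ 3) * b ≤ C') {ε : ℝ} (hε : 0 < ε)
    (τ : ℝ) :
    ‖p.J₁ t (ε⁻¹ * τ)‖ * (ε ^ (3 / 2 : ℝ) * (t ^ 2 + ε ^ 2) ^ (-3 / 4 : ℝ)) ≤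
      (K + max C 2 * |τ| ^ (1 / 2 : ℝ)) * ε ∧
    ‖p.J₂ t (ε⁻¹ * τ)‖ * (ε ^ (1 / 2 : ℝ) * (t ^ 2 + ε ^ 2) ^ (-1 / 4 : ℝ)) ≤
      L + max C' (2 * s) * |τ| ^ (1 / 2 : ℝ) := by
  have hsq : 0 < √cs := Real.sqrt_pos.2 hcs
  have hs0 : 0 < s := hs ▸ inv_pos.2 hsq
  have hq := hQ.q_nonneg
  have hm0 : 0 ≤ ‖p.X₁‖ := norm_nonneg _
  have hb0 : 0 ≤ b := le_trans (by positivity) hb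
  have hK0 : 0 ≤ K := le_trans (by positivity) hK
  have hL0 : 0 ≤ L := le_trans (by positivity) hL
  rcases eq_or_ne t 0 with rfl | htne
  · -- at `t = 0` there is no lower bound, but `|s|` bounds `λ^(-1/2) sin (s λ^(1/2))`
    obtain ⟨-, -, h1, h2⟩ := hQ.norm_J_le (τ := ε⁻¹ * τ) (ρ := |ε⁻¹ * τ|) hD hnd hcs ht₀ htt ht
      (fun s y hs hy => (abs_sinQuot_le s (by simpa using hy)).trans hs)
    simp only [abs_zero, mul_zero, zero_mul, add_zero, ne_eq, OfNat.ofNat_ne_zero,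
      not_false_eq_true, zero_pow] at h1 h2
    have e1 := le_antisymm h1 (norm_nonneg _)
    have e2 := le_antisymm h2 (norm_nonneg _)
    rw [e1, e2]
    have : 0 ≤ max C' (2 * s) := le_trans (by positivity) (le_max_right _ _)
    constructor
    · rw [zero_mul]; positivity
    · rw [zero_mul]; positivity
  have htp : 0 < |t| := abs_pos.2 htne
  have hsm : 1 ≤ s * ‖p.X₁‖ := by
    have h1 : √cs ≤ ‖p.X₁‖ := by
      rw [Real.sqrt_le_left hm0]
      exact hQ.le_norm_sq hnd hcs ht₀
    rw [hs, inv_mul_eq_div, le_div_iff₀ hsq, one_mul]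
    exact h1
  have hρe : (√(cs * t ^ 2))⁻¹ = s * |t|⁻¹ := by
    rw [Real.sqrt_mul hcs.le, Real.sqrt_sq_eq_abs, mul_inv, hs]
  obtain ⟨h1, h2, h3, h4⟩ := hQ.norm_J_le (τ := ε⁻¹ * τ) (ρ := s * |t|⁻¹) hD hnd hcs ht₀ htt ht
    (fun s y _ hy => hρe ▸ abs_sinQuot_le_inv_sqrt s (by positivity) hy)
  set m := ‖p.X₁‖
  set σ := |ε⁻¹ * τ|
  have h5 : s * |t|⁻¹ * (19 * t ^ 4 * (q * m ^ 3) * (q * m + ‖D‖)) +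
      11 * |t| ^ 3 * (q * m ^ 2) * (q * m + ‖D‖) ≤ 30 * s * (q * m ^ 3) * b * |t| ^ 3 := by
    have e1 : s * |t|⁻¹ * (19 * t ^ 4 * (q * m ^ 3) * (q * m + ‖D‖)) =
        19 * s * (q * m ^ 3) * (q * m + ‖D‖) * |t| ^ 3 := by
      have : t ^ 4 = |t| ^ 4 := by rw [← abs_pow]; exact (abs_of_nonneg (by positivity)).symm
      rw [this]
      field_simp
    have e2 : 11 * |t| ^ 3 * (q * m ^ 2) * (q * m + ‖D‖) ≤
        11 * |t| ^ 3 * (q * m ^ 2) * (q * m + ‖D‖) * (s * m) :=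
      le_mul_of_one_le_right (by positivity) hsm
    calc _ ≤ 19 * s * (q * m ^ 3) * (q * m + ‖D‖) * |t| ^ 3 +
          11 * |t| ^ 3 * (q * m ^ 2) * (q * m + ‖D‖) * (s * m) := by
          rw [e1]; gcongr
      _ = 30 * s * (q * m ^ 3) * (q * m + ‖D‖) * |t| ^ 3 := by ring
      _ ≤ 30 * s * (q * m ^ 3) * b * |t| ^ 3 := by gcongr
  have h6 : 10 * |t| * (q * m + ‖D‖) ≤ 10 * b * |t| := by
    calc 10 * |t| * (q * m + ‖D‖) ≤ 10 * |t| * b := by gcongr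
      _ = _ := by ring
  constructor
  · refine interpolate_cos hε hK0 h1 (h3.trans ?_)
    calc _ ≤ 10 * b * |t| + 30 * s * (q * m ^ 3) * b * |t| ^ 3 * σ := by gcongr
      _ ≤ K * |t| + C * |t| ^ 3 * σ := by gcongr
      _ = _ := by ring
  · refine interpolate_sin hε htne hL0 hs0.le h2 (h4.trans ?_)
    calc _ ≤ s * |t|⁻¹ * (10 * b * |t| + 30 * s * (q * m ^ 3) * b * |t| ^ 3 * σ) := by gcongr
      _ = 10 * s * b + 30 * s ^ 2 * (q * m ^ 3) * b * (σ * |t| ^ 2) := by field_simp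
      _ ≤ L + C' * (σ * |t| ^ 2) := by gcongr
      _ = _ := by rw [sq_abs]

end Pencil

end OperatorPencil

theorem theorem3p2 :
    ∃ β₁ β₂ β₇ β₉ β₁₁ β₁₂ β₁₃ : ℝ,
      1 ≤ β₁ ∧ 1 ≤ β₂ ∧ 1 ≤ β₇ ∧ 1 ≤ β₉ ∧ 1 ≤ β₁₁ ∧ 1 ≤ β₁₂ ∧ 1 ≤ β₁₃ ∧
      ∀ (H : Type*) (Hs : Type*)
        [NormedAddCommGroup H] [InnerProductSpace ℂ H] [CompleteSpace H]
        [TopologicalSpace.SeparableSpace H]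
        [NormedAddCommGroup Hs] [InnerProductSpace ℂ Hs] [CompleteSpace Hs]
        [TopologicalSpace.SeparableSpace Hs]
        (p : OperatorPencil.Pencil H Hs) (δ t₀ cs : ℝ),
        0 < δ → ENNReal.ofReal (8 * δ) < p.d₀ →
        0 < t₀ → t₀ ≤ δ ^ (1 / 2 : ℝ) * ‖p.X₁‖⁻¹ →
        0 < cs → p.Nondegenerate cs t₀ →
        (p.N = 0 →
          ∀ C₁ C₇ C₉ C₁₀ : ℝ,
            C₁ = β₁ * δ ^ (-1 / 2 : ℝ) * ‖p.X₁‖ →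
            C₇ = β₇ * δ ^ (-1 / 2 : ℝ) * cs ^ (-1 / 2 : ℝ) * ‖p.X₁‖ * (1 + cs⁻¹ * ‖p.X₁‖ ^ 2) →
            C₉ = β₉ * δ⁻¹ * ‖p.X₁‖ ^ 3 *
              (1 + cs ^ (-1 / 2 : ℝ) * ‖p.X₁‖ + cs ^ (-3 / 2 : ℝ) * ‖p.X₁‖ ^ 3 +
                cs ^ (-5 / 2 : ℝ) * ‖p.X₁‖ ^ 5) →
            C₁₀ = cs ^ (-1 / 2 : ℝ) * C₉ →
            ∀ ε τ t : ℝ, 0 < ε → |t| ≤ t₀ →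
              ‖p.J₁ t (ε⁻¹ * τ)‖ * (ε ^ (3 / 2 : ℝ) * (t ^ 2 + ε ^ 2) ^ (-3 / 4 : ℝ)) ≤
                  (2 * C₁ + max C₉ 2 * |τ| ^ (1 / 2 : ℝ)) * ε ∧
              ‖p.J₂ t (ε⁻¹ * τ)‖ * (ε ^ (1 / 2 : ℝ) * (t ^ 2 + ε ^ 2) ^ (-1 / 4 : ℝ)) ≤
                  C₇ + max C₁₀ (2 * cs ^ (-1 / 2 : ℝ)) * |τ| ^ (1 / 2 : ℝ)) ∧
        (p.N₀ = 0 →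
          ∀ κ C₁₁ C₁₂ C₁₃ C₁₄ : ℝ,
            κ = ((p.cCirc cs)⁻¹).toReal →
            C₁₁ = β₁₁ * δ ^ (-1 / 2 : ℝ) * ‖p.X₁‖ *
              (1 + (p.n : ℝ) ^ 2 * cs ^ (-1 / 2 : ℝ) * ‖p.X₁‖ ^ 3 * κ) →
            C₁₂ = β₁₂ * δ⁻¹ * ‖p.X₁‖ ^ 3 *
                (1 + cs ^ (-1 / 2 : ℝ) * ‖p.X₁‖ + cs ^ (-3 / 2 : ℝ) * ‖p.X₁‖ ^ 3 +
                  cs ^ (-5 / 2 : ℝ) * ‖p.X₁‖ ^ 5) +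
              β₁₂ * δ⁻¹ * cs ^ (-1 / 2 : ℝ) * ‖p.X₁‖ ^ 8 * (p.n : ℝ) ^ 2 * κ ^ 2 →
            C₁₃ = β₁₃ * δ ^ (-1 / 2 : ℝ) * cs ^ (-1 / 2 : ℝ) * ‖p.X₁‖ *
              (1 + cs⁻¹ * ‖p.X₁‖ ^ 2 + (p.n : ℝ) ^ 2 * cs ^ (-1 / 2 : ℝ) * ‖p.X₁‖ ^ 3 * κ) →
            C₁₄ = cs ^ (-1 / 2 : ℝ) * C₁₂ →
            ∀ t₀₀ : ℝ, t₀₀ ≤ t₀ →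
              ENNReal.ofReal t₀₀ ≤
                ENNReal.ofReal ((4 * β₂)⁻¹ * δ ^ (1 / 2 : ℝ) * (‖p.X₁‖ ^ 3)⁻¹) * p.cCirc cs →
            ∀ ε τ t : ℝ, 0 < ε → |t| ≤ t₀₀ →
              ‖p.J₁ t (ε⁻¹ * τ)‖ * (ε ^ (3 / 2 : ℝ) * (t ^ 2 + ε ^ 2) ^ (-3 / 4 : ℝ)) ≤
                  (C₁₁ + max C₁₂ 2 * |τ| ^ (1 / 2 : ℝ)) * ε ∧
              ‖p.J₂ t (ε⁻¹ * τ)‖ * (ε ^ (1 / 2 : ℝ) * (t ^ 2 + ε ^ 2) ^ (-1 / 4 : ℝ)) ≤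
                  C₁₃ + max C₁₄ (2 * cs ^ (-1 / 2 : ℝ)) * |τ| ^ (1 / 2 : ℝ)) := by
  -- the factors `10` and `30` of `IsSolutionOperator.interpolated_bounds`, doubled where
  -- `‖D‖ ≤ 2 δ^(-1/2) ‖X₁‖³ n (c°)⁻¹` enters
  refine ⟨5, 1, 10, 30, 20, 60, 20, by norm_num, by norm_num, by norm_num, by norm_num,
    by norm_num, by norm_num, by norm_num, ?_⟩
  intro H Hs _ _ _ _ _ _ _ _ p δ t₀ cs hδ hgap ht₀ htδ hcs hnd
  have hδ8 : (0 : ℝ) < 8 * δ := by positivity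
  obtain ⟨Q, Γ, hQ8⟩ := p.exists_isSolutionOperator hδ8 hgap
  have hsδ : 0 < √δ := Real.sqrt_pos.2 hδ
  obtain ⟨q, hq⟩ : ∃ q, q = (√δ)⁻¹ := ⟨_, rfl⟩
  have hQ : p.IsSolutionOperator Q Γ q := hQ8.mono <| hq ▸
    inv_anti₀ hsδ (Real.sqrt_le_sqrt (by linarith))
  obtain ⟨s, hs⟩ : ∃ s, s = (√cs)⁻¹ := ⟨_, rfl⟩
  have hsc : 0 < √cs := Real.sqrt_pos.2 hcs
  have hs0 : 0 < s := hs ▸ inv_pos.2 hsc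
  have hq0 : 0 < q := hq ▸ inv_pos.2 hsδ
  -- all powers of `δ` and `c_*` in terms of `q = δ^(-1/2)` and `s = c_*^(-1/2)`
  have hrpow : ∀ {x : ℝ}, 0 < x → ∀ k : ℕ, x ^ (-(k : ℝ) / 2) = ((√x)⁻¹) ^ k := fun {x} hx k => by
    rw [neg_div, Real.rpow_neg hx.le, Real.sqrt_eq_rpow, inv_pow, ← Real.rpow_natCast,
      ← Real.rpow_mul hx.le]
    congr 2
    ring
  have hδ1 : δ ^ (-1 / 2 : ℝ) = q := by simpa [hq] using hrpow hδ 1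
  have hδ2 : δ⁻¹ = q ^ 2 := by rw [hq, inv_pow, Real.sq_sqrt hδ.le]
  have hc1 : cs ^ (-1 / 2 : ℝ) = s := by simpa [hs] using hrpow hcs 1
  have hc2 : cs⁻¹ = s ^ 2 := by rw [hs, inv_pow, Real.sq_sqrt hcs.le]
  have hc3 : cs ^ (-3 / 2 : ℝ) = s ^ 3 := by simpa [hs] using hrpow hcs 3
  have hc5 : cs ^ (-5 / 2 : ℝ) = s ^ 5 := by simpa [hs] using hrpow hcs 5
  have hm0 : 0 < ‖p.X₁‖ := by
    refine lt_of_le_of_ne (norm_nonneg _) fun h => ?_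
    rw [← h, inv_zero, mul_zero] at htδ
    exact absurd htδ (not_le.2 ht₀)
  have hsm : 1 ≤ s * ‖p.X₁‖ := by
    rw [hs, inv_mul_eq_div, le_div_iff₀ hsc, one_mul, Real.sqrt_le_left hm0.le]
    exact hQ.le_norm_sq hnd hcs ht₀
  have htq : ∀ t, |t| ≤ t₀ → |t| * (q * ‖p.X₁‖) ≤ 1 := fun t ht => by
    rw [← Real.sqrt_eq_rpow] at htδ
    calc |t| * (q * ‖p.X₁‖) ≤ √δ * ‖p.X₁‖⁻¹ * (q * ‖p.X₁‖) := by
          gcongr; exact ht.trans htδ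
      _ = 1 := by rw [hq]; field_simp
  rw [hδ1, hδ2, hc1, hc2, hc3, hc5]
  have hNn := hQ.norm_N_le
  constructor
  · rintro hN C₁ C₇ C₉ C₁₀ rfl rfl rfl rfl ε τ t hε ht
    -- for `N = 0` the commutator equation has the solution `D = 0`
    have hD : ∀ ω : p.𝔑, p.N ω + (p.S ((0 : p.𝔑 →L[ℂ] p.𝔑) ω) : H) -
        ((0 : p.𝔑 →L[ℂ] p.𝔑) (p.S ω) : H) = 0 := fun ω => by simp [hN]
    have hb : q * ‖p.X₁‖ + ‖(0 : p.𝔑 →L[ℂ] p.𝔑)‖ ≤ q * ‖p.X₁‖ := by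
      have : ‖(0 : p.𝔑 →L[ℂ] p.𝔑)‖ ≤ 0 := ContinuousLinearMap.opNorm_zero.le
      linarith
    refine hQ.interpolated_bounds hD hb hnd hcs ht₀ ht (htq t ht) hs ?_ ?_ ?_ ?_ hε τ
    · exact le_of_eq (by ring)
    all_goals
      generalize ‖p.X₁‖ = m at *
    · calc 30 * s * (q * m ^ 3) * (q * m) = 30 * q ^ 2 * m ^ 3 * (s * m) := by ring
        _ ≤ _ := by
          gcongr
          have : 0 ≤ 1 + s ^ 3 * m ^ 3 + s ^ 5 * m ^ 5 := by positivity
          linarith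
    · calc 10 * s * (q * m) = 10 * q * s * m * 1 := by ring
        _ ≤ _ := by
          gcongr
          have : 0 ≤ s ^ 2 * m ^ 2 := by positivity
          linarith
    · calc 30 * s ^ 2 * (q * m ^ 3) * (q * m) = s * (30 * q ^ 2 * m ^ 3 * (s * m)) := by ring
        _ ≤ _ := by
          gcongr
          have : 0 ≤ 1 + s ^ 3 * m ^ 3 + s ^ 5 * m ^ 5 := by positivity
          linarith
  · rintro hN₀ κ C₁₁ C₁₂ C₁₃ C₁₄ rfl rfl rfl rfl rfl t₀₀ ht₀₀ _ ε τ t hε ht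
    obtain ⟨D, hD, hDn⟩ := OperatorPencil.Pencil.exists_commutator_solution hQ.N_mem hN₀ hcs
    have hκ : 0 ≤ ((p.cCirc cs)⁻¹).toReal := ENNReal.toReal_nonneg
    have hn : (1 : ℝ) ≤ p.n := by exact_mod_cast p.n_pos
    have hb : q * ‖p.X₁‖ + ‖D‖ ≤
        q * ‖p.X₁‖ * (1 + 2 * (p.n * ((p.cCirc cs)⁻¹).toReal * ‖p.X₁‖ ^ 2)) := by
      calc q * ‖p.X₁‖ + ‖D‖
          ≤ q * ‖p.X₁‖ + p.n * ((p.cCirc cs)⁻¹).toReal * (2 * q * ‖p.X₁‖ ^ 3) := by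
            gcongr
            exact hDn.trans (by gcongr)
        _ = _ := by ring
    refine hQ.interpolated_bounds hD hb hnd hcs ht₀ (ht.trans ht₀₀) (htq t (ht.trans ht₀₀)) hs
      ?_ ?_ ?_ ?_ hε τ
    all_goals
      generalize ‖p.X₁‖ = m at *
      generalize ((p.cCirc cs)⁻¹).toReal = κ at *
      generalize (p.n : ℝ) = n at *
      have hx0 : 0 ≤ n * κ * m ^ 2 := by positivity
      -- `n κ m² ≤ n² s m³ κ`, since `1 ≤ n` and `1 ≤ s m`
      have hx : n * κ * m ^ 2 ≤ n ^ 2 * s * m ^ 3 * κ := by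
        calc n * κ * m ^ 2 ≤ n * κ * m ^ 2 * (n * (s * m)) :=
              le_mul_of_one_le_right hx0 (one_le_mul_of_one_le_of_one_le hn hsm)
          _ = _ := by ring
      have hC : 30 * s * (q * m ^ 3) * (q * m * (1 + 2 * (n * κ * m ^ 2))) ≤
          60 * q ^ 2 * m ^ 3 * (1 + s * m + s ^ 3 * m ^ 3 + s ^ 5 * m ^ 5) +
            60 * q ^ 2 * s * m ^ 8 * n ^ 2 * κ ^ 2 := by
        calc _ = 60 * q ^ 2 * m ^ 3 * (s * m) * ((1 + 2 * (n * κ * m ^ 2)) / 2) := by ring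
          _ ≤ 60 * q ^ 2 * m ^ 3 * (s * m) * (1 + (n * κ * m ^ 2) ^ 2) := by
            gcongr
            nlinarith only [sq_nonneg (n * κ * m ^ 2 - 1 / 2)]
          _ = 60 * q ^ 2 * m ^ 3 * (s * m) + 60 * q ^ 2 * s * m ^ 8 * n ^ 2 * κ ^ 2 := by ring
          _ ≤ _ := by
            gcongr
            have : 0 ≤ 1 + s ^ 3 * m ^ 3 + s ^ 5 * m ^ 5 := by positivity
            linarith
    · calc 10 * (q * m * (1 + 2 * (n * κ * m ^ 2)))
          = 20 * q * m * (1 / 2 + n * κ * m ^ 2) := by ring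
        _ ≤ _ := by gcongr; norm_num
    · exact hC
    · calc 10 * s * (q * m * (1 + 2 * (n * κ * m ^ 2)))
          = 20 * q * s * m * (1 / 2 + n * κ * m ^ 2) := by ring
        _ ≤ _ := by
          gcongr
          have : 0 ≤ s ^ 2 * m ^ 2 := by positivity
          linarith
    · calc 30 * s ^ 2 * (q * m ^ 3) * (q * m * (1 + 2 * (n * κ * m ^ 2)))
          = s * (30 * s * (q * m ^ 3) * (q * m * (1 + 2 * (n * κ * m ^ 2)))) := by ring
        _ ≤ _ := by gcongr
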